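/- Let $M,N\ge 0$ and let $\mathcal A=\{a_1,\dots,a_M\}$, $\mathcal X=\{x_1,\dots,x_N\}$ be disjoint alphabets. A shuffle word is a word with distinct letters from $\mathcal A\cup\mathcal X$ in which the letters of each alphabet occur in increasing order of their subscripts. The poset of shuffles $W_{MN}$ consists of the shuffle words, with $w\lessdot w'$ iff $w'$ arises from $w$ by deleting a letter of $\mathcal A$ or by inserting a letter of $\mathcal X$ (so that $w'$ is again a shuffle word); it is ranked, of rank $n=M+N$, with $\hat 0=a_1\cdots a_M$ and $\hat 1=x_1\cdots x_N$. Let $\rho$ be its rank function. For a maximal chain $c=(\hat 0=w^0\lessdot w^1\lessdot\cdots\lessdot w^n=\hat 1)$ define the label sequence $\Lambda(c)=(\Lambda_1(c),\dots,\Lambda_n(c))$ as follows. If $w^{i}$ arises from $w^{i-1}$ by inserting $x_k$, then $\Lambda_i(c)=x_k$. If $w^{i-1}=u\,x_k\,a_m\,v$ and $w^i=u\,x_k\,v$, and this is the first deletion along $c$ (starting from $\hat 0$) of a letter located immediately after $x_k$, then $\Lambda_i(c)=x_k$. In all other cases $w^i$ arises from $w^{i-1}$ by deleting a letter $a_j$,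 and $\Lambda_i(c)=a_j$. Let $F_{W_{MN}}=\sum x_1^{\rho(t_1)}x_2^{\rho(t_2)-\rho(t_1)}\cdots x_{k+1}^{n-\rho(t_k)}$ be the formal power series in variables $x_1,x_2,\dots$ in which the sum is over all $k\ge 0$ and all multichains $\hat 0\le t_1\le\cdots\le t_k<\hat 1$ in $W_{MN}$ (the term for $k=0$ is $x_1^n$). For a character $\psi$ of $S_n$ let $\mathrm{ch}(\psi)=\sum_{\lambda\vdash n}\frac{\psi(\lambda)}{z_\lambda}p_\lambda$ be its Frobenius characteristic, where $\psi(\lambda)$ is the value of $\psi$ on the permutations of cycle type $\lambda$, $z_\lambda=\lambda_1\lambda_2\cdots m_1!\,m_2!\cdots$ with $m_i$ the multiplicity of $i$ as a part of $\lambda$, and $p_\lambda$ is the power sum symmetric function. Let $e_r$ and $h_r$ be the elementary and complete homogeneous symmetric functions, and $\omega$ the algebra endomorphism of the symmetric functions with $\omega(e_r)=h_r$ for all $r\ge 1$. **Corollary 4.5.** For every $\sigma\in S_{M+N}$ and every maximal chain $c$ of $W_{MN}$ there is exactly one maximal chain $\sigma\cdot c$ whose label sequence is obtained from $\Lambda(c)$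 by permuting the coordinates according to $\sigma$, that is, $\Lambda_i(\sigma\cdot c)=\Lambda_{\sigma^{-1}(i)}(c)$ for all $i$. This defines an action of $S_{M+N}$ on the maximal chains of $W_{MN}$, and the action is local: for every adjacent transposition $\sigma_i=(i,i+1)$ and every maximal chain $c$, the chain $\sigma_i\cdot c$ differs from $c$ at most in the element of rank $i$. Moreover $F_{W_{MN}}$ is a symmetric function and, if $\psi$ denotes the character of the corresponding representation of $S_{M+N}$ on the complex vector space with basis the maximal chains, then $$\mathrm{ch}(\psi)=\sum_{k\ge 0}\binom Mk\binom Nk h_2^k h_1^{M+N-2k}=\omega F_{W_{MN}},\qquad F_{W_{MN}}=\sum_{k\ge 0}\binom Mk\binom Nk e_2^k e_1^{M+N-2k}.$$ -/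

import Mathlib

noncomputable section
namespace SymFun

open MvPowerSeries

/-- The algebra of symmetric functions with complex coefficients in the variables
`x 0, x 1, …`: the formal power series of bounded degree that are invariant under all
permutations of the variables. -/
def symFun : Subalgebra ℂ (MvPowerSeries ℕ ℂ) where
  carrier := {f | (∀ e : Equiv.Perm ℕ, renameEquiv ℂ e f = f) ∧
    ∃ d : ℕ, ∀ m : ℕ →₀ ℕ, coeff m f ≠ 0 → m.degree ≤ d}
  mul_mem' := by
    rintro f g ⟨hf, d, hd⟩ ⟨hg, d', hd'⟩
    refine ⟨fun e => by rw [map_mul, hf, hg], d + d', fun m hm => ?_⟩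
    classical
    rw [coeff_mul] at hm
    obtain ⟨p, hp, hne⟩ := Finset.exists_ne_zero_of_sum_ne_zero hm
    rw [Finset.HasAntidiagonal.mem_antidiagonal] at hp
    rw [← hp, map_add]
    exact add_le_add (hd _ (left_ne_zero_of_mul hne)) (hd' _ (right_ne_zero_of_mul hne))
  add_mem' := by
    rintro f g ⟨hf, d, hd⟩ ⟨hg, d', hd'⟩
    refine ⟨fun e => by rw [map_add, hf, hg], max d d', fun m hm => ?_⟩
    rw [map_add] at hm
    by_cases h : coeff m f = 0
    · exact (hd' m (by simpa [h] using hm)).trans (le_max_right _ _)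
    · exact (hd m h).trans (le_max_left _ _)
  algebraMap_mem' := by
    intro r
    refine ⟨fun e => AlgEquiv.commutes _ r, 0, fun m hm => ?_⟩
    classical
    rw [← c_eq_algebraMap, coeff_C] at hm
    by_cases h : m = 0
    · simp [h]
    · simp [h] at hm

lemma mem_symFun_of_coeff (f : (ℕ →₀ ℕ) → ℂ) (d : ℕ)
    (hs : ∀ (e : Equiv.Perm ℕ) (m : ℕ →₀ ℕ), f (m.embDomain e.toEmbedding) = f m)
    (hd : ∀ m : ℕ →₀ ℕ, f m ≠ 0 → m.degree ≤ d) : (f : MvPowerSeries ℕ ℂ) ∈ symFun := by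
  refine ⟨fun e => ?_, d, hd⟩
  ext m
  obtain ⟨m', rfl⟩ : ∃ m' : ℕ →₀ ℕ, m'.embDomain e.toEmbedding = m :=
    ⟨m.embDomain e.symm.toEmbedding, by
      ext i
      obtain ⟨j, rfl⟩ := e.surjective i
      have h1 := Finsupp.embDomain_apply_self e.toEmbedding (m.embDomain e.symm.toEmbedding) j
      have h2 := Finsupp.embDomain_apply_self e.symm.toEmbedding m (e j)
      simp only [Equiv.toEmbedding_apply, Equiv.symm_apply_apply] at h1 h2
      rw [h1, h2]⟩
  exact (coeff_embDomain_rename e.toEmbedding f m').trans (hs e m').symm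

lemma coeff_embDomain_of_mem {f : MvPowerSeries ℕ ℂ} (hf : f ∈ symFun) (e : Equiv.Perm ℕ)
    (m : ℕ →₀ ℕ) : coeff (m.embDomain e.toEmbedding) f = coeff m f := by
  conv_lhs => rw [← hf.1 e]
  exact coeff_embDomain_rename e.toEmbedding f m

lemma degree_embDomain {α β : Type*} (e : α ↪ β) (m : α →₀ ℕ) :
    (m.embDomain e).degree = m.degree := by
  simp only [Finsupp.degree_apply, Finsupp.support_embDomain, Finset.sum_map,
    Finsupp.embDomain_apply_self]

open Classical in
/-- The elementary symmetric function `e_r`. -/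
def elem (r : ℕ) : symFun :=
  ⟨fun m => if m.degree = r ∧ ∀ i, m i ≤ 1 then 1 else 0, by
    apply mem_symFun_of_coeff _ r
    · intro e m
      rw [degree_embDomain]
      have : (∀ i, m.embDomain e.toEmbedding i ≤ 1) ↔ ∀ i, m i ≤ 1 := by
        rw [← e.forall_congr_right]
        exact forall_congr' fun i => by
          rw [← Finsupp.embDomain_apply_self e.toEmbedding m i]; rfl
      rw [this]
    · intro m hm
      simp only [ne_eq, ite_eq_right_iff, not_forall] at hm
      exact hm.1.1.le⟩

/-- The complete homogeneous symmetric function `h_r`. -/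
def homog (r : ℕ) : symFun :=
  ⟨fun m => if m.degree = r then 1 else 0, by
    apply mem_symFun_of_coeff _ r
    · intro e m
      rw [degree_embDomain]
    · intro m hm
      simp only [ne_eq, ite_eq_right_iff, not_forall] at hm
      exact hm.1.le⟩

open Classical in
/-- The power sum symmetric function `p_r` (used for `r ≥ 1`). -/
def psum (r : ℕ) : symFun :=
  ⟨fun m => if ∃ i, m = Finsupp.single i r then 1 else 0, by
    apply mem_symFun_of_coeff _ r
    · intro e m
      have : (∃ i, m.embDomain e.toEmbedding = Finsupp.single i r) ↔
          ∃ i, m = Finsupp.single i r := by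
        rw [← e.exists_congr_right]
        refine exists_congr fun i => ?_
        rw [← (Finsupp.embDomain_injective e.toEmbedding).eq_iff (a := m),
          Finsupp.embDomain_single]
        rfl
      rw [this]
    · intro m hm
      simp only [ne_eq, ite_eq_right_iff, not_forall] at hm
      obtain ⟨⟨i, rfl⟩, -⟩ := hm
      simp⟩

/-- The algebra map from polynomials to symmetric functions sending the `i`-th variable
to `e_{i+1}`. -/
def elemHom : MvPolynomial ℕ ℂ →ₐ[ℂ] symFun :=
  MvPolynomial.aeval fun i => elem (i + 1)

/-- Setting `x n = x (n+1) = … = 0`. -/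
abbrev restr (n : ℕ) : MvPowerSeries ℕ ℂ →ₐ[ℂ] MvPowerSeries (Fin n) ℂ :=
  killCompl Fin.valEmbedding

lemma restr_elem (n r : ℕ) :
    restr n (elem r : MvPowerSeries ℕ ℂ) = (MvPolynomial.esymm (Fin n) ℂ r : MvPowerSeries _ ℂ) := by
  classical
  ext m
  rw [coeff_killCompl, MvPolynomial.coeff_coe, MvPolynomial.esymm_eq_sum_monomial,
    MvPolynomial.coeff_sum]
  simp only [MvPolynomial.coeff_monomial]
  change (if _ then _ else _) = _
  rw [degree_embDomain]
  have key : ∀ t : Finset (Fin n), (∑ i ∈ t, Finsupp.single i 1 : Fin n →₀ ℕ) = m ↔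
      (∀ i, m i ≤ 1) ∧ t = m.support := by
    intro t
    have ht : ∀ i, (∑ j ∈ t, Finsupp.single j 1 : Fin n →₀ ℕ) i = if i ∈ t then 1 else 0 := by
      intro i
      simp [Finsupp.finsetSum_apply, Finsupp.single_apply]
    constructor
    · rintro rfl
      refine ⟨fun i => by rw [ht]; split_ifs <;> simp, ?_⟩
      ext i
      rw [Finsupp.mem_support_iff, ht]
      simp
    · rintro ⟨h1, rfl⟩
      ext i
      rw [ht]
      have := h1 i
      by_cases h : m i = 0 <;> simp [h]
      omega
  simp only [key]
  have hle : (∀ i, m.embDomain Fin.valEmbedding i ≤ 1) ↔ ∀ i, m i ≤ 1 := by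
    constructor
    · intro h i
      rw [← Finsupp.embDomain_apply_self Fin.valEmbedding m i]; exact h _
    · intro h i
      by_cases hi : i ∈ Set.range (Fin.valEmbedding (n := n))
      · obtain ⟨j, rfl⟩ := hi
        rw [Finsupp.embDomain_apply_self]; exact h j
      · rw [Finsupp.embDomain_of_notMem_range _ _ _ hi]; simp
  rw [hle]
  by_cases h1 : ∀ i, m i ≤ 1
  · have hdeg : m.degree = m.support.card := by
      rw [Finsupp.degree_apply, Finset.card_eq_sum_ones]
      refine Finset.sum_congr rfl fun i hi => ?_
      have := h1 i
      have := Finsupp.mem_support_iff.1 hi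
      omega
    simp [h1, hdeg, Finset.sum_ite_eq', Finset.mem_powersetCard]
  · simp [h1]

lemma restr_elemHom (n : ℕ) (Q : MvPolynomial (Fin n) ℂ) :
    restr n (elemHom (MvPolynomial.rename Fin.val Q) : MvPowerSeries ℕ ℂ) =
      ((MvPolynomial.esymmAlgHom (Fin n) ℂ n Q : MvPolynomial (Fin n) ℂ) :
        MvPowerSeries (Fin n) ℂ) := by
  induction Q using MvPolynomial.induction_on with
  | C a =>
    simp only [← MvPolynomial.algebraMap_eq, AlgHom.commutes, Subalgebra.coe_algebraMap]
    rw [MvPolynomial.algebraMap_eq, MvPolynomial.coe_C, c_eq_algebraMap]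
  | add p q hp hq =>
    simp only [map_add, Subalgebra.coe_add, hp, hq, MvPolynomial.coe_add]
  | mul_X p i hp =>
    simp only [map_mul, Subalgebra.coe_mul, hp, MvPolynomial.coe_mul]
    congr 1
    simp only [MvPolynomial.rename_X, elemHom, MvPolynomial.aeval_X, MvPolynomial.esymmAlgHom]
    exact restr_elem n (i + 1)

lemma eq_zero_of_restr (n : ℕ) (P : MvPolynomial ℕ ℂ) (hP : ↑P.vars ⊆ Set.range (Fin.val (n := n)))
    (h : restr n (elemHom P : MvPowerSeries ℕ ℂ) = 0) : P = 0 := by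
  obtain ⟨Q, rfl⟩ := MvPolynomial.exists_rename_eq_of_vars_subset_range P _ Fin.val_injective hP
  rw [restr_elemHom, MvPolynomial.coe_eq_zero_iff] at h
  have : Q = 0 := (injective_iff_map_eq_zero _).1 (MvPolynomial.esymmAlgHom_fin_injective ℂ le_rfl)
    Q (Subtype.ext h)
  rw [this, map_zero]

/-- The elementary symmetric functions are algebraically independent. -/
lemma elemHom_injective : Function.Injective elemHom := by
  rw [injective_iff_map_eq_zero]
  intro P hP
  refine eq_zero_of_restr (P.vars.sup id + 1) P (fun i hi => ?_) (by rw [hP]; simp)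
  have : i ≤ P.vars.sup id := Finset.le_sup (f := id) (by simpa using hi)
  exact ⟨⟨i, by omega⟩, rfl⟩

lemma elem_isHomogeneous (r : ℕ) : IsHomogeneous (elem r : MvPowerSeries ℕ ℂ) r := by
  classical
  intro m hm
  change (if _ then _ else _) ≠ _ at hm
  simp only [ne_eq, ite_eq_right_iff, not_forall] at hm
  exact (DFunLike.congr_fun Finsupp.degree_eq_weight_one.symm m).trans hm.1.1

lemma elemHom_monomial_isHomogeneous (s : ℕ →₀ ℕ) (c : ℂ) :
    IsHomogeneous (elemHom (MvPolynomial.monomial s c) : MvPowerSeries ℕ ℂ)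
      (Finsupp.weight (fun i : ℕ => i + 1) s) := by
  classical
  induction s using Finsupp.induction_linear generalizing c with
  | zero =>
    intro m hm
    rw [← MvPolynomial.C_apply, ← MvPolynomial.algebraMap_eq, AlgHom.commutes,
      Subalgebra.coe_algebraMap, ← c_eq_algebraMap, coeff_C] at hm
    have : m = 0 := by by_contra h; simp [h] at hm
    simp [this]
  | add s t hs ht =>
    have : (MvPolynomial.monomial (s + t) c : MvPolynomial ℕ ℂ) =
        MvPolynomial.monomial s c * MvPolynomial.monomial t 1 := by
      rw [MvPolynomial.monomial_mul, mul_one]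
    rw [this, map_mul, map_add]
    intro m
    exact IsHomogeneous.mul (fun {_} => hs c) (fun {_} => ht 1)
  | single i n =>
    induction n generalizing c with
    | zero =>
      intro m hm
      rw [Finsupp.single_zero, ← MvPolynomial.C_apply, ← MvPolynomial.algebraMap_eq,
        AlgHom.commutes, Subalgebra.coe_algebraMap, ← c_eq_algebraMap, coeff_C] at hm
      have : m = 0 := by by_contra h; simp [h] at hm
      simp [this]
    | succ n ih =>
      have : (MvPolynomial.monomial (Finsupp.single i (n + 1)) c : MvPolynomial ℕ ℂ) =
          MvPolynomial.monomial (Finsupp.single i n) c * MvPolynomial.X i := by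
        rw [MvPolynomial.X, MvPolynomial.monomial_mul, mul_one, Finsupp.single_add]
      have hw : Finsupp.weight (fun i : ℕ => i + 1) (Finsupp.single i (n + 1)) =
          Finsupp.weight (fun i : ℕ => i + 1) (Finsupp.single i n) + (i + 1) := by
        simp [Finsupp.weight_single]
      rw [this, map_mul, hw]
      intro m
      refine IsHomogeneous.mul (fun {_} => ih c) (q := i + 1) ?_
      rw [elemHom, MvPolynomial.aeval_X]
      exact elem_isHomogeneous (i + 1)

lemma coeff_elemHom_component (P : MvPolynomial ℕ ℂ) (k : ℕ) (m : ℕ →₀ ℕ) :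
    coeff m (elemHom (MvPolynomial.weightedHomogeneousComponent (fun i : ℕ => i + 1) k P) :
      MvPowerSeries ℕ ℂ) =
      if m.degree = k then coeff m (elemHom P : MvPowerSeries ℕ ℂ) else 0 := by
  classical
  induction P using MvPolynomial.induction_on' with
  | monomial s c =>
    have h1 := MvPolynomial.weightedHomogeneousComponent_of_mem (m := k)
      (MvPolynomial.isWeightedHomogeneous_monomial (fun i : ℕ => i + 1) s c rfl)
    rw [h1]
    by_cases h : k = Finsupp.weight (fun i : ℕ => i + 1) s
    · rw [if_pos h]
      split_ifs with h2
      · rfl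
      · exact IsHomogeneous.coeff_eq_zero (fun {_} => elemHom_monomial_isHomogeneous s c) (h ▸ h2)
    · rw [if_neg h]
      split_ifs with h2
      · rw [IsHomogeneous.coeff_eq_zero (fun {_} => elemHom_monomial_isHomogeneous s c) (h2 ▸ h)]; simp
      · simp
  | add p q hp hq =>
    simp only [map_add, Subalgebra.coe_add, hp, hq]
    split_ifs <;> simp

/-- Every finite set of variables of size at most `n` is moved into `{0, …, n-1}` by a
permutation. -/
lemma exists_perm_embDomain (n : ℕ) (m : ℕ →₀ ℕ) (hm : m.support.card ≤ n) :
    ∃ (e : Equiv.Perm ℕ) (m' : Fin n →₀ ℕ),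
      m.embDomain e.toEmbedding = m'.embDomain Fin.valEmbedding := by
  obtain ⟨e, he⟩ : ∃ e : Equiv.Perm ℕ, ∀ i ∈ m.support, e i < n := by
    obtain ⟨f⟩ : Nonempty (m.support ↪ Fin n) :=
      Function.Embedding.nonempty_of_card_le (by simpa using hm)
    obtain ⟨e, he⟩ := Equiv.Perm.exists_extending_pair
      (f := fun x : m.support => (x : ℕ)) (g := fun x => (f x : ℕ))
      Subtype.val_injective (Fin.val_injective.comp f.injective)
    exact ⟨e, fun i hi => by have := he ⟨i, hi⟩; simp_all⟩
  refine ⟨e, (m.embDomain e.toEmbedding).comapDomain Fin.val Fin.val_injective.injOn, ?_⟩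
  refine (Finsupp.embDomain_comapDomain (f := Fin.valEmbedding) fun i hi => ?_).symm
  obtain ⟨j, hj, rfl⟩ : ∃ j ∈ m.support, e j = i := by
    obtain ⟨j, hj, rfl⟩ := Finset.mem_map.1 (Finset.mem_coe.1 hi)
    exact ⟨j, hj, rfl⟩
  exact ⟨⟨e j, he j hj⟩, rfl⟩

lemma elemHom_surjective : Function.Surjective elemHom := by
  classical
  rintro ⟨f, hf⟩
  obtain ⟨d, hd⟩ := hf.2
  -- the restriction of `f` to `d` variables is a symmetric polynomial
  obtain ⟨g, hg⟩ : ∃ g : MvPolynomial (Fin d) ℂ, (g : MvPowerSeries (Fin d) ℂ) = restr d f := by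
    refine ⟨∑ m ∈ (Finsupp.finite_of_degree_le (σ := Fin d) d).toFinset,
      MvPolynomial.monomial m (coeff m (restr d f)), ?_⟩
    ext m
    rw [MvPolynomial.coeff_coe, MvPolynomial.coeff_sum]
    simp only [MvPolynomial.coeff_monomial, Finset.sum_ite_eq', Set.Finite.mem_toFinset,
      Set.mem_ofPred_eq, ite_eq_left_iff]
    intro hm
    by_contra h
    exact hm (degree_embDomain Fin.valEmbedding m ▸ hd _ (Ne.symm h))
  have hgs : g.IsSymmetric := by
    intro e
    obtain ⟨e', he'⟩ := Equiv.Perm.exists_extending_pair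
      (f := fun x : Fin d => (x : ℕ)) (g := fun x => (e x : ℕ))
      Fin.val_injective (Fin.val_injective.comp e.injective)
    ext m
    obtain ⟨m, rfl⟩ : ∃ m', Finsupp.mapDomain e m' = m :=
      ⟨Finsupp.mapDomain e.symm m, by rw [← Finsupp.mapDomain_comp]; simp⟩
    rw [MvPolynomial.coeff_rename_mapDomain _ e.injective, ← MvPolynomial.coeff_coe,
      ← MvPolynomial.coeff_coe, hg, coeff_killCompl, coeff_killCompl,
      ← coeff_embDomain_of_mem hf e']
    congr 1
    simp only [Finsupp.embDomain_eq_mapDomain, ← Finsupp.mapDomain_comp]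
    congr 1
    have hfun : (e'.toEmbedding : ℕ → ℕ) ∘ (Fin.valEmbedding : Fin d → ℕ) =
        (Fin.valEmbedding : Fin d → ℕ) ∘ e := funext he'
    rw [hfun]
  obtain ⟨Q, hQ⟩ := (MvPolynomial.esymmAlgHom_fin_bijective ℂ d).2 ⟨g, hgs⟩
  set P := MvPolynomial.rename Fin.val Q with hP
  have hres : restr d (elemHom P : MvPowerSeries ℕ ℂ) = restr d f := by
    rw [hP, restr_elemHom, hQ, hg]
  have hvan : ∀ k, d < k →
      MvPolynomial.weightedHomogeneousComponent (fun i : ℕ => i + 1) k P = 0 := by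
    intro k hk
    apply eq_zero_of_restr d
    · intro i hi
      obtain ⟨s, hs, hi⟩ := (MvPolynomial.mem_vars_iff_mem_support i).1 (Finset.mem_coe.1 hi)
      have hs' : s ∈ P.support := by
        rw [MvPolynomial.mem_support_iff, MvPolynomial.coeff_weightedHomogeneousComponent] at hs
        rw [MvPolynomial.mem_support_iff]
        exact fun h => hs (by simp [h])
      have hi' := MvPolynomial.vars_rename Fin.val Q ((MvPolynomial.mem_vars_iff_mem_support i).2 ⟨s, hs', hi⟩)
      obtain ⟨j, -, rfl⟩ := Finset.mem_image.1 hi'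
      exact ⟨j, rfl⟩
    · ext m
      rw [coeff_killCompl, coeff_elemHom_component]
      split_ifs with h
      · rw [← coeff_killCompl, hres, coeff_killCompl]
        by_contra h'
        have := hd _ h'
        omega
      · simp
  refine ⟨P, Subtype.ext ?_⟩
  ext m
  change coeff m (elemHom P : MvPowerSeries ℕ ℂ) = coeff m f
  by_cases hm : m.degree ≤ d
  · obtain ⟨e, m', he⟩ := exists_perm_embDomain d m (by
      refine le_trans ?_ hm
      rw [Finsupp.degree_apply, Finset.card_eq_sum_ones]
      exact Finset.sum_le_sum fun i hi => Nat.one_le_iff_ne_zero.2 (Finsupp.mem_support_iff.1 hi))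
    rw [← coeff_embDomain_of_mem (elemHom P).2 e, ← coeff_embDomain_of_mem hf e, he,
      ← coeff_killCompl, ← coeff_killCompl, hres]
  · have h0 := coeff_elemHom_component P m.degree m
    rw [if_pos rfl, hvan _ (by omega)] at h0
    rw [← h0]
    by_contra h
    have := hd m (fun h' => h (by rw [h']; simp))
    omega

/-- The symmetric functions are the polynomials in `e_1, e_2, …`. -/
def elemEquiv : MvPolynomial ℕ ℂ ≃ₐ[ℂ] symFun :=
  AlgEquiv.ofBijective elemHom ⟨elemHom_injective, elemHom_surjective⟩

/-- The standard involution `ω` on symmetric functions: the algebra homomorphism with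
`ω e_r = h_r` for all `r ≥ 1`. -/
def omega : symFun →ₐ[ℂ] symFun :=
  (MvPolynomial.aeval fun i : ℕ => homog (i + 1) : MvPolynomial ℕ ℂ →ₐ[ℂ] symFun).comp
    (elemEquiv.symm : symFun →ₐ[ℂ] MvPolynomial ℕ ℂ)

lemma omega_elem (r : ℕ) : omega (elem (r + 1)) = homog (r + 1) := by
  have : elemEquiv.symm (elem (r + 1)) = MvPolynomial.X r := by
    rw [AlgEquiv.symm_apply_eq]
    exact (MvPolynomial.aeval_X (R := ℂ) (fun i : ℕ => elem (i + 1)) r).symm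
  simp [omega, this]

lemma exists_perm_partition {n : ℕ} (l : n.Partition) :
    ∃ σ : Equiv.Perm (Fin n), σ.partition.parts = l.parts := by
  classical
  have hle : (l.parts.filter (2 ≤ ·)).sum + (l.parts.filter fun i => ¬ 2 ≤ i).sum = n := by
    rw [← Multiset.sum_add, Multiset.filter_add_not, l.parts_sum]
  obtain ⟨σ, hσ⟩ := (Equiv.Perm.exists_with_cycleType_iff (Fin n)
    (m := l.parts.filter (2 ≤ ·))).2 ⟨by rw [Fintype.card_fin]; omega, by simp⟩
  refine ⟨σ, ?_⟩
  have h1 : l.parts.filter (fun i => ¬ 2 ≤ i) =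
      Multiset.replicate (Multiset.card (l.parts.filter fun i => ¬ 2 ≤ i)) 1 := by
    rw [Multiset.eq_replicate]
    refine ⟨rfl, fun b hb => ?_⟩
    rw [Multiset.mem_filter] at hb
    have := l.parts_pos hb.1
    omega
  have h2 : (l.parts.filter fun i => ¬ 2 ≤ i).sum =
      Multiset.card (l.parts.filter fun i => ¬ 2 ≤ i) := by
    rw [h1]; simp
  rw [h2] at hle
  rw [Equiv.Perm.parts_partition, ← Equiv.Perm.sum_cycleType, hσ, Fintype.card_fin]
  conv_rhs => rw [← Multiset.filter_add_not (2 ≤ ·) l.parts, h1]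
  congr 2
  omega

/-- The value of a class function `ψ` of `S_n` on the conjugacy class of permutations of cycle
type `l` (fixed points count as parts equal to `1`). -/
def classValue {n : ℕ} (ψ : Equiv.Perm (Fin n) → ℂ) (l : n.Partition) : ℂ :=
  ψ (exists_perm_partition l).choose

/-- `z_λ = λ₁ λ₂ ⋯ m₁! m₂! ⋯`, where `m_i` is the multiplicity of `i` as a part of `λ`. -/
def zee {n : ℕ} (l : n.Partition) : ℕ :=
  l.parts.prod * ∏ i ∈ l.parts.toFinset, (l.parts.count i).factorial

/-- The power sum symmetric function `p_λ = p_{λ₁} p_{λ₂} ⋯`. -/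
def psumPartition {n : ℕ} (l : n.Partition) : symFun :=
  (l.parts.map psum).prod

/-- The Frobenius characteristic `ch(ψ) = ∑_{λ ⊢ n} (ψ(λ) / z_λ) p_λ` of a class function `ψ`
of the symmetric group `S_n`. -/
def frobeniusChar {n : ℕ} (ψ : Equiv.Perm (Fin n) → ℂ) : symFun :=
  ∑ l : n.Partition, (classValue ψ l / (zee l : ℂ)) • psumPartition l

end SymFun

namespace Ranked

variable (P : Type*) [PartialOrder P] [BoundedOrder P]

/-- The maximal chains `⊥ = w 0 ⋖ w 1 ⋖ ⋯ ⋖ w n = ⊤` of a bounded poset of rank `n`. -/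
structure MaxChain (n : ℕ) where
  /-- the element of rank `i` -/
  elt : Fin (n + 1) → P
  elt_zero : elt 0 = ⊥
  elt_last : elt (Fin.last n) = ⊤
  covBy : ∀ i : Fin n, elt i.castSucc ⋖ elt i.succ

variable {P}

/-- A representation of `S_n` on the complex vector space with basis the maximal chains of `P`
is local if for every adjacent transposition `σ_i` (exchanging the `i`-th and the `(i+1)`-st
coordinate, `1 ≤ i < n`) and every maximal chain `c`, only maximal chains that differ from `c`
at most in the element of rank `i` occur in `σ_i c` with a nonzero coefficient. -/
def IsLocal {n : ℕ}
    (ρ : Representation ℂ (Equiv.Perm (Fin n)) (MonoidAlgebra ℂ (MaxChain P n))) : Prop :=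
  ∀ (i : ℕ) (h1 : 1 ≤ i) (hn : i < n) (c c' : MaxChain P n),
    (ρ (Equiv.swap ⟨i - 1, by omega⟩ ⟨i, hn⟩) (MonoidAlgebra.single c 1)).coeff c' ≠ 0 →
      ∀ r : Fin (n + 1), (r : ℕ) ≠ i → c'.elt r = c.elt r

/-- A finite sequence `t 1, …, t k` of elements, bordered by `t 0 = ⊥` and `t (k+1) = ⊤`. -/
def bordered {k : ℕ} (t : Fin k → P) (j : ℕ) : P :=
  if j = 0 then ⊥ else if h : j - 1 < k then t ⟨j - 1, h⟩ else ⊤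

variable (P) in
/-- The multichains `⊥ ≤ t 1 ≤ ⋯ ≤ t k < ⊤` of arbitrary length `k ≥ 0`. -/
structure Multichain where
  /-- the length -/
  k : ℕ
  /-- the elements -/
  t : Fin k → P
  monotone : Monotone t
  lt_top : ∀ i, t i < ⊤

/-- The exponent vector of the monomial
`x_1^{ρ(t_1)} x_2^{ρ(t_2) - ρ(t_1)} ⋯ x_{k+1}^{n - ρ(t_k)}` belonging to a multichain
(the variable `x_{j+1}` has the index `j`). -/
def Multichain.exponent [GradeOrder ℕ P] (c : Multichain P) : ℕ →₀ ℕ :=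
  ∑ j ∈ Finset.range (c.k + 1),
    Finsupp.single j (grade ℕ (bordered c.t (j + 1)) - grade ℕ (bordered c.t j))

variable (P) in
/-- The formal power series `F_P`, the sum of the monomials of all multichains
`⊥ ≤ t 1 ≤ ⋯ ≤ t k < ⊤`: its coefficient at a monomial is the number of multichains which
contribute that monomial. -/
def flagSeries [Finite P] [GradeMinOrder ℕ P] : MvPowerSeries ℕ ℂ :=
  fun m => (Nat.card {c : Multichain P // c.exponent = m} : ℂ)

end Ranked

namespace Shuffle

/-- The letters `a_1, …, a_M` (lower alphabet) and `x_1, …, x_N` (upper alphabet). -/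
abbrev Letter (M N : ℕ) := Fin M ⊕ Fin N

/-- The shuffle property: within each alphabet the letters of the word are distinct and occur
in increasing order of their subscripts. -/
def IsShuffle {M N : ℕ} (w : List (Letter M N)) : Prop :=
  (w.filterMap Sum.getLeft?).Pairwise (· < ·) ∧ (w.filterMap Sum.getRight?).Pairwise (· < ·)

/-- The shuffle words over the two alphabets. -/
@[ext] structure Word (M N : ℕ) where
  /-- the sequence of letters -/
  letters : List (Letter M N)
  isShuffle : IsShuffle letters

variable {M N : ℕ}

/-- `w'` arises from `w` by deleting the letter `a` of the lower alphabet. -/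
def Deletes (w w' : Word M N) (a : Fin M) : Prop :=
  ∃ u v, w.letters = u ++ Sum.inl a :: v ∧ w'.letters = u ++ v

/-- `w'` arises from `w` by inserting the letter `x` of the upper alphabet. -/
def Inserts (w w' : Word M N) (x : Fin N) : Prop :=
  ∃ u v, w.letters = u ++ v ∧ w'.letters = u ++ Sum.inr x :: v

/-- `w'` arises from `w` by deleting a letter of the lower alphabet located immediately after
the letter `x` of the upper alphabet. -/
def DeletesAfter (w w' : Word M N) (x : Fin N) : Prop :=
  ∃ u v a, w.letters = u ++ Sum.inr x :: Sum.inl a :: v ∧ w'.letters = u ++ Sum.inr x :: v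

/-- The covering relation of the poset of shuffles. -/
def Step (w w' : Word M N) : Prop := (∃ a, Deletes w w' a) ∨ ∃ x, Inserts w w' x

/-- The rank of a shuffle word: the number of missing letters of the lower alphabet plus the
number of letters of the upper alphabet. -/
def rank (w : Word M N) : ℕ :=
  (M - (w.letters.filterMap Sum.getLeft?).length) + (w.letters.filterMap Sum.getRight?).length

lemma left_inl (a : Fin M) (w : List (Letter M N)) :
    (Sum.inl a :: w).filterMap Sum.getLeft? = a :: w.filterMap Sum.getLeft? := rfl

lemma left_inr (x : Fin N) (w : List (Letter M N)) :
    (Sum.inr x :: w).filterMap Sum.getLeft? = w.filterMap Sum.getLeft? := rfl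

lemma right_inl (a : Fin M) (w : List (Letter M N)) :
    (Sum.inl a :: w).filterMap Sum.getRight? = w.filterMap Sum.getRight? := rfl

lemma right_inr (x : Fin N) (w : List (Letter M N)) :
    (Sum.inr x :: w).filterMap Sum.getRight? = x :: w.filterMap Sum.getRight? := rfl

lemma length_left_le (w : Word M N) : (w.letters.filterMap Sum.getLeft?).length ≤ M := by
  have h : (w.letters.filterMap Sum.getLeft?).Nodup := w.isShuffle.1.imp fun h => h.ne
  simpa using h.length_le_card

lemma Step.rank_eq {w w' : Word M N} (h : Step w w') : rank w' = rank w + 1 := by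
  have := length_left_le w
  rcases h with ⟨a, u, v, h1, h2⟩ | ⟨x, u, v, h1, h2⟩ <;>
    simp [rank, h1, h2, left_inl, left_inr, right_inl, right_inr] at this ⊢ <;> omega

/-- The order generated by the covering relation. -/
instance : PartialOrder (Word M N) where
  le := Relation.ReflTransGen Step
  le_refl _ := .refl
  le_trans _ _ _ := .trans
  le_antisymm := by
    have key : ∀ {w w' : Word M N}, Relation.ReflTransGen Step w w' →
        w = w' ∨ rank w < rank w' := by
      intro w w' h
      induction h with
      | refl => exact .inl rfl
      | tail _ h ih =>
        right
        have := h.rank_eq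
        rcases ih with rfl | ih <;> omega
    intro a b h1 h2
    rcases key h1 with h | h
    · exact h
    · rcases key h2 with h' | h'
      · exact h'.symm
      · omega

lemma le_def {w w' : Word M N} : w ≤ w' ↔ Relation.ReflTransGen Step w w' := Iff.rfl

lemma Step.le {w w' : Word M N} (h : Step w w') : w ≤ w' := .single h

lemma rank_strictMono : StrictMono (rank (M := M) (N := N)) := by
  intro w w' h
  obtain ⟨h1, h2⟩ := lt_iff_le_and_ne.1 h
  rcases Relation.ReflTransGen.cases_tail h1 with h | ⟨v, hv, hs⟩
  · exact absurd h.symm h2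
  · have key : rank w ≤ rank v := by
      clear hs
      induction hv with
      | refl => exact le_rfl
      | tail _ h ih => rw [h.rank_eq]; omega
    rw [hs.rank_eq]
    omega

lemma covBy_iff_step {w w' : Word M N} : w ⋖ w' ↔ Step w w' := by
  constructor
  · intro h
    rcases Relation.ReflTransGen.cases_head h.le with rfl | ⟨v, hs, hv⟩
    · exact absurd h.lt (lt_irrefl _)
    · have h1 : w < v := by
        refine lt_of_le_of_ne hs.le fun he => ?_
        have := hs.rank_eq
        rw [he] at this
        omega
      rcases (le_def.2 hv).eq_or_lt with rfl | h2
      · exact hs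
      · exact absurd h2 (h.2 h1)
  · intro h
    refine ⟨lt_of_le_of_ne h.le fun he => ?_, fun v h1 h2 => ?_⟩
    · have := h.rank_eq
      rw [he] at this
      omega
    · have := rank_strictMono h1
      have := rank_strictMono h2
      have := h.rank_eq
      omega

lemma isShuffle_of_sublist {w w' : List (Letter M N)} (h : w'.Sublist w) (hw : IsShuffle w) :
    IsShuffle w' :=
  ⟨hw.1.sublist (h.filterMap _), hw.2.sublist (h.filterMap _)⟩

/-- Deleting letters of the lower alphabet goes up in the order. -/
lemma le_of_deletions {w w' : List (Letter M N)} (h : w'.Sublist w)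
    (hx : w'.filterMap Sum.getRight? = w.filterMap Sum.getRight?) :
    ∀ (u : List (Letter M N)) (hw : IsShuffle (u ++ w)) (hw' : IsShuffle (u ++ w')),
      (⟨u ++ w, hw⟩ : Word M N) ≤ ⟨u ++ w', hw'⟩ := by
  induction h with
  | slnil => intro u hw hw'; exact Relation.ReflTransGen.refl
  | @cons w' w l h ih =>
    intro u hw hw'
    cases l with
    | inl a =>
      have hv : IsShuffle (u ++ w) :=
        isShuffle_of_sublist ((List.sublist_cons_self _ _).append_left u) hw
      have hs : Step (⟨u ++ Sum.inl a :: w, hw⟩ : Word M N) ⟨u ++ w, hv⟩ :=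
        .inl ⟨a, u, w, rfl, rfl⟩
      exact le_trans hs.le (ih (by simpa [right_inl, right_inr] using hx) u hv hw')
    | inr x =>
      have := (h.filterMap Sum.getRight?).length_le
      rw [hx] at this
      simp at this
  | @cons_cons w' w l h ih =>
    intro u hw hw'
    have := ih (by cases l <;> simpa [right_inl, right_inr] using hx) (u ++ [l]) (by simpa using hw) (by simpa using hw')
    simpa using this

/-- Inserting letters of the upper alphabet goes up in the order. -/
lemma le_of_insertions {w w' : List (Letter M N)} (h : w'.Sublist w)
    (ha : w'.filterMap Sum.getLeft? = w.filterMap Sum.getLeft?) :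
    ∀ (u : List (Letter M N)) (hw : IsShuffle (u ++ w)) (hw' : IsShuffle (u ++ w')),
      (⟨u ++ w', hw'⟩ : Word M N) ≤ ⟨u ++ w, hw⟩ := by
  induction h with
  | slnil => intro u hw hw'; exact Relation.ReflTransGen.refl
  | @cons w' w l h ih =>
    intro u hw hw'
    cases l with
    | inr x =>
      have hv : IsShuffle (u ++ w) :=
        isShuffle_of_sublist ((List.sublist_cons_self _ _).append_left u) hw
      have hs : Step (⟨u ++ w, hv⟩ : Word M N) ⟨u ++ Sum.inr x :: w, hw⟩ :=
        .inr ⟨x, u, w, rfl, rfl⟩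
      exact le_trans (ih (by simpa [left_inl, left_inr] using ha) u hv hw') hs.le
    | inl a =>
      have := (h.filterMap Sum.getLeft?).length_le
      rw [ha] at this
      simp [left_inl] at this
  | @cons_cons w' w l h ih =>
    intro u hw hw'
    have := ih (by cases l <;> simpa [left_inl, left_inr] using ha) (u ++ [l]) (by simpa using hw) (by simpa using hw')
    simpa using this

lemma filterMap_left_map_inl (l : List (Fin M)) :
    (l.map (Sum.inl : Fin M → Letter M N)).filterMap Sum.getLeft? = l := by
  induction l with
  | nil => rfl
  | cons a l ih => simpa using ih

lemma filterMap_right_map_inr (l : List (Fin N)) :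
    (l.map (Sum.inr : Fin N → Letter M N)).filterMap Sum.getRight? = l := by
  induction l with
  | nil => rfl
  | cons a l ih => simpa [right_inr] using ih

lemma filterMap_right_map_inl (l : List (Fin M)) :
    (l.map (Sum.inl : Fin M → Letter M N)).filterMap Sum.getRight? = [] := by
  induction l with
  | nil => rfl
  | cons a l ih => simp

lemma filterMap_left_map_inr (l : List (Fin N)) :
    (l.map (Sum.inr : Fin N → Letter M N)).filterMap Sum.getLeft? = [] := by
  induction l with
  | nil => rfl
  | cons a l ih => simp

lemma map_left_sublist (w : List (Letter M N)) :
    ((w.filterMap Sum.getLeft?).map Sum.inl).Sublist w := by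
  induction w with
  | nil => simp
  | cons l w ih => cases l <;> simp [left_inl, left_inr, right_inl, right_inr, ih, List.Sublist.cons]

lemma map_right_sublist (w : List (Letter M N)) :
    ((w.filterMap Sum.getRight?).map Sum.inr).Sublist w := by
  induction w with
  | nil => simp
  | cons l w ih => cases l <;> simp [left_inl, left_inr, right_inl, right_inr, ih, List.Sublist.cons]

lemma sublist_finRange {n : ℕ} {l : List (Fin n)} (h : l.Pairwise (· < ·)) :
    l.Sublist (List.finRange n) :=
  List.sublist_of_subperm_of_pairwise (r := (· < ·))
    (List.subperm_of_subset (h.imp fun h => h.ne) fun x _ => List.mem_finRange x) h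
    (List.pairwise_lt_finRange n)

lemma nodup_of_isShuffle {w : List (Letter M N)} (h : IsShuffle w) : w.Nodup := by
  induction w with
  | nil => exact List.nodup_nil
  | cons l w ih =>
    refine List.nodup_cons.2 ⟨fun hl => ?_, ih (isShuffle_of_sublist (List.sublist_cons_self _ _) h)⟩
    cases l with
    | inl a =>
      have h1 := h.1
      rw [left_inl, List.pairwise_cons] at h1
      exact lt_irrefl a (h1.1 a (List.mem_filterMap.2 ⟨_, hl, rfl⟩))
    | inr x =>
      have h1 := h.2
      rw [right_inr, List.pairwise_cons] at h1
      exact lt_irrefl x (h1.1 x (List.mem_filterMap.2 ⟨_, hl, rfl⟩))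

/-- `⊥ = a_1 a_2 ⋯ a_M` and `⊤ = x_1 x_2 ⋯ x_N`. -/
instance : BoundedOrder (Word M N) where
  bot := ⟨(List.finRange M).map Sum.inl, by
    rw [IsShuffle, filterMap_left_map_inl, filterMap_right_map_inl]
    exact ⟨List.pairwise_lt_finRange M, .nil⟩⟩
  top := ⟨(List.finRange N).map Sum.inr, by
    rw [IsShuffle, filterMap_left_map_inr, filterMap_right_map_inr]
    exact ⟨.nil, List.pairwise_lt_finRange N⟩⟩
  bot_le := by
    rintro ⟨w, hw⟩
    have hA : IsShuffle ((w.filterMap Sum.getLeft?).map Sum.inl : List (Letter M N)) :=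
      isShuffle_of_sublist (map_left_sublist w) hw
    refine le_trans (b := ⟨_, hA⟩) ?_ ?_
    · exact le_of_deletions ((sublist_finRange hw.1).map _)
        (by rw [filterMap_right_map_inl, filterMap_right_map_inl]) [] _ _
    · exact le_of_insertions (map_left_sublist w) (by rw [filterMap_left_map_inl]) [] hw hA
  le_top := by
    rintro ⟨w, hw⟩
    have hX : IsShuffle ((w.filterMap Sum.getRight?).map Sum.inr : List (Letter M N)) :=
      isShuffle_of_sublist (map_right_sublist w) hw
    refine le_trans (b := ⟨_, hX⟩) ?_ ?_
    · exact le_of_deletions (map_right_sublist w) (by rw [filterMap_right_map_inr]) [] hw hX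
    · exact le_of_insertions ((sublist_finRange hw.2).map _)
        (by rw [filterMap_left_map_inr, filterMap_left_map_inr]) [] _ _

/-- The poset of shuffles is ranked by `rank`. -/
instance : GradeMinOrder ℕ (Word M N) where
  grade := rank
  grade_strictMono := rank_strictMono
  covBy_grade _ _ h := by
    rw [Nat.covBy_iff_add_one_eq, (covBy_iff_step.1 h).rank_eq]
  isMin_grade w h := by
    rw [isMin_iff_eq_bot.1 h, isMin_iff_eq_bot]
    change M - (((List.finRange M).map Sum.inl).filterMap Sum.getLeft?).length +
      (((List.finRange M).map Sum.inl).filterMap Sum.getRight?).length = 0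
    rw [filterMap_left_map_inl, filterMap_right_map_inl]
    simp

instance : Finite (Word M N) := by
  have : Function.Injective (fun w : Word M N =>
      ((⟨w.letters, nodup_of_isShuffle w.isShuffle⟩ : {l : List (Letter M N) // l.Nodup}))) := by
    intro w w' h
    exact Word.ext (congrArg (fun l : {l : List (Letter M N) // l.Nodup} => l.1) h)
  exact Finite.of_injective _ this

open Ranked

/-- The `i`-th step of a maximal chain deletes a letter located immediately after `x`, and no
earlier step along the chain does so. -/
def IsFirstDeletionAfter {n : ℕ} (c : MaxChain (Word M N) n) (i : Fin n) (x : Fin N) : Prop :=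
  DeletesAfter (c.elt i.castSucc) (c.elt i.succ) x ∧
    ∀ j < i, ¬ DeletesAfter (c.elt j.castSucc) (c.elt j.succ) x

open Classical in
/-- The label sequence `Λ(c)` of a maximal chain `c` of the poset of shuffles. The `i`-th label
is `x` if the `i`-th step inserts `x`; it is `x` if the `i`-th step is the first deletion along
`c` of a letter located immediately after `x`; otherwise it is the letter `a` of the lower
alphabet that is deleted in the `i`-th step. -/
def label {n : ℕ} (c : MaxChain (Word M N) n) (i : Fin n) : Letter M N :=
  if hx : ∃ x, Inserts (c.elt i.castSucc) (c.elt i.succ) x then Sum.inr hx.choose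
  else if hxa : ∃ x, IsFirstDeletionAfter c i x then Sum.inr hxa.choose
  else Sum.inl ((covBy_iff_step.1 (c.covBy i)).resolve_right hx).choose

end Shuffle

end

open SymFun Ranked Shuffle

noncomputable section

/-! Weakly increasing sequences of words from `⊥` to `⊤` are encoded by a matching of letters
together with a time for each letter. Match `a_m` with `x_y` if `a_m` is the first letter that is
deleted from the place right after `x_y`. These pairs do not cross (`Flag.Pair.lt_iff_lt`), and they
fix the relative order of all letters: when `x_l` and `a_j` are both present, `x_l` comes first iff
some pair `(a_m, x_y)` has `l ≤ y` and `m ≤ j` (`Flag.exists_pair_of_before`, `Flag.Pair.before`).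
Hence the sequence can be recovered from its matching and its times. Conversely, every increasing
matching occurs with all times that insert `x_y` strictly before `a_m` is deleted, for each pair.
This is `flagEquivCode`.

Multichains carry arbitrary such times. For a fixed matching with `k` pairs, each pair contributes a
strictly increasing pair of indices, that is `e_2`, and each other letter contributes `e_1`. An
increasing matching amounts to a choice of `k` letters from each alphabet, which gives the binomial
coefficients (`flagSeries_eq`).

Maximal chains carry bijective times. Both letters of a pair have the label `x_y`, every other
letter is its own label. The labels determine the matching: `x_y` is matched iff it occurs twice,
`a_m` is matched iff it is missing, and an increasing matching is determined by its two sets of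
letters. They also determine the times, since the earlier `x_y` is the insertion. Every
rearrangement of the labels occurs, which gives the action (`label_injective`,
`IsMatching.exists_chain`). An adjacent transposition either exchanges two equal labels or keeps the
matching and exchanges two consecutive times; this affects only the word in between.

By Burnside's lemma, a coefficient of `ch(ψ)` counts the orbits of maximal chains whose steps are
colored with a given content (`coeff_frobeniusChar_ofMulAction`). Such an orbit is a matching with a
coloring of the letters, normalized to be weakly increasing on each pair (`orbitEquiv`). The count
is therefore the one for `F` with `≤` in place of `<`, so `e_2` becomes `h_2`, in agreement with
`ω`. -/

lemma List.pair_sublist_iff_idxOf {α : Type*} [BEq α] [LawfulBEq α] {l : List α} (h : l.Nodup)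
    {p q : α} :
    [p, q].Sublist l ↔ l.idxOf p < l.idxOf q ∧ q ∈ l := by
  induction l with
  | nil => simp
  | cons c l ih =>
    have ih := ih h.of_cons
    have hc : c ∉ l := (List.nodup_cons.1 h).1
    rw [List.idxOf_cons, List.idxOf_cons]
    by_cases hp : c = p
    · subst hp
      rw [List.cons_sublist_cons, List.singleton_sublist]
      by_cases hq : c = q
      · subst hq; simp [hc]
      · simp [beq_false_of_ne hq, Ne.symm hq]
    · by_cases hq : c = q
      · subst hq
        have : ¬ [p, c].Sublist (c :: l) := by
          intro hs
          rcases List.sublist_cons_iff.1 hs with hs | ⟨r, hr, -⟩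
          · exact hc (hs.subset (by simp))
          · simp at hr; exact hp hr.1.symm
        simp [this]
      · have : [p, q].Sublist (c :: l) ↔ [p, q].Sublist l := by
          rw [List.sublist_cons_iff]
          constructor
          · rintro (hs | ⟨r, hr, -⟩)
            · exact hs
            · simp at hr; exact absurd hr.1.symm hp
          · exact .inl
        rw [this, ih]
        simp [beq_false_of_ne hp, beq_false_of_ne hq, Ne.symm hq]

/-! ### Relative order of the letters of a shuffle word -/

namespace Shuffle

variable {M N : ℕ}

instance : LawfulBEq (Letter M N) where
  eq_of_beq {a b} h := by
    cases a <;> cases b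
    · exact congrArg Sum.inl (LawfulBEq.eq_of_beq (α := Fin M) h)
    · cases h
    · cases h
    · exact congrArg Sum.inr (LawfulBEq.eq_of_beq (α := Fin N) h)
  rfl {a} := by
    cases a
    · exact LawfulBEq.toReflBEq.rfl (α := Fin M)
    · exact LawfulBEq.toReflBEq.rfl (α := Fin N)

/-- The letter `p` occurs before the letter `q` in the word `w`. -/
def Word.Before (w : Word M N) (p q : Letter M N) : Prop := [p, q].Sublist w.letters

lemma Word.nodup (w : Word M N) : w.letters.Nodup := nodup_of_isShuffle w.isShuffle

/-- Positions turn order arguments into arithmetic. The position of an absent letter is the length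
of the word, so the inequality forces `p` to be present, but the presence of `q` has to be required.
-/
lemma Word.before_iff {w : Word M N} {p q : Letter M N} :
    w.Before p q ↔ w.letters.idxOf p < w.letters.idxOf q ∧ q ∈ w.letters :=
  List.pair_sublist_iff_idxOf w.nodup

namespace Word

lemma Before.left {w : Word M N} {p q : Letter M N} (h : w.Before p q) : p ∈ w.letters :=
  List.Sublist.subset h (by simp)

lemma Before.right {w : Word M N} {p q : Letter M N} (h : w.Before p q) : q ∈ w.letters :=
  List.Sublist.subset h (by simp)

lemma Before.trans {w : Word M N} {p q r : Letter M N} (h : w.Before p q) (h' : w.Before q r) :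
    w.Before p r := by
  rw [before_iff] at *
  exact ⟨h.1.trans h'.1, h'.2⟩

lemma Before.asymm {w : Word M N} {p q : Letter M N} (h : w.Before p q) : ¬ w.Before q p := by
  rw [before_iff] at *
  omega

lemma before_irrefl {w : Word M N} (p : Letter M N) : ¬ w.Before p p := fun h => h.asymm h

lemma before_or_before {w : Word M N} {p q : Letter M N} (hp : p ∈ w.letters) (hq : q ∈ w.letters)
    (hne : p ≠ q) : w.Before p q ∨ w.Before q p := by
  rw [before_iff, before_iff]
  rcases lt_trichotomy (w.letters.idxOf p) (w.letters.idxOf q) with h | h | h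
  · exact .inl ⟨h, hq⟩
  · exact absurd ((List.idxOf_inj hp).1 h) hne
  · exact .inr ⟨h, hp⟩

lemma Before.lt_left {w : Word M N} {a b : Fin M} (h : w.Before (.inl a) (.inl b)) : a < b := by
  have h1 : [a, b].Sublist (w.letters.filterMap Sum.getLeft?) := h.filterMap Sum.getLeft?
  exact List.pairwise_iff_forall_sublist.1 w.isShuffle.1 h1

lemma Before.lt_right {w : Word M N} {a b : Fin N} (h : w.Before (.inr a) (.inr b)) : a < b := by
  have h1 : [a, b].Sublist (w.letters.filterMap Sum.getRight?) := h.filterMap Sum.getRight?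
  exact List.pairwise_iff_forall_sublist.1 w.isShuffle.2 h1

lemma before_of_lt_left {w : Word M N} {a b : Fin M} (ha : .inl a ∈ w.letters)
    (hb : .inl b ∈ w.letters) (h : a < b) : w.Before (.inl a) (.inl b) :=
  (before_or_before ha hb (by simpa using h.ne)).resolve_right fun h' => h.asymm h'.lt_left

lemma before_of_lt_right {w : Word M N} {a b : Fin N} (ha : .inr a ∈ w.letters)
    (hb : .inr b ∈ w.letters) (h : a < b) : w.Before (.inr a) (.inr b) :=
  (before_or_before ha hb (by simpa using h.ne)).resolve_right fun h' => h.asymm h'.lt_right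

/-- The letter `q` occurs immediately after the letter `p` in the word `w`. -/
def Adj (w : Word M N) (p q : Letter M N) : Prop :=
  w.Before p q ∧ ∀ z, w.Before p z → ¬ w.Before z q

lemma adj_of_eq_append {w : Word M N} {p q : Letter M N} {u v : List (Letter M N)}
    (h : w.letters = u ++ p :: q :: v) : w.Adj p q := by
  have hn := w.nodup
  have hp : w.letters.idxOf p = u.length := by
    rw [h] at hn ⊢
    have hpu : p ∉ u := fun hpu => (List.nodup_append.1 hn).2.2 p hpu p (by simp) rfl
    rw [List.idxOf_append_of_notMem hpu]; simp
  have hq : w.letters.idxOf q = u.length + 1 := by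
    rw [h] at hn ⊢
    have hqu : q ∉ u := fun hqu => (List.nodup_append.1 hn).2.2 q hqu q (by simp) rfl
    have hpq : p ≠ q := by rintro rfl; exact absurd hn.of_append_right (by simp)
    rw [List.idxOf_append_of_notMem hqu, List.idxOf_cons_ne _ hpq]; simp
  refine ⟨before_iff.2 ⟨by omega, by simp [h]⟩, fun z h1 h2 => ?_⟩
  rw [before_iff] at h1 h2
  omega

lemma exists_adj_of_before {w : Word M N} {p q : Letter M N} (h : w.Before p q) :
    ∃ z u v, w.letters = u ++ z :: q :: v := by
  obtain ⟨u, v, huv⟩ := List.append_of_mem h.right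
  rcases List.eq_nil_or_concat u with rfl | ⟨u, z, rfl⟩
  · have := (before_iff.1 h).1
    simp [huv] at this
  · exact ⟨z, u, v, by simpa using huv⟩

lemma adj_iff_exists {w : Word M N} {p q : Letter M N} :
    w.Adj p q ↔ ∃ u v, w.letters = u ++ p :: q :: v := by
  constructor
  · intro h
    obtain ⟨z, u, v, huv⟩ := exists_adj_of_before h.1
    have hz := adj_of_eq_append huv
    by_cases hpz : p = z
    · subst hpz; exact ⟨u, v, huv⟩
    · exfalso
      rcases before_or_before h.1.left hz.1.left hpz with h1 | h1
      · exact h.2 z h1 hz.1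
      · exact hz.2 p h1 h.1
  · rintro ⟨u, v, h⟩
    exact adj_of_eq_append h

lemma Adj.right_unique {w : Word M N} {p q q' : Letter M N} (h : w.Adj p q) (h' : w.Adj p q') :
    q = q' := by
  by_contra hne
  rcases before_or_before h.1.right h'.1.right hne with h1 | h1
  · exact h'.2 q h.1 h1
  · exact h.2 q' h'.1 h1

lemma Adj.left_unique {w : Word M N} {p p' q : Letter M N} (h : w.Adj p q) (h' : w.Adj p' q) :
    p = p' := by
  by_contra hne
  rcases before_or_before h.1.left h'.1.left hne with h1 | h1
  · exact h.2 p' h1 h'.1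
  · exact h'.2 p h1 h.1

lemma before_or_eq_of_adj {w : Word M N} {p q z : Letter M N} (h : w.Adj p q)
    (hz : w.Before z q) : z = p ∨ w.Before z p := by
  by_contra! hne
  exact (before_or_before hz.left h.1.left hne.1).elim hne.2 fun h' => h.2 z h' hz

/-- The letters which have been treated when the word `w` is reached: the deleted letters of the
lower alphabet and the inserted letters of the upper alphabet. -/
def Done (w : Word M N) : Letter M N → Prop
  | .inl a => .inl a ∉ w.letters
  | .inr x => .inr x ∈ w.letters

lemma mem_iff_mem_of_done_iff {w w' : Word M N} (h : ∀ u, w.Done u ↔ w'.Done u) (u : Letter M N) :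
    u ∈ w.letters ↔ u ∈ w'.letters := by
  cases u with
  | inl a => exact not_iff_not.1 (h (.inl a))
  | inr x => exact h (.inr x)

lemma Done.mono {w w' : Word M N} (h : w ≤ w') {u : Letter M N} (hu : w.Done u) : w'.Done u := by
  rw [le_def] at h
  induction h with
  | refl => exact hu
  | @tail v v' _ hs ih =>
    cases u with
    | inl a =>
      intro ha
      apply ih
      rcases hs with ⟨b, u, t, h1, h2⟩ | ⟨x, u, t, h1, h2⟩
      · rw [h2] at ha; rw [h1]; simp at ha ⊢; tauto
      · rw [h2] at ha; rw [h1]; simpa using ha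
    | inr y =>
      change _ ∈ _
      change _ ∈ _ at ih
      rcases hs with ⟨b, u, t, h1, h2⟩ | ⟨x, u, t, h1, h2⟩
      · rw [h1] at ih; rw [h2]; simpa using ih
      · rw [h1] at ih; rw [h2]; simp at ih ⊢; tauto

/-- No step moves letters past each other. A letter that is present at both ends is present
throughout, because deletions and insertions are never undone, so the order can be transported one
step at a time. -/
lemma Before.mono {w w' : Word M N} (h : w ≤ w') {p q : Letter M N} (hb : w.Before p q)
    (hp : p ∈ w'.letters) (hq : q ∈ w'.letters) : w'.Before p q := by
  rw [le_def] at h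
  induction h with
  | refl => exact hb
  | @tail v v' h1 hs ih =>
    have key : ∀ z ∈ w.letters, z ∈ v'.letters → z ∈ v.letters := by
      intro z hz hz'
      cases z with
      | inl a => by_contra ha; exact Done.mono hs.le (u := .inl a) ha hz'
      | inr x => exact Done.mono (u := .inr x) h1 hz
    have hv := ih (key p hb.left hp) (key q hb.right hq)
    rcases hs with ⟨b, u, t, h1, h2⟩ | ⟨x, u, t, h1, h2⟩
    · have hsub : v'.letters.Sublist v.letters := by
        rw [h1, h2]; exact (List.sublist_cons_self _ _).append_left _
      refine (before_or_before hp hq fun hpq => ?_).resolve_right fun h' => ?_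
      · subst hpq; exact before_irrefl _ hb
      · exact hv.asymm (List.Sublist.trans h' hsub)
    · have hsub : v.letters.Sublist v'.letters := by
        rw [h1, h2]; exact (List.sublist_cons_self _ _).append_left _
      exact List.Sublist.trans hv hsub

lemma mem_bot (u : Letter M N) : u ∈ (⊥ : Word M N).letters ↔ u.isLeft := by
  change u ∈ (List.finRange M).map Sum.inl ↔ _
  cases u <;> simp

lemma mem_top (u : Letter M N) : u ∈ (⊤ : Word M N).letters ↔ u.isRight := by
  change u ∈ (List.finRange N).map Sum.inr ↔ _
  cases u <;> simp

lemma not_done_bot (u : Letter M N) : ¬ (⊥ : Word M N).Done u := by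
  cases u <;> simp [Done, mem_bot]

lemma done_top (u : Letter M N) : (⊤ : Word M N).Done u := by
  cases u <;> simp [Done, mem_top]

end Word

/-! ### Flags of words and the pairs of letters they determine -/

open Word

/-- A weakly increasing sequence of shuffle words that starts with `⊥` and is eventually equal
to `⊤`. -/
@[ext] structure Flag (M N : ℕ) where
  /-- the words of the sequence -/
  word : ℕ → Word M N
  mono : Monotone word
  zero : word 0 = ⊥
  exists_top : ∃ r, word r = ⊤

namespace Flag

variable (w : Flag M N)

lemma exists_done (u : Letter M N) : ∃ s, (w.word (s + 1)).Done u := by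
  obtain ⟨r, hr⟩ := w.exists_top
  exact ⟨r, Done.mono (w.mono r.le_succ) (hr ▸ done_top u)⟩

open Classical in
/-- The step in which a letter is deleted or inserted. -/
def time (u : Letter M N) : ℕ := Nat.find (w.exists_done u)

/-- Step `s` leads from `word s` to `word (s + 1)`, so a letter of time `s` is still untreated in
`word s`; this makes the inequality strict. In `word 0 = ⊥` nothing has been treated. -/
lemma done_iff {s : ℕ} {u : Letter M N} : (w.word s).Done u ↔ w.time u < s := by
  classical
  cases s with
  | zero => simp [w.zero, not_done_bot]
  | succ s =>
    rw [Nat.lt_succ_iff, time, Nat.find_le_iff]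
    constructor
    · exact fun h => ⟨s, le_rfl, h⟩
    · rintro ⟨m, hm, h⟩
      exact Done.mono (w.mono (by omega)) h

lemma inl_mem {s : ℕ} {a : Fin M} : .inl a ∈ (w.word s).letters ↔ s ≤ w.time (.inl a) := by
  rw [← not_lt, ← w.done_iff, Done, not_not]

lemma inr_mem {s : ℕ} {x : Fin N} : .inr x ∈ (w.word s).letters ↔ w.time (.inr x) < s := by
  rw [← w.done_iff, Done]

variable {w} in
lemma before_congr {s t : ℕ} {p q : Letter M N} (h : (w.word s).Before p q)
    (hp : p ∈ (w.word t).letters) (hq : q ∈ (w.word t).letters) : (w.word t).Before p q := by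
  rcases le_total s t with hst | hst
  · exact h.mono (w.mono hst) hp hq
  · refine (before_or_before hp hq fun hpq => ?_).resolve_right fun h' => ?_
    · subst hpq; exact before_irrefl _ h
    · exact h.asymm (h'.mono (w.mono hst) h.right h.left)

/-- The letter `a_m` is deleted from the position immediately after `x_y`, and this does not
happen earlier to another letter of the lower alphabet. -/
def Pair (m : Fin M) (y : Fin N) : Prop :=
  (w.word (w.time (.inl m))).Adj (.inr y) (.inl m) ∧
    ∀ m', (w.word (w.time (.inl m'))).Adj (.inr y) (.inl m') → w.time (.inl m) ≤ w.time (.inl m')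

variable {w}

lemma Pair.time_lt {m : Fin M} {y : Fin N} (h : w.Pair m y) :
    w.time (.inr y) < w.time (.inl m) := w.inr_mem.1 h.1.1.left

lemma Pair.right_unique {m : Fin M} {y y' : Fin N} (h : w.Pair m y) (h' : w.Pair m y') : y = y' :=
  Sum.inr_injective (h.1.left_unique h'.1)

/-- Several letters may be deleted in the same step of a flag. Uniqueness persists because adjacency
is tested in the word before the step, where only one letter follows `x_y` immediately. -/
lemma Pair.left_unique {m m' : Fin M} {y : Fin N} (h : w.Pair m y) (h' : w.Pair m' y) :
    m = m' := by
  have h1 := le_antisymm (h.2 _ h'.1) (h'.2 _ h.1)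
  have h2 := h'.1
  rw [← h1] at h2
  exact Sum.inl_injective (h.1.right_unique h2)

/-- Take the earliest deletion right after `x_y`. If its letter `a_m` had `j < m`, then `a_j`, which
is still present at that time, would stand between `x_y` and `a_m`. -/
lemma exists_pair_of_adj {j : Fin M} {y : Fin N}
    (h : (w.word (w.time (.inl j))).Adj (.inr y) (.inl j)) : ∃ m ≤ j, w.Pair m y := by
  classical
  obtain ⟨m, hm, hmin⟩ := Finset.exists_min_image
    (Finset.univ.filter fun m => (w.word (w.time (.inl m))).Adj (.inr y) (.inl m))
    (fun m => w.time (.inl m)) ⟨j, by simpa using h⟩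
  simp only [Finset.mem_filter, Finset.mem_univ, true_and] at hm hmin
  refine ⟨m, ?_, hm, hmin⟩
  by_contra! hlt
  have hj : .inl j ∈ (w.word (w.time (.inl m))).letters := w.inl_mem.2 (hmin j h)
  exact hm.2 _ (before_congr h.1 hm.1.left hj) (before_of_lt_left hj hm.1.right hlt)

/-- Look at the predecessor of `a_j` just before `a_j` is deleted. If it is some `x_y`, then `l ≤ y`
and a first deletion after `x_y` gives the pair. If it is some `a_j'`, then `x_l` precedes `a_j'`
and induction applies. -/
lemma exists_pair_of_before {s : ℕ} {l : Fin N} {j : Fin M}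
    (h : (w.word s).Before (.inr l) (.inl j)) : ∃ m y, w.Pair m y ∧ l ≤ y ∧ m ≤ j := by
  induction j using WellFoundedLT.induction generalizing s with
  | ind j ih =>
    have hs : s ≤ w.time (.inl j) := w.inl_mem.1 h.right
    have hl : w.time (.inr l) < s := w.inr_mem.1 h.left
    replace h : (w.word (w.time (.inl j))).Before (.inr l) (.inl j) :=
      before_congr h (w.inr_mem.2 (by omega)) (w.inl_mem.2 le_rfl)
    obtain ⟨z, hz⟩ := exists_adj_of_before h
    have hz := adj_iff_exists.2 hz
    cases z with
    | inr y =>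
      obtain ⟨m, hm, hp⟩ := exists_pair_of_adj hz
      refine ⟨m, y, hp, ?_, hm⟩
      rcases before_or_eq_of_adj hz h with h' | h'
      · exact (Sum.inr_injective h').le
      · exact h'.lt_right.le
    | inl j' =>
      obtain ⟨m, y, hp, hy, hm⟩ := ih j' hz.1.lt_left
        ((before_or_eq_of_adj hz h).resolve_left (by simp))
      exact ⟨m, y, hp, hy, hm.trans hz.1.lt_left.le⟩

/-- Compare in the word just before `a_m` is deleted, where `x_y` precedes `a_m`, and transport the
result to `word s`. -/
lemma Pair.before {m j : Fin M} {y l : Fin N} (h : w.Pair m y) (hl : l ≤ y) (hj : m ≤ j) {s : ℕ}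
    (hls : .inr l ∈ (w.word s).letters) (hjs : .inl j ∈ (w.word s).letters) :
    (w.word s).Before (.inr l) (.inl j) := by
  have hls' := w.inr_mem.1 hls
  have hjs' := w.inl_mem.1 hjs
  have hadj := h.1
  have hy := h.time_lt
  have hle : ∀ {t : ℕ} {p : Letter M N}, (w.word t).Before p (.inl m) →
      .inl j ∈ (w.word t).letters → (w.word t).Before p (.inl j) := by
    intro t p hp hjt
    rcases hj.eq_or_lt with rfl | hlt
    · exact hp
    · exact hp.trans (before_of_lt_left hp.right hjt hlt)
  have hle' : ∀ {t : ℕ} {q : Letter M N}, (w.word t).Before (.inr y) q →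
      .inr l ∈ (w.word t).letters → (w.word t).Before (.inr l) q := by
    intro t q hq hlt
    rcases hl.eq_or_lt with rfl | hlt'
    · exact hq
    · exact (before_of_lt_right hlt hq.left hlt').trans hq
  -- If `x_l` is present when `a_m` is deleted, it precedes `a_m`; if `a_j` disappears before `a_m`,
  -- the comparison is made just before that deletion instead. If `x_l` comes later, `a_j` must
  -- outlive `a_m`, and `x_y` carries the order over to `word s`.
  by_cases h1 : w.time (.inr l) < w.time (.inl m)
  · have h2 : (w.word (w.time (.inl m))).Before (.inr l) (.inl m) := hle' hadj.1 (w.inr_mem.2 h1)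
    by_cases h3 : w.time (.inl m) ≤ w.time (.inl j)
    · exact before_congr (hle h2 (w.inl_mem.2 h3)) hls hjs
    · have h4 : (w.word (w.time (.inl j))).Before (.inr l) (.inl m) :=
        before_congr h2 (w.inr_mem.2 (by omega)) (w.inl_mem.2 (by omega))
      exact before_congr (hle h4 (w.inl_mem.2 le_rfl)) hls hjs
  · have h3 : (w.word (w.time (.inl m))).Before (.inr y) (.inl j) :=
      hle hadj.1 (w.inl_mem.2 (by omega))
    exact hle' (before_congr h3 (w.inr_mem.2 (by omega)) hjs) hls

/-- Suppose `m' < m` and consider the word just before `a_m` is deleted. It contains `x_y'`, or else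
`a_m'`, which can only be deleted after `x_y'` has been inserted. Either letter would separate `x_y`
from `a_m`. -/
lemma Pair.lt_of_lt {m m' : Fin M} {y y' : Fin N} (h : w.Pair m y) (h' : w.Pair m' y')
    (hy : y < y') : m < m' := by
  by_contra! hm
  rcases hm.eq_or_lt with rfl | hm
  · exact hy.ne (h.right_unique h')
  have hty := h.time_lt
  have hty' := h'.time_lt
  by_cases h1 : w.time (.inr y') < w.time (.inl m)
  · have hmem : .inr y' ∈ (w.word (w.time (.inl m))).letters := w.inr_mem.2 h1
    exact h.1.2 _ (before_of_lt_right h.1.1.left hmem hy)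
      (h'.before le_rfl hm.le hmem h.1.1.right)
  · have hmem : .inl m' ∈ (w.word (w.time (.inl m))).letters := w.inl_mem.2 (by omega)
    exact h.1.2 _ (h'.before hy.le le_rfl h.1.1.left hmem)
      (before_of_lt_left hmem h.1.1.right hm)

lemma Pair.lt_iff_lt {m m' : Fin M} {y y' : Fin N} (h : w.Pair m y) (h' : w.Pair m' y') :
    m < m' ↔ y < y' := by
  refine ⟨fun hm => ?_, h.lt_of_lt h'⟩
  by_contra! hy
  rcases hy.eq_or_lt with rfl | hy
  · exact hm.ne (h.left_unique h')
  · exact (h'.lt_of_lt h hy).asymm hm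

end Flag
end Shuffle

lemma List.filterMap_filter_congr {α β : Type*} {f : α → Option β} {p q : α → Bool} {l : List α}
    (h : ∀ a, f a ≠ none → p a = q a) : (l.filter p).filterMap f = (l.filter q).filterMap f := by
  induction l with
  | nil => rfl
  | cons a l ih =>
    by_cases ha : f a = none
    · rw [List.filter_cons, List.filter_cons]
      split_ifs <;> simp [ha, ih]
    · rw [List.filter_cons, List.filter_cons, h a ha]
      split_ifs <;> simp [List.filterMap_cons, ih]

/-! ### Words rebuilt from a matching; flags correspond to codes -/

namespace Shuffle

variable {M N : ℕ}

/-- The number of letters of the lower alphabet that precede `x_l` in the word with all letters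
determined by a set of pairs: all letters before the first `a_m` paired with some `x_y`,
`l ≤ y`. -/
def gap (P : Finset (Fin M × Fin N)) (l : Fin N) : ℕ :=
  sInf {m | m = M ∨ ∃ p ∈ P, l ≤ p.2 ∧ (p.1 : ℕ) = m}

/-- The default `M` keeps the set nonempty. It exceeds every index `j`, so it never accounts for the
left-hand side. -/
lemma gap_le_iff {P : Finset (Fin M × Fin N)} {l : Fin N} {j : Fin M} :
    gap P l ≤ j ↔ ∃ p ∈ P, l ≤ p.2 ∧ p.1 ≤ j := by
  constructor
  · intro h
    rcases Nat.sInf_mem (s := {m | m = M ∨ ∃ p ∈ P, l ≤ p.2 ∧ (p.1 : ℕ) = m}) ⟨M, .inl rfl⟩ with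
      h1 | ⟨p, hp, h1, h2⟩
    · rw [← gap] at h1
      omega
    · exact ⟨p, hp, h1, by rw [← gap] at h2; exact Fin.le_def.2 (h2 ▸ h)⟩
  · rintro ⟨p, hp, h1, h2⟩
    exact (Nat.sInf_le (.inr ⟨p, hp, h1, rfl⟩)).trans h2

lemma gap_mono (P : Finset (Fin M × Fin N)) : Monotone (gap P) := by
  intro l l' h
  refine le_csInf ⟨M, .inl rfl⟩ ?_
  rintro m (rfl | ⟨p, hp, h1, rfl⟩)
  · exact Nat.sInf_le (.inl rfl)
  · exact Nat.sInf_le (.inr ⟨p, hp, h.trans h1, rfl⟩)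

/-- The position of the letters in the word with all letters determined by a set of pairs. -/
def key (P : Finset (Fin M × Fin N)) : Letter M N → ℕ
  | .inl j => j * (N + 1) + N
  | .inr l => gap P l * (N + 1) + l

variable (P : Finset (Fin M × Fin N))

lemma key_inl_lt {a b : Fin M} : key P (.inl a) < key P (.inl b) ↔ a < b := by
  simp [key]

lemma key_inr_lt {a b : Fin N} : key P (.inr a) < key P (.inr b) ↔ a < b := by
  have key : ∀ {a b : Fin N}, a < b → key P (.inr a) < key P (.inr b) := by
    intro a b h
    have := Nat.mul_le_mul_right (N + 1) (gap_mono P h.le)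
    have := Fin.lt_def.1 h
    simp only [Shuffle.key]
    omega
  refine ⟨fun h => ?_, key⟩
  by_contra! h'
  rcases h'.eq_or_lt with rfl | h'
  · exact lt_irrefl _ h
  · exact (key h').asymm h

/-- The keys form blocks of length `N + 1`: block `g` holds the `x_l` with `gap P l = g` at the
offsets `l < N`, followed by `a_g` at the offset `N`. The comparison thus reduces to `gap P l ≤ j`.
-/
lemma key_inr_lt_inl {l : Fin N} {j : Fin M} :
    key P (.inr l) < key P (.inl j) ↔ ∃ p ∈ P, l ≤ p.2 ∧ p.1 ≤ j := by
  rw [← gap_le_iff]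
  simp only [key]
  have := l.isLt
  constructor
  · intro h
    by_contra! h'
    have := Nat.mul_le_mul_right (N + 1) (Nat.succ_le_of_lt h')
    rw [Nat.succ_mul] at this
    omega
  · intro h
    have := Nat.mul_le_mul_right (N + 1) h
    omega

/-- Modulo `N + 1` the keys of lower letters are `N`, those of upper letters are smaller. -/
lemma key_inl_ne_inr {l : Fin N} {j : Fin M} : key P (.inl j) ≠ key P (.inr l) := by
  intro h
  have h1 := congrArg (· % (N + 1)) h
  simp only [key] at h1
  rw [Nat.mul_add_mod', Nat.mul_add_mod', Nat.mod_eq_of_lt (by omega),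
    Nat.mod_eq_of_lt (by omega)] at h1
  omega

lemma key_injective : Function.Injective (key P) := by
  rintro (a | x) (b | y) h
  · rcases lt_trichotomy a b with h1 | h1 | h1
    · exact absurd h ((key_inl_lt P).2 h1).ne
    · rw [h1]
    · exact absurd h ((key_inl_lt P).2 h1).ne'
  · exact absurd h (key_inl_ne_inr P)
  · exact absurd h.symm (key_inl_ne_inr P)
  · rcases lt_trichotomy x y with h1 | h1 | h1
    · exact absurd h ((key_inr_lt P).2 h1).ne
    · rw [h1]
    · exact absurd h ((key_inr_lt P).2 h1).ne'

lemma exists_sorted_letters :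
    ∃ l : List (Letter M N), (∀ u, u ∈ l) ∧ l.Pairwise fun u v => key P u < key P v := by
  let r : Letter M N → Letter M N → Prop := fun u v => key P u ≤ key P v
  have : IsTrans _ r := ⟨fun _ _ _ h h' => le_trans h h'⟩
  have : Std.Antisymm r := ⟨fun _ _ h h' => key_injective P (le_antisymm h h')⟩
  have : Std.Total r := ⟨fun _ _ => le_total _ _⟩
  have : DecidableRel r := fun _ _ => Nat.decLe _ _
  refine ⟨Finset.univ.sort r, fun u => by simp, ?_⟩
  refine ((Finset.pairwise_sort _ r).and (Finset.sort_nodup _ r)).imp ?_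
  rintro u v ⟨h1, h2⟩
  exact lt_of_le_of_ne h1 fun h => h2 (key_injective P h)

/-- The word with all letters determined by a set of pairs. -/
def sortedLetters : List (Letter M N) := (exists_sorted_letters P).choose

lemma mem_sortedLetters (u : Letter M N) : u ∈ sortedLetters P :=
  (exists_sorted_letters P).choose_spec.1 u

lemma pairwise_sortedLetters : (sortedLetters P).Pairwise fun u v => key P u < key P v :=
  (exists_sorted_letters P).choose_spec.2

lemma isShuffle_sortedLetters : IsShuffle (sortedLetters P) := by
  have h := pairwise_sortedLetters P
  constructor <;> rw [List.pairwise_filterMap] <;> refine h.imp fun {u v} huv => ?_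
  · rintro a ha b hb
    cases u <;> cases v <;> simp at ha hb
    subst ha hb
    exact (key_inl_lt P).1 huv
  · rintro a ha b hb
    cases u <;> cases v <;> simp at ha hb
    subst ha hb
    exact (key_inr_lt P).1 huv

open Classical in
/-- The word with a given set of letters whose letters are arranged according to a set of pairs. -/
def sortedWord (S : Letter M N → Prop) : Word M N :=
  ⟨(sortedLetters P).filter (S ·), isShuffle_of_sublist List.filter_sublist
    (isShuffle_sortedLetters P)⟩

variable {P}

lemma mem_sortedWord {S : Letter M N → Prop} {u : Letter M N} :
    u ∈ (sortedWord P S).letters ↔ S u := by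
  simp [sortedWord, mem_sortedLetters]

lemma pairwise_sortedWord (S : Letter M N → Prop) :
    (sortedWord P S).letters.Pairwise fun u v => key P u < key P v :=
  (pairwise_sortedLetters P).sublist List.filter_sublist

lemma Word.Before.key_lt {S : Letter M N → Prop} {u v : Letter M N}
    (h : (sortedWord P S).Before u v) : key P u < key P v :=
  List.pairwise_iff_forall_sublist.1 (pairwise_sortedWord S) h

lemma before_sortedWord {S : Letter M N → Prop} {u v : Letter M N} :
    (sortedWord P S).Before u v ↔ S u ∧ S v ∧ key P u < key P v := by
  refine ⟨fun h => ⟨mem_sortedWord.1 h.left, mem_sortedWord.1 h.right, h.key_lt⟩, ?_⟩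
  rintro ⟨hu, hv, h⟩
  refine (Word.before_or_before (mem_sortedWord.2 hu) (mem_sortedWord.2 hv) ?_).resolve_right
    fun h' => h'.key_lt.asymm h
  rintro rfl
  exact lt_irrefl _ h

/-- Since a list sorted by a strict order is determined by its members, equality of words reduces to
equality of their sets of letters. -/
lemma eq_of_mem_iff_of_pairwise {w w' : Word M N} (h : ∀ u, u ∈ w.letters ↔ u ∈ w'.letters)
    (hw : w.letters.Pairwise fun u v => key P u < key P v)
    (hw' : w'.letters.Pairwise fun u v => key P u < key P v) : w = w' := by
  have hp : w.letters.Perm w'.letters := (List.perm_ext_iff_of_nodup w.nodup w'.nodup).2 h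
  exact Word.ext (hp.eq_of_pairwise (fun _ _ _ _ h1 h2 => (h1.asymm h2).elim) hw hw')

/-- Pass through the word `T` of the common letters: going from `S` to `T` only deletes lower
letters, and going from `T` to `S'` only inserts upper letters. -/
lemma sortedWord_le {S S' : Letter M N → Prop} (hl : ∀ a, S' (.inl a) → S (.inl a))
    (hr : ∀ x, S (.inr x) → S' (.inr x)) : sortedWord P S ≤ sortedWord P S' := by
  classical
  let T : Letter M N → Prop := fun u => S u ∧ S' u
  refine le_trans (b := sortedWord P T) ?_ ?_
  · refine le_of_deletions (w := (sortedWord P S).letters) (w' := (sortedWord P T).letters)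
      (List.monotone_filter_right _ fun u => by simp +contextual [T])
      (List.filterMap_filter_congr ?_) [] (sortedWord P S).2 (sortedWord P T).2
    rintro (a | x) h
    · simp at h
    · simpa [T] using hr x
  · refine le_of_insertions (w := (sortedWord P S').letters) (w' := (sortedWord P T).letters)
      (List.monotone_filter_right _ fun u => by simp +contextual [T])
      (List.filterMap_filter_congr ?_) [] (sortedWord P S').2 (sortedWord P T).2
    rintro (a | x) h
    · simpa [T] using hl a
    · simp at h

lemma pairwise_bot : (⊥ : Word M N).letters.Pairwise fun u v => key P u < key P v := by
  rw [List.pairwise_iff_forall_sublist]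
  intro u v h
  have h : (⊥ : Word M N).Before u v := h
  have h1 := (Word.mem_bot _).1 h.left
  have h2 := (Word.mem_bot _).1 h.right
  cases u <;> cases v <;> simp at h1 h2
  exact (key_inl_lt P).2 h.lt_left

lemma pairwise_top : (⊤ : Word M N).letters.Pairwise fun u v => key P u < key P v := by
  rw [List.pairwise_iff_forall_sublist]
  intro u v h
  have h : (⊤ : Word M N).Before u v := h
  have h1 := (Word.mem_top _).1 h.left
  have h2 := (Word.mem_top _).1 h.right
  cases u <;> cases v <;> simp at h1 h2
  exact (key_inr_lt P).2 h.lt_right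

/-- A set of pairs of letters which is a strictly increasing matching of letters of the two
alphabets. -/
def IsMatching (P : Finset (Fin M × Fin N)) : Prop :=
  ∀ p ∈ P, ∀ q ∈ P, p.1 < q.1 ↔ p.2 < q.2

lemma IsMatching.eq_of_fst_eq (hP : IsMatching P) {p q : Fin M × Fin N} (hp : p ∈ P) (hq : q ∈ P)
    (h : p.1 = q.1) : p = q := by
  refine Prod.ext h (le_antisymm ?_ ?_)
  · exact not_lt.1 fun h' => ((hP q hq p hp).2 h').ne' h
  · exact not_lt.1 fun h' => ((hP p hp q hq).2 h').ne h

lemma IsMatching.eq_of_snd_eq (hP : IsMatching P) {p q : Fin M × Fin N} (hp : p ∈ P) (hq : q ∈ P)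
    (h : p.2 = q.2) : p = q := by
  refine Prod.ext (le_antisymm ?_ ?_) h
  · exact not_lt.1 fun h' => ((hP q hq p hp).1 h').ne' h
  · exact not_lt.1 fun h' => ((hP p hp q hq).1 h').ne h

/-- A letter strictly between `x_y` and `a_m` would require a second pair that crosses `(a_m, x_y)`.
This holds for every set `S` of present letters. -/
lemma IsMatching.adj (hP : IsMatching P) {p : Fin M × Fin N} (hp : p ∈ P) {S : Letter M N → Prop}
    (h1 : S (.inl p.1)) (h2 : S (.inr p.2)) :
    (sortedWord P S).Adj (.inr p.2) (.inl p.1) := by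
  refine ⟨before_sortedWord.2 ⟨h2, h1, (key_inr_lt_inl P).2 ⟨p, hp, le_rfl, le_rfl⟩⟩, ?_⟩
  intro z hz hz'
  replace hz := hz.key_lt
  replace hz' := hz'.key_lt
  cases z with
  | inl j =>
    obtain ⟨q, hq, hq1, hq2⟩ := (key_inr_lt_inl P).1 hz
    exact hq1.not_gt ((hP q hq p hp).1 (hq2.trans_lt ((key_inl_lt P).1 hz')))
  | inr l =>
    obtain ⟨q, hq, hq1, hq2⟩ := (key_inr_lt_inl P).1 hz'
    exact hq2.not_gt ((hP p hp q hq).2 (((key_inr_lt P).1 hz).trans_le hq1))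

variable (M N) in
/-- A matching together with times for the deletions and insertions of the letters, such that
the upper letter of each pair is inserted before the lower one is deleted. -/
@[ext] structure Code where
  /-- the matching -/
  pairs : Finset (Fin M × Fin N)
  isMatching : IsMatching pairs
  /-- the time at which a letter is deleted or inserted -/
  time : Letter M N → ℕ
  time_lt : ∀ p ∈ pairs, time (.inr p.2) < time (.inl p.1)

/-- The letters which are present before step `s`. -/
def Present (T : Letter M N → ℕ) (s : ℕ) : Letter M N → Prop
  | .inl a => s ≤ T (.inl a)
  | .inr x => T (.inr x) < s

/-- The sequence of words determined by a code. -/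
def Code.flag (c : Code M N) : Flag M N where
  word s := sortedWord c.pairs (Present c.time s)
  mono s t h := sortedWord_le (fun _ h' => h.trans h') (fun _ h' => lt_of_lt_of_le h' h)
  zero := by
    refine eq_of_mem_iff_of_pairwise (P := c.pairs) (fun u => ?_) (pairwise_sortedWord _)
      pairwise_bot
    rw [mem_sortedWord, Word.mem_bot]
    cases u <;> simp [Present]
  exists_top := by
    -- Any step beyond all times serves.
    refine ⟨∑ u, c.time u + 1, ?_⟩
    refine eq_of_mem_iff_of_pairwise (P := c.pairs) (fun u => ?_) (pairwise_sortedWord _)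
      pairwise_top
    rw [mem_sortedWord, Word.mem_top]
    have := Finset.single_le_sum (f := c.time) (fun _ _ => Nat.zero_le _) (Finset.mem_univ u)
    cases u with
    | inl a => exact iff_of_false (fun h => by simp only [Present] at h; omega) (by simp)
    | inr x => exact iff_of_true (by simp only [Present]; omega) (by simp)

lemma Code.time_flag (c : Code M N) : c.flag.time = c.time := by
  have key : ∀ u s, c.flag.time u < s ↔ c.time u < s := by
    intro u s
    rw [← Flag.done_iff]
    cases u with
    | inl a => exact (not_iff_not.2 mem_sortedWord).trans not_le
    | inr x => exact mem_sortedWord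
  funext u
  exact le_antisymm (Nat.lt_succ_iff.1 ((key u _).2 (Nat.lt_succ_self _)))
    (Nat.lt_succ_iff.1 ((key u _).1 (Nat.lt_succ_self _)))

/-- Minimality: if some `a_m'` were deleted right after `x_y` at an earlier time, `a_m` would still
be present then and be the letter following `x_y`, whence `m' = m`. -/
lemma Code.pair_flag_of_mem (c : Code M N) {p : Fin M × Fin N} (hp : p ∈ c.pairs) :
    c.flag.Pair p.1 p.2 := by
  have ht := c.time_lt p hp
  refine ⟨?_, fun m' h => ?_⟩
  · rw [c.time_flag]
    exact c.isMatching.adj hp le_rfl ht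
  · rw [c.time_flag] at h ⊢
    by_contra! hlt
    have h1 : c.time (.inr p.2) < c.time (.inl m') := mem_sortedWord.1 h.1.left
    have h2 := (c.isMatching.adj hp (S := Present c.time (c.time (.inl m'))) hlt.le h1).right_unique
      h
    rw [Sum.inl_injective h2] at hlt
    exact lt_irrefl _ hlt

/-- For a pair `(m, y)` of the flag, the order of the letters yields a pair `q` of the code with `y
≤ q.2` and `q.1 ≤ m`. As `q` is also a pair of the flag, the absence of crossings forces `q = (m,
y)`. -/
lemma Code.pair_flag_iff (c : Code M N) {m : Fin M} {y : Fin N} :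
    c.flag.Pair m y ↔ (m, y) ∈ c.pairs := by
  refine ⟨fun h => ?_, fun h => c.pair_flag_of_mem h⟩
  obtain ⟨q, hq, h1, h2⟩ := (key_inr_lt_inl c.pairs).1 h.1.1.key_lt
  have hq' := c.pair_flag_of_mem hq
  obtain h3 := h2.eq_of_not_lt fun hlt => ((hq'.lt_iff_lt h).1 hlt).not_ge h1
  rw [h3] at hq'
  rw [← h3, ← hq'.right_unique h]
  exact hq

open Classical in
/-- The code of a sequence of words. -/
def Flag.code (w : Flag M N) : Code M N where
  pairs := Finset.univ.filter fun p => w.Pair p.1 p.2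
  isMatching p hp q hq := by
    simp only [Finset.mem_filter, Finset.mem_univ, true_and] at hp hq
    exact hp.lt_iff_lt hq
  time := w.time
  time_lt p hp := by
    simp only [Finset.mem_filter, Finset.mem_univ, true_and] at hp
    exact hp.time_lt

lemma Flag.mem_pairs_code {w : Flag M N} {p : Fin M × Fin N} :
    p ∈ w.code.pairs ↔ w.Pair p.1 p.2 := by
  simp [Flag.code]

/-- The two criteria for `x_l` to precede `a_j` meet here: the order in each word of a flag is the
order of the keys of its own matching. So a flag is determined by its code. -/
lemma Flag.pairwise_word (w : Flag M N) (s : ℕ) :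
    (w.word s).letters.Pairwise fun u v => key w.code.pairs u < key w.code.pairs v := by
  rw [List.pairwise_iff_forall_sublist]
  intro u v h
  have h : (w.word s).Before u v := h
  cases u with
  | inl a =>
    cases v with
    | inl b => exact (key_inl_lt _).2 h.lt_left
    | inr y =>
      refine lt_of_le_of_ne (not_lt.1 fun h' => ?_) (key_inl_ne_inr _)
      obtain ⟨p, hp, h1, h2⟩ := (key_inr_lt_inl _).1 h'
      exact h.asymm ((mem_pairs_code.1 hp).before h1 h2 h.right h.left)
  | inr x =>
    cases v with
    | inl b =>
      obtain ⟨m, y, hp, h1, h2⟩ := exists_pair_of_before h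
      exact (key_inr_lt_inl _).2 ⟨(m, y), mem_pairs_code.2 hp, h1, h2⟩
    | inr y => exact (key_inr_lt _).2 h.lt_right

lemma Flag.flag_code (w : Flag M N) : w.code.flag = w := by
  ext1
  funext s
  refine eq_of_mem_iff_of_pairwise (P := w.code.pairs) (fun u => ?_) (pairwise_sortedWord _)
    (w.pairwise_word s)
  rw [Code.flag, mem_sortedWord]
  cases u with
  | inl a => exact w.inl_mem.symm
  | inr x => exact w.inr_mem.symm

lemma Code.code_flag (c : Code M N) : c.flag.code = c := by
  refine Code.ext ?_ c.time_flag
  ext p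
  rw [Flag.mem_pairs_code, c.pair_flag_iff]

/-- Sequences of words correspond to codes. -/
def flagEquivCode : Flag M N ≃ Code M N where
  toFun := Flag.code
  invFun := Code.flag
  left_inv := Flag.flag_code
  right_inv := Code.code_flag

end Shuffle

/-! ### Maximal chains as matchings with bijective times -/

namespace Shuffle

variable {M N : ℕ}

lemma card_filterMap_left (w : Word M N) [DecidablePred fun a : Fin M => .inl a ∈ w.letters] :
    (w.letters.filterMap Sum.getLeft?).length =
      (Finset.univ.filter fun a : Fin M => .inl a ∈ w.letters).card := by
  have h : (w.letters.filterMap Sum.getLeft?).Nodup := w.isShuffle.1.imp fun h => h.ne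
  rw [← List.toFinset_card_of_nodup h]
  congr 1
  ext a
  simp

lemma card_filterMap_right (w : Word M N) [DecidablePred fun x : Fin N => .inr x ∈ w.letters] :
    (w.letters.filterMap Sum.getRight?).length =
      (Finset.univ.filter fun x : Fin N => .inr x ∈ w.letters).card := by
  have h : (w.letters.filterMap Sum.getRight?).Nodup := w.isShuffle.2.imp fun h => h.ne
  rw [← List.toFinset_card_of_nodup h]
  congr 1
  ext a
  simp

open Classical in
lemma rank_eq_card (w : Word M N) : rank w = (Finset.univ.filter w.Done).card := by
  rw [rank, card_filterMap_left, card_filterMap_right, Finset.card_filter w.Done,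
    Fintype.sum_sum_type, ← Finset.card_filter, ← Finset.card_filter]
  congr 1
  · have h := Finset.card_filter_add_card_filter_not (s := Finset.univ)
      (fun a : Fin M => Sum.inl a ∈ w.letters)
    rw [Finset.card_univ, Fintype.card_fin] at h
    refine Nat.sub_eq_of_eq_add (h.symm.trans ((Nat.add_comm _ _).trans ?_))
    exact congrArg (· + _) (congrArg Finset.card (Finset.filter_congr fun _ _ => Iff.rfl))
  · exact congrArg Finset.card (Finset.filter_congr fun _ _ => Iff.rfl)

namespace Flag

variable (w : Flag M N)

open Classical in
lemma rank_word (s : ℕ) :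
    rank (w.word s) = (Finset.univ.filter fun u => w.time u < s).card := by
  rw [rank_eq_card]
  congr 1
  ext u
  simp [w.done_iff]

lemma word_eq_top {s : ℕ} (h : ∀ u, w.time u < s) : w.word s = ⊤ := by
  refine eq_of_mem_iff_of_pairwise (P := w.code.pairs) ?_ (w.pairwise_word s) pairwise_top
  exact Word.mem_iff_mem_of_done_iff fun u =>
    iff_of_true (w.done_iff.2 (h u)) (Word.done_top u)

end Flag

lemma covBy_of_le_of_rank {w w' : Word M N} (h : w ≤ w') (hr : rank w' = rank w + 1) :
    w ⋖ w' := by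
  refine ⟨lt_of_le_of_ne h fun he => ?_, fun v h1 h2 => ?_⟩
  · rw [he] at hr
    omega
  · have := rank_strictMono h1
    have := rank_strictMono h2
    omega

lemma strictMono_elt (c : MaxChain (Word M N) (M + N)) : StrictMono c.elt :=
  Fin.strictMono_iff_lt_succ.2 fun i => (c.covBy i).lt

lemma rank_elt (c : MaxChain (Word M N) (M + N)) (i : Fin (M + N + 1)) : rank (c.elt i) = i := by
  induction i using Fin.induction with
  | zero =>
    rw [c.elt_zero, rank_eq_card]
    simp [Word.not_done_bot]
  | succ i ih =>
    rw [(covBy_iff_step.1 (c.covBy i)).rank_eq, ih]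
    simp

/-- The maximal chain `c` as an infinite sequence of words. -/
def chainFlag (c : MaxChain (Word M N) (M + N)) : Flag M N where
  word s := c.elt ⟨min s (M + N), by omega⟩
  mono s t h := (strictMono_elt c).monotone (Fin.mk_le_mk.2 (min_le_min_right _ h))
  zero := by simpa using c.elt_zero
  exists_top := ⟨M + N, by simpa using! c.elt_last⟩

lemma word_chainFlag (c : MaxChain (Word M N) (M + N)) (i : Fin (M + N + 1)) :
    (chainFlag c).word i = c.elt i := by
  simp only [chainFlag]
  congr 1
  exact Fin.ext (min_eq_left (by omega))

lemma word_castSucc (c : MaxChain (Word M N) (M + N)) (i : Fin (M + N)) :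
    c.elt i.castSucc = (chainFlag c).word i := (word_chainFlag c i.castSucc).symm

lemma word_succ (c : MaxChain (Word M N) (M + N)) (i : Fin (M + N)) :
    c.elt i.succ = (chainFlag c).word (i + 1) := (word_chainFlag c i.succ).symm

lemma time_chainFlag_lt (c : MaxChain (Word M N) (M + N)) (u : Letter M N) :
    (chainFlag c).time u < M + N := by
  rw [← Flag.done_iff, ← Fin.val_last (M + N), word_chainFlag, c.elt_last]
  exact Word.done_top u

/-- Otherwise the same letters would be treated before and after step `i`, although the rank
increases. As there are `M + N` letters and steps, surjectivity of the times suffices for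
bijectivity. -/
lemma exists_time_chainFlag_eq (c : MaxChain (Word M N) (M + N)) (i : Fin (M + N)) :
    ∃ u, (chainFlag c).time u = i := by
  classical
  have h1 := rank_elt c i.castSucc
  have h2 := rank_elt c i.succ
  rw [word_castSucc, Flag.rank_word] at h1
  rw [word_succ, Flag.rank_word] at h2
  simp only [Fin.val_castSucc, Fin.val_succ] at h1 h2
  by_contra! h
  have : (Finset.univ.filter fun u => (chainFlag c).time u < i + 1) =
      Finset.univ.filter fun u => (chainFlag c).time u < i := by
    ext u
    have := h u
    simp only [Finset.mem_filter, Finset.mem_univ, true_and]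
    omega
  rw [this] at h2
  omega

/-- The times of the deletions and insertions along a maximal chain. -/
def chainTime (c : MaxChain (Word M N) (M + N)) : Letter M N ≃ Fin (M + N) :=
  Equiv.ofBijective (fun u => ⟨(chainFlag c).time u, time_chainFlag_lt c u⟩)
    ((Fintype.bijective_iff_surjective_and_card _).2 ⟨fun i => by
      obtain ⟨u, hu⟩ := exists_time_chainFlag_eq c i
      exact ⟨u, Fin.ext hu⟩, by simp⟩)

@[simp]
lemma val_chainTime (c : MaxChain (Word M N) (M + N)) (u : Letter M N) :
    (chainTime c u : ℕ) = (chainFlag c).time u := rfl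

/-- The pairs of letters that share a label in a maximal chain. -/
def chainPairs (c : MaxChain (Word M N) (M + N)) : Finset (Fin M × Fin N) :=
  (chainFlag c).code.pairs

lemma isMatching_chainPairs (c : MaxChain (Word M N) (M + N)) : IsMatching (chainPairs c) :=
  (chainFlag c).code.isMatching

lemma chainTime_lt (c : MaxChain (Word M N) (M + N)) {p : Fin M × Fin N} (hp : p ∈ chainPairs c) :
    chainTime c (.inr p.2) < chainTime c (.inl p.1) :=
  (chainFlag c).code.time_lt p hp

lemma MaxChain.ext_flag {c c' : MaxChain (Word M N) (M + N)} (h : chainFlag c = chainFlag c') :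
    c = c' := by
  have : c.elt = c'.elt := by
    funext i
    rw [← word_chainFlag, h, word_chainFlag]
  cases c
  cases c'
  cases this
  rfl

lemma chain_ext {c c' : MaxChain (Word M N) (M + N)} (hp : chainPairs c = chainPairs c')
    (ht : chainTime c = chainTime c') : c = c' := by
  refine MaxChain.ext_flag (flagEquivCode.injective (Code.ext hp ?_))
  funext u
  exact congrArg Fin.val (DFunLike.congr_fun ht u)

/-- The code given by a matching and a bijective system of times. -/
@[simps] def bijCode {P : Finset (Fin M × Fin N)} (hP : IsMatching P)
    (τ : Letter M N ≃ Fin (M + N)) (hτ : ∀ p ∈ P, τ (.inr p.2) < τ (.inl p.1)) : Code M N where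
  pairs := P
  isMatching := hP
  time u := τ u
  time_lt p hp := hτ p hp

/-- The maximal chain given by a matching and a bijective system of times. -/
def chainOf {P : Finset (Fin M × Fin N)} (hP : IsMatching P)
    (τ : Letter M N ≃ Fin (M + N)) (hτ : ∀ p ∈ P, τ (.inr p.2) < τ (.inl p.1)) :
    MaxChain (Word M N) (M + N) where
  elt i := (bijCode hP τ hτ).flag.word i
  elt_zero := Flag.zero _
  elt_last := Flag.word_eq_top _ fun u => by
    rw [Code.time_flag]
    exact (τ u).isLt
  covBy i := by
    classical
    refine covBy_of_le_of_rank (Flag.mono _ (by simp)) ?_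
    -- Step `i` treats exactly one letter, `τ.symm i`, so the rank increases by one.
    rw [Flag.rank_word, Flag.rank_word, Code.time_flag,
      ← Finset.card_insert_of_notMem (a := τ.symm i) (by simp)]
    congr 1
    ext u
    simp only [Finset.mem_filter, Finset.mem_univ, true_and, Finset.mem_insert,
      Equiv.eq_symm_apply, bijCode_time, Fin.val_succ, Fin.val_castSucc, Fin.ext_iff]
    omega

section ChainOf

variable {P : Finset (Fin M × Fin N)} (hP : IsMatching P)
    (τ : Letter M N ≃ Fin (M + N)) (hτ : ∀ p ∈ P, τ (.inr p.2) < τ (.inl p.1))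

lemma chainFlag_chainOf : chainFlag (chainOf hP τ hτ) = (bijCode hP τ hτ).flag := by
  ext1
  funext s
  change (bijCode hP τ hτ).flag.word (min s (M + N)) = _
  rcases le_total s (M + N) with h | h
  · rw [min_eq_left h]
  · have key : ∀ t, M + N ≤ t → (bijCode hP τ hτ).flag.word t = ⊤ := by
      intro t ht
      refine Flag.word_eq_top _ fun u => ?_
      rw [Code.time_flag]
      exact (τ u).isLt.trans_le ht
    rw [key _ h, min_eq_right h, key _ le_rfl]

@[simp]
lemma chainPairs_chainOf : chainPairs (chainOf hP τ hτ) = P := by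
  rw [chainPairs, chainFlag_chainOf, Code.code_flag]
  rfl

@[simp]
lemma chainTime_chainOf : chainTime (chainOf hP τ hτ) = τ := by
  ext u
  rw [val_chainTime, chainFlag_chainOf, Code.time_flag]
  rfl

end ChainOf

/-! ### Labels -/

open Classical in
/-- The label of a letter with respect to a matching: the upper letter of a pair is the label of
both letters of the pair, and the other letters are their own labels. -/
def letterLabel (P : Finset (Fin M × Fin N)) : Letter M N → Letter M N
  | .inl a => if h : ∃ y, (a, y) ∈ P then .inr h.choose else .inl a
  | .inr x => .inr x

lemma IsMatching.letterLabel_inl {P : Finset (Fin M × Fin N)} (hP : IsMatching P)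
    {p : Fin M × Fin N} (hp : p ∈ P) : letterLabel P (.inl p.1) = .inr p.2 := by
  have h : ∃ y, (p.1, y) ∈ P := ⟨p.2, hp⟩
  rw [letterLabel, dif_pos h]
  exact congrArg (fun q : Fin M × Fin N => Sum.inr q.2) (hP.eq_of_fst_eq h.choose_spec hp rfl)

lemma letterLabel_inl_of_notMem {P : Finset (Fin M × Fin N)} {a : Fin M}
    (h : ¬ ∃ y, (a, y) ∈ P) : letterLabel P (.inl a) = .inl a := by
  rw [letterLabel, dif_neg h]

@[simp]
lemma letterLabel_inr {P : Finset (Fin M × Fin N)} (x : Fin N) :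
    letterLabel P (.inr x) = .inr x := rfl

lemma time_of_deletes {c : MaxChain (Word M N) (M + N)} {i : Fin (M + N)} {a : Fin M}
    (h : Deletes (c.elt i.castSucc) (c.elt i.succ) a) : chainTime c (.inl a) = i := by
  obtain ⟨u, v, h1, h2⟩ := h
  have hn := (c.elt i.castSucc).nodup
  have h3 : .inl a ∈ (c.elt i.castSucc).letters := by simp [h1]
  have h4 : .inl a ∉ (c.elt i.succ).letters := by
    rw [h2]
    rw [h1] at hn
    exact (List.nodup_cons.1 (List.nodup_middle.1 hn)).1
  rw [word_castSucc, Flag.inl_mem] at h3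
  rw [word_succ, Flag.inl_mem] at h4
  exact Fin.ext (by rw [val_chainTime]; omega)

lemma time_of_inserts {c : MaxChain (Word M N) (M + N)} {i : Fin (M + N)} {x : Fin N}
    (h : Inserts (c.elt i.castSucc) (c.elt i.succ) x) : chainTime c (.inr x) = i := by
  obtain ⟨u, v, h1, h2⟩ := h
  have hn := (c.elt i.succ).nodup
  have h3 : .inr x ∈ (c.elt i.succ).letters := by simp [h2]
  have h4 : .inr x ∉ (c.elt i.castSucc).letters := by
    rw [h1]
    rw [h2] at hn
    exact (List.nodup_cons.1 (List.nodup_middle.1 hn)).1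
  rw [word_castSucc, Flag.inr_mem] at h4
  rw [word_succ, Flag.inr_mem] at h3
  exact Fin.ext (by rw [val_chainTime]; omega)

lemma deletes_time (c : MaxChain (Word M N) (M + N)) (a : Fin M) :
    Deletes (c.elt (chainTime c (.inl a)).castSucc) (c.elt (chainTime c (.inl a)).succ) a := by
  rcases covBy_iff_step.1 (c.covBy (chainTime c (.inl a))) with ⟨b, h⟩ | ⟨x, h⟩
  · have := time_of_deletes h
    rw [EmbeddingLike.apply_eq_iff_eq] at this
    obtain rfl := Sum.inl_injective this
    exact h
  · have := time_of_inserts h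
    simp at this

lemma inserts_time (c : MaxChain (Word M N) (M + N)) (x : Fin N) :
    Inserts (c.elt (chainTime c (.inr x)).castSucc) (c.elt (chainTime c (.inr x)).succ) x := by
  rcases covBy_iff_step.1 (c.covBy (chainTime c (.inr x))) with ⟨b, h⟩ | ⟨y, h⟩
  · have := time_of_deletes h
    simp at this
  · have := time_of_inserts h
    rw [EmbeddingLike.apply_eq_iff_eq] at this
    obtain rfl := Sum.inr_injective this
    exact h

lemma deletesAfter_iff {c : MaxChain (Word M N) (M + N)} {i : Fin (M + N)} {x : Fin N} :
    DeletesAfter (c.elt i.castSucc) (c.elt i.succ) x ↔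
      ∃ a, chainTime c (.inl a) = i ∧
        ((chainFlag c).word ((chainFlag c).time (.inl a))).Adj (.inr x) (.inl a) := by
  constructor
  · rintro ⟨u, v, a, h1, h2⟩
    have ht : chainTime c (.inl a) = i :=
      time_of_deletes ⟨u ++ [.inr x], v, by simpa using h1, by simpa using h2⟩
    refine ⟨a, ht, ?_⟩
    rw [← val_chainTime, ht, ← word_castSucc]
    exact Word.adj_of_eq_append h1
  · rintro ⟨a, rfl, h⟩
    rw [← val_chainTime, ← word_castSucc] at h
    obtain ⟨u, v, huv⟩ := Word.adj_iff_exists.1 h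
    obtain ⟨u', v', h1, h2⟩ := deletes_time c a
    have hn := (c.elt (chainTime c (.inl a)).castSucc).nodup
    have h3 : u' ++ .inl a :: v' = (u ++ [.inr x]) ++ .inl a :: v := by
      rw [← h1, huv]; simp
    rw [h1] at hn
    have h4 := (List.nodup_cons.1 (List.nodup_middle.1 hn)).1
    rw [List.mem_append, not_or] at h4
    -- The letters are distinct, so the factorizations of the word around `a` coming from the
    -- adjacency and from the deletion coincide.
    obtain ⟨rfl, -, rfl⟩ := (List.append_cons_inj_of_notMem h4.1 h4.2).1 h3
    exact ⟨u, v', a, huv, by simpa using h2⟩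

lemma isFirstDeletionAfter_iff {c : MaxChain (Word M N) (M + N)} {i : Fin (M + N)} {x : Fin N} :
    IsFirstDeletionAfter c i x ↔
      ∃ a, chainTime c (.inl a) = i ∧ (a, x) ∈ chainPairs c := by
  simp only [IsFirstDeletionAfter, deletesAfter_iff, chainPairs, Flag.mem_pairs_code]
  constructor
  · rintro ⟨⟨a, rfl, h1⟩, h2⟩
    refine ⟨a, rfl, h1, fun m' hm' => ?_⟩
    by_contra! hlt
    exact h2 (chainTime c (.inl m')) hlt ⟨m', rfl, hm'⟩
  · rintro ⟨a, rfl, h1, h2⟩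
    refine ⟨⟨a, rfl, h1⟩, ?_⟩
    rintro j hj ⟨m', rfl, hm'⟩
    exact (h2 m' hm').not_gt hj

/-- The letters chosen in `label` are identified by uniqueness: a step treats only one letter, and a
lower letter has at most one partner. -/
lemma label_chainTime (c : MaxChain (Word M N) (M + N)) (u : Letter M N) :
    label c (chainTime c u) = letterLabel (chainPairs c) u := by
  cases u with
  | inr x =>
    have h : ∃ y, Inserts (c.elt (chainTime c (.inr x)).castSucc)
        (c.elt (chainTime c (.inr x)).succ) y := ⟨x, inserts_time c x⟩
    rw [label, dif_pos h, letterLabel_inr]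
    exact (chainTime c).injective (time_of_inserts h.choose_spec)
  | inl a =>
    have h : ¬ ∃ y, Inserts (c.elt (chainTime c (.inl a)).castSucc)
        (c.elt (chainTime c (.inl a)).succ) y := by
      rintro ⟨y, hy⟩
      simpa using time_of_inserts hy
    rw [label, dif_neg h]
    have hiff : ∀ x, IsFirstDeletionAfter c (chainTime c (.inl a)) x ↔ (a, x) ∈ chainPairs c := by
      intro x
      rw [isFirstDeletionAfter_iff]
      simp
    split_ifs with h1
    · have h2 := (hiff _).1 h1.choose_spec
      exact ((isMatching_chainPairs c).letterLabel_inl h2).symm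
    · rw [letterLabel_inl_of_notMem fun ⟨y, hy⟩ => h1 ⟨y, (hiff y).2 hy⟩]
      generalize_proofs h2
      exact (chainTime c).injective (time_of_deletes h2.choose_spec)

lemma label_eq (c : MaxChain (Word M N) (M + N)) (i : Fin (M + N)) :
    label c i = letterLabel (chainPairs c) ((chainTime c).symm i) := by
  rw [← label_chainTime, Equiv.apply_symm_apply]

end Shuffle

namespace Shuffle

variable {M N : ℕ}

/-! ### Maximal chains are determined by their labels -/

section Cases

variable (P : Finset (Fin M × Fin N))

/-- A letter that does not belong to any pair. -/
def Unpaired : Letter M N → Prop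
  | .inl a => ¬ ∃ y, (a, y) ∈ P
  | .inr x => ¬ ∃ a, (a, x) ∈ P

lemma letter_cases (u : Letter M N) :
    (∃ p ∈ P, u = .inl p.1) ∨ (∃ p ∈ P, u = .inr p.2) ∨ Unpaired P u := by
  cases u with
  | inl a =>
    by_cases h : ∃ y, (a, y) ∈ P
    · obtain ⟨y, hy⟩ := h
      exact .inl ⟨_, hy, rfl⟩
    · exact .inr (.inr h)
  | inr x =>
    by_cases h : ∃ a, (a, x) ∈ P
    · obtain ⟨a, ha⟩ := h
      exact .inr (.inl ⟨_, ha, rfl⟩)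
    · exact .inr (.inr h)

variable {P}

lemma Unpaired.ne_inl {u : Letter M N} (h : Unpaired P u) {p : Fin M × Fin N} (hp : p ∈ P) :
    u ≠ .inl p.1 := by
  rintro rfl
  exact h ⟨p.2, hp⟩

lemma Unpaired.ne_inr {u : Letter M N} (h : Unpaired P u) {p : Fin M × Fin N} (hp : p ∈ P) :
    u ≠ .inr p.2 := by
  rintro rfl
  exact h ⟨p.1, hp⟩

lemma Unpaired.letterLabel_eq {u : Letter M N} (h : Unpaired P u) : letterLabel P u = u := by
  cases u with
  | inl a => exact letterLabel_inl_of_notMem h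
  | inr x => rfl

lemma Unpaired.eq_of_letterLabel_eq (hP : IsMatching P) {u v : Letter M N} (h : Unpaired P u)
    (hv : letterLabel P v = u) : v = u := by
  rcases letter_cases P v with ⟨p, hp, rfl⟩ | ⟨p, hp, rfl⟩ | hv'
  · rw [hP.letterLabel_inl hp] at hv
    exact absurd hv.symm (h.ne_inr hp)
  · exact hv
  · rwa [hv'.letterLabel_eq] at hv

lemma IsMatching.letterLabel_eq_inr (hP : IsMatching P) {p : Fin M × Fin N} (hp : p ∈ P)
    {v : Letter M N} (hv : letterLabel P v = .inr p.2) : v = .inr p.2 ∨ v = .inl p.1 := by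
  rcases letter_cases P v with ⟨q, hq, rfl⟩ | ⟨q, hq, rfl⟩ | hv'
  · rw [hP.letterLabel_inl hq] at hv
    rw [hP.eq_of_snd_eq hq hp (Sum.inr_injective hv)]
    exact .inr rfl
  · exact .inl hv
  · rw [hv'.letterLabel_eq] at hv
    exact .inl hv

lemma exists_letterLabel_eq_inl_iff (hP : IsMatching P) {a : Fin M} :
    (∃ v, letterLabel P v = .inl a) ↔ ¬ ∃ y, (a, y) ∈ P := by
  constructor
  · rintro ⟨v, hv⟩ ⟨y, hy⟩
    rcases letter_cases P v with ⟨p, hp, rfl⟩ | ⟨p, hp, rfl⟩ | hv'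
    · rw [hP.letterLabel_inl hp] at hv
      cases hv
    · cases hv
    · rw [hv'.letterLabel_eq] at hv
      exact hv'.ne_inl hy hv
  · intro h
    exact ⟨.inl a, letterLabel_inl_of_notMem h⟩

lemma exists_letterLabel_eq_inr_iff (hP : IsMatching P) {x : Fin N} :
    (∃ v v', v ≠ v' ∧ letterLabel P v = .inr x ∧ letterLabel P v' = .inr x) ↔
      ∃ a, (a, x) ∈ P := by
  constructor
  · rintro ⟨v, v', hne, hv, hv'⟩
    by_contra hx
    have hx : Unpaired P (.inr x) := hx
    exact hne ((hx.eq_of_letterLabel_eq hP hv).trans (hx.eq_of_letterLabel_eq hP hv').symm)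
  · rintro ⟨a, ha⟩
    exact ⟨.inl a, .inr x, by simp, hP.letterLabel_inl ha, rfl⟩

end Cases

/-- The two letters of a pair have the same rank among the matched letters of their alphabets. This
is why the two projections determine an increasing matching. -/
lemma IsMatching.card_filter_fst {P : Finset (Fin M × Fin N)} (hP : IsMatching P)
    {p : Fin M × Fin N} (hp : p ∈ P) :
    ((P.image Prod.fst).filter (· < p.1)).card = ((P.image Prod.snd).filter (· < p.2)).card := by
  rw [Finset.filter_image, Finset.filter_image, Finset.card_image_of_injOn,
    Finset.card_image_of_injOn]
  · congr 1
    exact Finset.filter_congr fun q hq => hP q hq p hp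
  · intro q hq q' hq' h
    exact hP.eq_of_snd_eq (Finset.mem_filter.1 hq).1 (Finset.mem_filter.1 hq').1 h
  · intro q hq q' hq' h
    exact hP.eq_of_fst_eq (Finset.mem_filter.1 hq).1 (Finset.mem_filter.1 hq').1 h

lemma eq_of_card_filter_lt {α : Type*} [LinearOrder α] {s : Finset α} {a b : α} (ha : a ∈ s)
    (hb : b ∈ s) (h : (s.filter (· < a)).card = (s.filter (· < b)).card) : a = b := by
  have key : ∀ {a b : α}, a ∈ s → a < b → (s.filter (· < a)).card < (s.filter (· < b)).card := by
    intro a b ha hab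
    refine Finset.card_lt_card ((Finset.ssubset_iff_of_subset ?_).2 ⟨a, ?_, ?_⟩)
    · exact Finset.monotone_filter_right _ fun c hc hc' => hc'.trans hab
    · simp [ha, hab]
    · simp
  rcases lt_trichotomy a b with h' | h' | h'
  · exact absurd h (key ha h').ne
  · exact h'
  · exact absurd h (key hb h').ne'

lemma IsMatching.subset_of_image_eq {P Q : Finset (Fin M × Fin N)} (hP : IsMatching P)
    (hQ : IsMatching Q) (h1 : P.image Prod.fst = Q.image Prod.fst)
    (h2 : P.image Prod.snd = Q.image Prod.snd) : P ⊆ Q := by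
  intro p hp
  obtain ⟨q, hq, hqp⟩ := Finset.mem_image.1 (h1 ▸ Finset.mem_image_of_mem Prod.fst hp)
  have h3 := hP.card_filter_fst hp
  have h4 := hQ.card_filter_fst hq
  rw [← h1, ← h2, hqp, h3] at h4
  have h5 := eq_of_card_filter_lt (Finset.mem_image_of_mem Prod.snd hp)
    (h2 ▸ Finset.mem_image_of_mem Prod.snd hq) h4
  rwa [Prod.ext hqp.symm h5]

lemma IsMatching.eq_of_image_eq {P Q : Finset (Fin M × Fin N)} (hP : IsMatching P)
    (hQ : IsMatching Q) (h1 : P.image Prod.fst = Q.image Prod.fst)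
    (h2 : P.image Prod.snd = Q.image Prod.snd) : P = Q :=
  (hP.subset_of_image_eq hQ h1 h2).antisymm (hQ.subset_of_image_eq hP h1.symm h2.symm)

/-- The multiset of labels shows which letters are matched: `a_m` is matched iff it is not a label,
and `x_y` is matched iff it is the label of two letters. -/
lemma IsMatching.eq_of_letterLabel {P Q : Finset (Fin M × Fin N)} (hP : IsMatching P)
    (hQ : IsMatching Q) (e : Equiv.Perm (Letter M N))
    (h : ∀ u, letterLabel Q (e u) = letterLabel P u) : P = Q := by
  refine hP.eq_of_image_eq hQ ?_ ?_
  · ext a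
    have : (∃ v, letterLabel P v = .inl a) ↔ ∃ v, letterLabel Q v = .inl a := by
      rw [← e.exists_congr_right (q := fun v => letterLabel Q v = .inl a)]
      simp only [h]
    rw [exists_letterLabel_eq_inl_iff hP, exists_letterLabel_eq_inl_iff hQ, not_iff_not] at this
    simpa using this
  · ext x
    have : (∃ v v', v ≠ v' ∧ letterLabel P v = .inr x ∧ letterLabel P v' = .inr x) ↔
        ∃ v v', v ≠ v' ∧ letterLabel Q v = .inr x ∧ letterLabel Q v' = .inr x := by
      constructor
      · rintro ⟨v, v', hne, h1, h2⟩
        exact ⟨e v, e v', e.injective.ne hne, by rwa [h], by rwa [h]⟩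
      · rintro ⟨v, v', hne, h1, h2⟩
        exact ⟨e.symm v, e.symm v', e.symm.injective.ne hne, by rwa [← h, e.apply_symm_apply],
          by rwa [← h, e.apply_symm_apply]⟩
    rw [exists_letterLabel_eq_inr_iff hP, exists_letterLabel_eq_inr_iff hQ] at this
    simpa using this

lemma chainPairs_eq_of_label {c c' : MaxChain (Word M N) (M + N)}
    (e : Equiv.Perm (Fin (M + N))) (h : ∀ i, label c' (e i) = label c i) :
    chainPairs c' = chainPairs c := by
  refine ((isMatching_chainPairs c).eq_of_letterLabel (isMatching_chainPairs c')
    ((chainTime c).trans (e.trans (chainTime c').symm)) fun u => ?_).symm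
  have := h (chainTime c u)
  rw [label_chainTime, label_eq] at this
  exact this

/-- Equal label sequences have equal matchings. Unpaired letters are then located by their labels;
of the two occurrences of `x_y` the earlier one is the insertion. -/
lemma label_injective :
    Function.Injective (label : MaxChain (Word M N) (M + N) → Fin (M + N) → Letter M N) := by
  intro c c' h
  have hp : chainPairs c' = chainPairs c :=
    chainPairs_eq_of_label (Equiv.refl _) fun i => (congrFun h i).symm
  have hM := isMatching_chainPairs c
  have hl : ∀ u, letterLabel (chainPairs c) ((chainTime c').symm (chainTime c u)) =
      letterLabel (chainPairs c) u := by
    intro u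
    rw [← label_chainTime c u, h, label_eq, hp]
  refine chain_ext hp.symm (Equiv.ext fun u => ?_)
  rw [← Equiv.symm_apply_eq, eq_comm, eq_comm]
  have key : ∀ p ∈ chainPairs c, (chainTime c').symm (chainTime c (.inr p.2)) = .inr p.2 ∧
      (chainTime c').symm (chainTime c (.inl p.1)) = .inl p.1 := by
    intro p hp'
    have h1 := hM.letterLabel_eq_inr hp' (hl (.inr p.2))
    have h2 := hM.letterLabel_eq_inr hp' ((hl (.inl p.1)).trans (hM.letterLabel_inl hp'))
    have h3 := chainTime_lt c hp'
    have h4 := chainTime_lt c' (hp ▸ hp')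
    rw [Equiv.symm_apply_eq, Equiv.symm_apply_eq] at h1 h2 ⊢
    -- Both letters cannot sit in the same step, and exchanging them would contradict that `x_y` is
    -- inserted before `a_m` is deleted in both chains.
    rcases h1 with h1 | h1 <;> rcases h2 with h2 | h2 <;> rw [h1, h2] at h3
    · exact absurd h3 (lt_irrefl _)
    · exact ⟨h1, h2⟩
    · exact absurd h3 h4.asymm
    · exact absurd h3 (lt_irrefl _)
  rcases letter_cases (chainPairs c) u with ⟨p, hp', rfl⟩ | ⟨p, hp', rfl⟩ | hu
  · exact (key p hp').2
  · exact (key p hp').1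
  · exact hu.eq_of_letterLabel_eq hM ((hl u).trans hu.letterLabel_eq)

/-! ### Rearranging the letters of the pairs -/

open Classical in
/-- The involution that exchanges the two letters of those pairs that satisfy `C`. -/
def exchange (P : Finset (Fin M × Fin N)) (C : Fin M × Fin N → Prop) : Letter M N → Letter M N
  | .inl a => if h : ∃ y, (a, y) ∈ P ∧ C (a, y) then .inr h.choose else .inl a
  | .inr x => if h : ∃ a, (a, x) ∈ P ∧ C (a, x) then .inl h.choose else .inr x

section Exchange

variable {P : Finset (Fin M × Fin N)} (C : Fin M × Fin N → Prop)

open Classical in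
lemma IsMatching.exchange_inl (hP : IsMatching P) {p : Fin M × Fin N} (hp : p ∈ P) :
    exchange P C (.inl p.1) = if C p then .inr p.2 else .inl p.1 := by
  have huniq : ∀ y, (p.1, y) ∈ P → y = p.2 := fun y hy =>
    congrArg Prod.snd (hP.eq_of_fst_eq hy hp rfl)
  split_ifs with hC
  · have h : ∃ y, (p.1, y) ∈ P ∧ C (p.1, y) := ⟨p.2, hp, hC⟩
    rw [exchange, dif_pos h, huniq _ h.choose_spec.1]
  · rw [exchange, dif_neg]
    rintro ⟨y, hy, hC'⟩
    rw [huniq y hy] at hC'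
    exact hC hC'

open Classical in
lemma IsMatching.exchange_inr (hP : IsMatching P) {p : Fin M × Fin N} (hp : p ∈ P) :
    exchange P C (.inr p.2) = if C p then .inl p.1 else .inr p.2 := by
  have huniq : ∀ a, (a, p.2) ∈ P → a = p.1 := fun y hy =>
    congrArg Prod.fst (hP.eq_of_snd_eq hy hp rfl)
  split_ifs with hC
  · have h : ∃ a, (a, p.2) ∈ P ∧ C (a, p.2) := ⟨p.1, hp, hC⟩
    rw [exchange, dif_pos h, huniq _ h.choose_spec.1]
  · rw [exchange, dif_neg]
    rintro ⟨y, hy, hC'⟩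
    rw [huniq y hy] at hC'
    exact hC hC'

lemma Unpaired.exchange_eq {u : Letter M N} (h : Unpaired P u) : exchange P C u = u := by
  cases u with
  | inl a => exact dif_neg fun ⟨y, hy, _⟩ => h ⟨y, hy⟩
  | inr x => exact dif_neg fun ⟨y, hy, _⟩ => h ⟨y, hy⟩

lemma IsMatching.exchange_involutive (hP : IsMatching P) : Function.Involutive (exchange P C) := by
  classical
  intro u
  rcases letter_cases P u with ⟨p, hp, rfl⟩ | ⟨p, hp, rfl⟩ | hu
  · rw [hP.exchange_inl C hp]
    split_ifs with h
    · rw [hP.exchange_inr C hp, if_pos h]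
    · rw [hP.exchange_inl C hp, if_neg h]
  · rw [hP.exchange_inr C hp]
    split_ifs with h
    · rw [hP.exchange_inl C hp, if_pos h]
    · rw [hP.exchange_inr C hp, if_neg h]
  · rw [hu.exchange_eq, hu.exchange_eq]

lemma IsMatching.letterLabel_exchange (hP : IsMatching P) (u : Letter M N) :
    letterLabel P (exchange P C u) = letterLabel P u := by
  classical
  rcases letter_cases P u with ⟨p, hp, rfl⟩ | ⟨p, hp, rfl⟩ | hu
  · rw [hP.exchange_inl C hp]
    split_ifs with h
    · rw [hP.letterLabel_inl hp, letterLabel_inr]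
    · rfl
  · rw [hP.exchange_inr C hp]
    split_ifs with h
    · rw [hP.letterLabel_inl hp, letterLabel_inr]
    · rfl
  · rw [hu.exchange_eq]

/-- The letters of each pair can be exchanged such that a given function becomes increasing on
all pairs. -/
lemma IsMatching.exists_perm_le (hP : IsMatching P) {α : Type*} [LinearOrder α] (f : Letter M N → α) :
    ∃ s : Equiv.Perm (Letter M N), (∀ u, letterLabel P (s u) = letterLabel P u) ∧
      ∀ p ∈ P, f (s (.inr p.2)) ≤ f (s (.inl p.1)) := by
  classical
  refine ⟨(hP.exchange_involutive fun p => f (.inl p.1) < f (.inr p.2)).toPerm,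
    hP.letterLabel_exchange fun p => f (.inl p.1) < f (.inr p.2), fun p hp => ?_⟩
  simp only [Function.Involutive.coe_toPerm]
  rw [hP.exchange_inl _ hp, hP.exchange_inr _ hp]
  split_ifs with h
  · exact h.le
  · exact not_lt.1 h

/-- Every arrangement of the labels of a matching is the label sequence of a maximal chain. -/
lemma IsMatching.exists_chain (hP : IsMatching P) (τ : Letter M N ≃ Fin (M + N)) :
    ∃ c, chainPairs c = P ∧ ∀ i, label c i = letterLabel P (τ.symm i) := by
  obtain ⟨s, hs1, hs2⟩ := hP.exists_perm_le τ
  -- Sorting each pair only yields `≤`; injectivity of `τ` makes the inequality strict.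
  refine ⟨chainOf hP (s.trans τ) fun p hp => lt_of_le_of_ne (hs2 p hp) ?_, by simp, fun i => ?_⟩
  · simp
  · rw [label_eq, chainPairs_chainOf, chainTime_chainOf, Equiv.symm_trans_apply, ← hs1,
      Equiv.apply_symm_apply]

end Exchange

/-! ### The action on maximal chains and its locality -/

lemma existsUnique_chain (σ : Equiv.Perm (Fin (M + N))) (c : MaxChain (Word M N) (M + N)) :
    ∃! c' : MaxChain (Word M N) (M + N), ∀ i, label c' i = label c (σ⁻¹ i) := by
  obtain ⟨c', -, hc'⟩ := (isMatching_chainPairs c).exists_chain ((chainTime c).trans σ)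
  refine ⟨c', fun i => ?_, fun c'' h => label_injective ?_⟩
  · rw [hc', label_eq]
    rfl
  · funext i
    rw [h, hc', label_eq]
    rfl

/-- The action of the symmetric group on the maximal chains by permuting the labels. -/
abbrev chainAction : MulAction (Equiv.Perm (Fin (M + N))) (MaxChain (Word M N) (M + N)) where
  smul σ c := (existsUnique_chain σ c).choose
  one_smul c := ((existsUnique_chain 1 c).choose_spec.2 c fun i => by simp).symm
  mul_smul σ τ c := ((existsUnique_chain (σ * τ) c).choose_spec.2 _ fun i => by
    have h1 := (existsUnique_chain σ (existsUnique_chain τ c).choose).choose_spec.1 i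
    have h2 := (existsUnique_chain τ c).choose_spec.1 (σ⁻¹ i)
    rw [mul_inv_rev, Equiv.Perm.mul_apply]
    exact h1.trans h2).symm

attribute [local instance] chainAction

lemma label_smul (σ : Equiv.Perm (Fin (M + N))) (c : MaxChain (Word M N) (M + N))
    (i : Fin (M + N)) : label (σ • c) i = label c (σ⁻¹ i) :=
  (existsUnique_chain σ c).choose_spec.1 i

lemma smul_eq_of_label {σ : Equiv.Perm (Fin (M + N))} {c c' : MaxChain (Word M N) (M + N)}
    (h : ∀ i, label c' i = label c (σ⁻¹ i)) : σ • c = c' :=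
  ((existsUnique_chain σ c).choose_spec.2 c' h).symm

lemma elt_eq_of_time {c c' : MaxChain (Word M N) (M + N)} (hp : chainPairs c' = chainPairs c)
    {r : Fin (M + N + 1)}
    (h : ∀ u, (chainTime c' u : ℕ) < r ↔ (chainTime c u : ℕ) < r) : c'.elt r = c.elt r := by
  rw [← word_chainFlag, ← word_chainFlag]
  refine eq_of_mem_iff_of_pairwise (P := chainPairs c) ?_ (hp ▸ (chainFlag c').pairwise_word r)
    ((chainFlag c).pairwise_word r)
  refine Word.mem_iff_mem_of_done_iff fun u => ?_
  rw [Flag.done_iff, Flag.done_iff]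
  exact h u

/-- If the two steps are the insertion and the deletion of one pair, their labels agree and the
chain is fixed. Otherwise the chain keeps its matching and exchanges two consecutive times, so at
any rank other than `i` the same letters have been treated. -/
lemma elt_swap_smul (i : ℕ) (h1 : 1 ≤ i) (hn : i < M + N) (c : MaxChain (Word M N) (M + N))
    (r : Fin (M + N + 1)) (hr : (r : ℕ) ≠ i) :
    (Equiv.swap (⟨i - 1, by omega⟩ : Fin (M + N)) ⟨i, hn⟩ • c).elt r = c.elt r := by
  set a : Fin (M + N) := ⟨i - 1, by omega⟩ with ha
  set b : Fin (M + N) := ⟨i, hn⟩ with hb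
  have hM := isMatching_chainPairs c
  have hswap : ∀ j : Fin (M + N), (Equiv.swap a b j = b ∧ j = a) ∨ (Equiv.swap a b j = a ∧ j = b) ∨
      (Equiv.swap a b j = j ∧ j ≠ a ∧ j ≠ b) := by
    intro j
    by_cases hja : j = a
    · subst hja; simp
    · by_cases hjb : j = b
      · subst hjb; simp
      · exact .inr (.inr ⟨Equiv.swap_apply_of_ne_of_ne hja hjb, hja, hjb⟩)
  by_cases hp : ∃ p ∈ chainPairs c, chainTime c (.inr p.2) = a ∧ chainTime c (.inl p.1) = b
  · obtain ⟨p, hp, hpa, hpb⟩ := hp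
    have hlab : label c a = label c b := by
      rw [← hpa, ← hpb, label_chainTime, label_chainTime, hM.letterLabel_inl hp, letterLabel_inr]
    rw [smul_eq_of_label (c' := c)]
    intro j
    rw [Equiv.swap_inv]
    rcases hswap j with ⟨h, rfl⟩ | ⟨h, rfl⟩ | ⟨h, -⟩ <;> rw [h]
    · exact hlab
    · exact hlab.symm
  -- The transposition reverses the order of `a` and `b` only, and no pair occupies these two steps.
  · have hτ : ∀ p ∈ chainPairs c, ((chainTime c).trans (Equiv.swap a b)) (.inr p.2) <
        ((chainTime c).trans (Equiv.swap a b)) (.inl p.1) := by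
      intro p hp'
      have hlt := chainTime_lt c hp'
      have hne : ¬ (chainTime c (.inr p.2) = a ∧ chainTime c (.inl p.1) = b) :=
        fun h => hp ⟨p, hp', h⟩
      simp only [Equiv.trans_apply]
      generalize chainTime c (.inr p.2) = j at *
      generalize chainTime c (.inl p.1) = k at *
      rcases hswap j with ⟨h, h'⟩ | ⟨h, h'⟩ | ⟨h, h'⟩ <;>
      rcases hswap k with ⟨g, g'⟩ | ⟨g, g'⟩ | ⟨g, g'⟩ <;> rw [h, g] <;>
      simp only [Fin.lt_def, Fin.ext_iff, ha, hb, ne_eq] at * <;> omega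
    rw [smul_eq_of_label (c' := chainOf hM _ hτ)]
    · refine elt_eq_of_time (by simp) fun u => ?_
      rw [chainTime_chainOf, Equiv.trans_apply]
      rcases hswap (chainTime c u) with ⟨h, h'⟩ | ⟨h, h'⟩ | ⟨h, h'⟩ <;> rw [h] <;>
      simp only [Fin.ext_iff, ha, hb, ne_eq] at * <;> omega
    · intro j
      rw [label_eq, label_eq, chainPairs_chainOf, chainTime_chainOf]
      rfl

lemma isLocal_chainAction :
    IsLocal (Representation.ofMulAction ℂ (Equiv.Perm (Fin (M + N)))
      (MaxChain (Word M N) (M + N))) := by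
  intro i h1 hn c c' h r hr
  rw [Representation.ofMulAction_single, MonoidAlgebra.coeff_single] at h
  rw [(Finsupp.single_apply_ne_zero.1 h).1]
  exact elt_swap_smul i h1 hn c r hr

end Shuffle

namespace SymFun

open MvPowerSeries

/-! ### Generating series of weighted sets -/

/-- The generating series of a weighted set: the sum of the monomials of its elements. -/
def genSeries {α : Type*} (w : α → ℕ →₀ ℕ) : MvPowerSeries ℕ ℂ :=
  fun m => (Nat.card {a // w a = m} : ℂ)

lemma coeff_genSeries {α : Type*} (w : α → ℕ →₀ ℕ) (m : ℕ →₀ ℕ) :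
    coeff m (genSeries w) = Nat.card {a // w a = m} := rfl

lemma genSeries_congr {α β : Type*} {w : α → ℕ →₀ ℕ} {w' : β → ℕ →₀ ℕ} (e : α ≃ β)
    (h : ∀ a, w' (e a) = w a) : genSeries w = genSeries w' := by
  ext m
  rw [coeff_genSeries, coeff_genSeries]
  congr 1
  exact Nat.card_congr (e.subtypeEquiv fun a => by rw [h])

/-- Only finitely many elements have any given weight. -/
def FiniteFibers {α : Type*} (w : α → ℕ →₀ ℕ) : Prop := ∀ m, Finite {a // w a = m}

lemma FiniteFibers.congr {α β : Type*} {w : α → ℕ →₀ ℕ} {w' : β → ℕ →₀ ℕ} (h : FiniteFibers w)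
    (e : α ≃ β) (he : ∀ a, w' (e a) = w a) : FiniteFibers w' := fun m =>
  have := h m
  Finite.of_equiv _ (e.subtypeEquiv (p := fun a => w a = m) (q := fun b => w' b = m)
    fun a => by rw [he])

lemma FiniteFibers.of_injective {α : Type*} {w : α → ℕ →₀ ℕ} (h : Function.Injective w) :
    FiniteFibers w := fun m => by
  have : Subsingleton {a // w a = m} :=
    ⟨fun a b => Subtype.ext (h (a.2.trans b.2.symm))⟩
  infer_instance

/-- The pairs of elements of given total weight, sorted by the weight of the first element. -/
def prodFiberEquiv {α β : Type*} (w : α → ℕ →₀ ℕ) (w' : β → ℕ →₀ ℕ) (m : ℕ →₀ ℕ) :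
    {p : α × β // w p.1 + w' p.2 = m} ≃
      Σ q : Finset.HasAntidiagonal.antidiagonal m, {a // w a = q.1.1} × {b // w' b = q.1.2} where
  toFun p := ⟨⟨(w p.1.1, w' p.1.2), Finset.HasAntidiagonal.mem_antidiagonal.2 p.2⟩,
    ⟨p.1.1, rfl⟩, ⟨p.1.2, rfl⟩⟩
  invFun q := ⟨(q.2.1.1, q.2.2.1), by
    rw [q.2.1.2, q.2.2.2]
    exact Finset.HasAntidiagonal.mem_antidiagonal.1 q.1.2⟩
  left_inv _ := rfl
  right_inv := by
    rintro ⟨⟨⟨m1, m2⟩, hm⟩, ⟨a, ha⟩, ⟨b, hb⟩⟩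
    dsimp only at ha hb
    subst ha hb
    rfl

lemma FiniteFibers.prod {α β : Type*} {w : α → ℕ →₀ ℕ} {w' : β → ℕ →₀ ℕ} (h : FiniteFibers w)
    (h' : FiniteFibers w') : FiniteFibers fun p : α × β => w p.1 + w' p.2 := fun m => by
  have := h
  have := h'
  unfold FiniteFibers at *
  exact Finite.of_equiv _ (prodFiberEquiv w w' m).symm

/-- Finite fibers are required because `Nat.card` of an infinite fiber is `0`, which would spoil the
sum over the antidiagonal. -/
lemma genSeries_prod {α β : Type*} {w : α → ℕ →₀ ℕ} {w' : β → ℕ →₀ ℕ} (h : FiniteFibers w)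
    (h' : FiniteFibers w') :
    genSeries (fun p : α × β => w p.1 + w' p.2) = genSeries w * genSeries w' := by
  classical
  unfold FiniteFibers at *
  ext m
  rw [coeff_mul, coeff_genSeries, Nat.card_congr (prodFiberEquiv w w' m), Nat.card_sigma,
    Nat.cast_sum, Finset.sum_coe_sort (Finset.HasAntidiagonal.antidiagonal m)
      fun q => ((Nat.card ({a // w a = q.1} × {b // w' b = q.2}) : ℕ) : ℂ)]
  refine Finset.sum_congr rfl fun q _ => ?_
  rw [Nat.card_prod, Nat.cast_mul]
  rfl

lemma genSeries_unique {α : Type*} [Unique α] (w : α → ℕ →₀ ℕ) (h : w default = 0) :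
    genSeries w = 1 := by
  classical
  ext m
  rw [coeff_genSeries, coeff_one]
  split_ifs with hm
  · subst hm
    have : Unique {a // w a = 0} := ⟨⟨default, h⟩, fun a => Subtype.ext (Subsingleton.elim _ _)⟩
    simp
  · have : IsEmpty {a // w a = m} := ⟨fun a => hm (by rw [← a.2, Subsingleton.elim a.1 default, h])⟩
    simp

/-- Both claims go into one induction, since adding a factor uses finiteness for the remaining ones.
-/
lemma genSeries_pi_aux {α : Type*} {ι : Type*} [Fintype ι] (w : ι → α → ℕ →₀ ℕ)
    (h : ∀ i, FiniteFibers (w i)) :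
    (FiniteFibers fun f : ι → α => ∑ i, w i (f i)) ∧
      genSeries (fun f : ι → α => ∑ i, w i (f i)) = ∏ i, genSeries (w i) := by
  revert w h
  refine Fintype.induction_empty_option (P := fun ι _ => ∀ w : ι → α → ℕ →₀ ℕ,
    (∀ i, FiniteFibers (w i)) → (FiniteFibers fun f : ι → α => ∑ i, w i (f i)) ∧
      genSeries (fun f : ι → α => ∑ i, w i (f i)) = ∏ i, genSeries (w i)) ?_ ?_ ?_ ι
  · intro ι κ _ e ih w h
    let := Fintype.ofEquiv _ e.symm
    obtain ⟨h1, h2⟩ := ih (fun i => w (e i)) fun i => h (e i)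
    have he : ∀ f : ι → α, ∑ i, w i ((e.arrowCongr (Equiv.refl α)) f i) =
        ∑ i, w (e i) (f i) := by
      intro f
      rw [← e.sum_comp]
      simp
    refine ⟨h1.congr (e.arrowCongr (Equiv.refl α)) he, ?_⟩
    rw [← genSeries_congr (e.arrowCongr (Equiv.refl α)) he, h2, ← e.prod_comp]
  · intro w h
    refine ⟨fun m => inferInstance, ?_⟩
    rw [genSeries_unique _ (by simp)]
    simp
  · intro ι _ ih w h
    obtain ⟨h1, h2⟩ := ih (fun i => w (some i)) fun i => h (some i)
    let e : (Option ι → α) ≃ α × (ι → α) := Equiv.piOptionEquivProd (β := fun _ => α)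
    have he : ∀ f : Option ι → α, w none (e f).1 + ∑ i, w (some i) ((e f).2 i) =
        ∑ i, w i (f i) := by
      intro f
      rw [Fintype.sum_option]
      rfl
    refine ⟨((h none).prod h1).congr e.symm fun a => ?_, ?_⟩
    · rw [← he, Equiv.apply_symm_apply]
    · rw [genSeries_congr e (w' := fun p => w none p.1 + ∑ i, w (some i) (p.2 i)) he,
        genSeries_prod (h none) h1, h2, Fintype.prod_option]

lemma FiniteFibers.pi {α ι : Type*} [Fintype ι] {w : ι → α → ℕ →₀ ℕ}
    (h : ∀ i, FiniteFibers (w i)) : FiniteFibers fun f : ι → α => ∑ i, w i (f i) :=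
  (genSeries_pi_aux w h).1

lemma genSeries_pi {α ι : Type*} [Fintype ι] {w : ι → α → ℕ →₀ ℕ}
    (h : ∀ i, FiniteFibers (w i)) :
    genSeries (fun f : ι → α => ∑ i, w i (f i)) = ∏ i, genSeries (w i) :=
  (genSeries_pi_aux w h).2

/-- The elements of given weight of a disjoint union. -/
def sigmaFiberEquiv {ι : Type*} {α : ι → Type*} (w : ∀ i, α i → ℕ →₀ ℕ) (m : ℕ →₀ ℕ) :
    {x : Σ i, α i // w x.1 x.2 = m} ≃ Σ i, {a // w i a = m} where
  toFun x := ⟨x.1.1, x.1.2, x.2⟩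
  invFun x := ⟨⟨x.1, x.2.1⟩, x.2.2⟩
  left_inv _ := rfl
  right_inv _ := rfl

lemma genSeries_sigma {ι : Type*} [Fintype ι] {α : ι → Type*} {w : ∀ i, α i → ℕ →₀ ℕ}
    (h : ∀ i, FiniteFibers (w i)) :
    genSeries (fun x : Σ i, α i => w x.1 x.2) = ∑ i, genSeries (w i) := by
  unfold FiniteFibers at h
  ext m
  rw [map_sum, coeff_genSeries, Nat.card_congr (sigmaFiberEquiv w m), Nat.card_sigma,
    Nat.cast_sum]
  rfl

lemma FiniteFibers.subtype {α : Type*} {w : α → ℕ →₀ ℕ} (h : FiniteFibers w) (p : α → Prop) :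
    FiniteFibers fun a : {a // p a} => w a := fun m => by
  have := h m
  refine Finite.of_injective (fun a : {a : {a // p a} // w a = m} => (⟨a.1.1, a.2⟩ :
    {a // w a = m})) fun a b hab => ?_
  exact Subtype.ext (Subtype.ext (congrArg (fun x : {a // w a = m} => x.1) hab))

lemma eq_genSeries_of_injective {α : Type*} {w : α → ℕ →₀ ℕ} (h : Function.Injective w)
    {f : MvPowerSeries ℕ ℂ} (h1 : ∀ a, coeff (w a) f = 1)
    (h0 : ∀ m, (¬ ∃ a, m = w a) → coeff m f = 0) : f = genSeries w := by
  ext m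
  rw [coeff_genSeries]
  by_cases hm : ∃ a, m = w a
  · obtain ⟨a, rfl⟩ := hm
    have : Unique {b // w b = w a} := ⟨⟨⟨a, rfl⟩⟩, fun b => Subtype.ext (h b.2)⟩
    simp [h1]
  · have : IsEmpty {a // w a = m} := ⟨fun a => hm ⟨a.1, a.2.symm⟩⟩
    simp [h0 m hm]

/-! ### The functions `e_1`, `e_2`, `h_1`, `h_2` and `p_r` as generating series -/

lemma coeff_homog (r : ℕ) (m : ℕ →₀ ℕ) :
    coeff m (homog r : MvPowerSeries ℕ ℂ) = if m.degree = r then 1 else 0 := rfl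

open Classical in
lemma coeff_elem (r : ℕ) (m : ℕ →₀ ℕ) :
    coeff m (elem r : MvPowerSeries ℕ ℂ) = if m.degree = r ∧ ∀ i, m i ≤ 1 then 1 else 0 := rfl

open Classical in
lemma coeff_psum (r : ℕ) (m : ℕ →₀ ℕ) :
    coeff m (psum r : MvPowerSeries ℕ ℂ) = if ∃ i, m = Finsupp.single i r then 1 else 0 := rfl

/-- The weight of a variable. -/
def varWeight (i : ℕ) : ℕ →₀ ℕ := Finsupp.single i 1

/-- The weight of a pair of variables. -/
def pairWeight (r : ℕ → ℕ → Prop) (p : {p : ℕ × ℕ // r p.1 p.2}) : ℕ →₀ ℕ :=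
  varWeight p.1.1 + varWeight p.1.2

lemma single_injective_of_pos {r : ℕ} (hr : r ≠ 0) :
    Function.Injective fun i : ℕ => Finsupp.single i r :=
  Finsupp.single_left_injective hr

lemma varWeight_injective : Function.Injective varWeight := single_injective_of_pos one_ne_zero

lemma finiteFibers_pairWeight (r : ℕ → ℕ → Prop) : FiniteFibers (pairWeight r) :=
  ((FiniteFibers.of_injective varWeight_injective).prod
    (FiniteFibers.of_injective varWeight_injective)).subtype fun p => r p.1 p.2

/-- The weight has support `{i, j}`, and `i ≤ j` makes `i` the minimum and `j` the maximum. -/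
lemma pairWeight_injective {r : ℕ → ℕ → Prop} (hr : ∀ i j, r i j → i ≤ j) :
    Function.Injective (pairWeight r) := by
  rintro ⟨⟨i, j⟩, hij⟩ ⟨⟨i', j'⟩, hij'⟩ h
  have h1 := hr i j hij
  have h2 := hr i' j' hij'
  have key : ∀ a, (a = i ∨ a = j) ↔ (a = i' ∨ a = j') := by
    intro a
    have := DFunLike.congr_fun h a
    simp only [pairWeight, varWeight, Finsupp.add_apply, Finsupp.single_apply] at this
    by_cases h1 : i = a <;> by_cases h2 : j = a <;> by_cases h3 : i' = a <;>
      by_cases h4 : j' = a <;> simp [h1, h2, h3, h4] at this <;> omega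
  have hi := (key i).1 (.inl rfl)
  have hj := (key j).1 (.inr rfl)
  have hi' := (key i').2 (.inl rfl)
  have hj' := (key j').2 (.inr rfl)
  have : i = i' ∧ j = j' := by omega
  obtain ⟨rfl, rfl⟩ := this
  rfl

lemma exists_eq_add_of_degree_eq_succ {m : ℕ →₀ ℕ} {d : ℕ} (h : m.degree = d + 1) :
    ∃ i m', m = varWeight i + m' ∧ m'.degree = d := by
  have hm : m ≠ 0 := by rintro rfl; simp at h
  obtain ⟨i, hi⟩ := Finsupp.support_nonempty_iff.2 hm
  have hle : Finsupp.single i 1 ≤ m := by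
    rw [Finsupp.single_le_iff]
    exact Nat.one_le_iff_ne_zero.2 (Finsupp.mem_support_iff.1 hi)
  refine ⟨i, m - Finsupp.single i 1, (add_tsub_cancel_of_le hle).symm, ?_⟩
  have h1 := congrArg Finsupp.degree (add_tsub_cancel_of_le hle)
  rw [map_add, Finsupp.degree_single, h] at h1
  omega

lemma degree_varWeight (i : ℕ) : (varWeight i).degree = 1 := Finsupp.degree_single _ _

lemma degree_eq_one_iff {m : ℕ →₀ ℕ} : m.degree = 1 ↔ ∃ i, m = varWeight i := by
  constructor
  · intro h
    obtain ⟨i, m', rfl, h'⟩ := exists_eq_add_of_degree_eq_succ h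
    rw [Finsupp.degree_eq_zero_iff] at h'
    exact ⟨i, by rw [h', add_zero]⟩
  · rintro ⟨i, rfl⟩
    exact degree_varWeight i

lemma degree_eq_two_iff {m : ℕ →₀ ℕ} : m.degree = 2 ↔ ∃ p, m = pairWeight (· ≤ ·) p := by
  constructor
  · intro h
    obtain ⟨i, m', rfl, h'⟩ := exists_eq_add_of_degree_eq_succ h
    obtain ⟨j, rfl⟩ := degree_eq_one_iff.1 h'
    rcases le_total i j with hij | hij
    · exact ⟨⟨(i, j), hij⟩, rfl⟩
    · exact ⟨⟨(j, i), hij⟩, add_comm _ _⟩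
  · rintro ⟨p, rfl⟩
    rw [pairWeight, map_add, degree_varWeight, degree_varWeight]

lemma homog_one_eq : (homog 1 : MvPowerSeries ℕ ℂ) = genSeries varWeight := by
  refine eq_genSeries_of_injective varWeight_injective (fun a => ?_) fun m hm => ?_
  · rw [coeff_homog, if_pos (degree_varWeight a)]
  · rw [coeff_homog, if_neg (degree_eq_one_iff.not.2 hm)]

lemma homog_two_eq : (homog 2 : MvPowerSeries ℕ ℂ) = genSeries (pairWeight (· ≤ ·)) := by
  refine eq_genSeries_of_injective (pairWeight_injective fun _ _ h => h) (fun p => ?_)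
    fun m hm => ?_
  · rw [coeff_homog, if_pos (degree_eq_two_iff.2 ⟨p, rfl⟩)]
  · rw [coeff_homog, if_neg (degree_eq_two_iff.not.2 hm)]

lemma elem_one_eq : (elem 1 : MvPowerSeries ℕ ℂ) = genSeries varWeight := by
  refine eq_genSeries_of_injective varWeight_injective (fun a => ?_) fun m hm => ?_
  · rw [coeff_elem, if_pos]
    refine ⟨degree_varWeight a, fun j => ?_⟩
    rw [varWeight, Finsupp.single_apply]
    split_ifs <;> omega
  · rw [coeff_elem, if_neg fun h => hm (degree_eq_one_iff.1 h.1)]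

lemma elem_two_eq : (elem 2 : MvPowerSeries ℕ ℂ) = genSeries (pairWeight (· < ·)) := by
  refine eq_genSeries_of_injective (pairWeight_injective fun _ _ h => h.le) (fun p => ?_)
    fun m hm => ?_
  · rw [coeff_elem, if_pos]
    obtain ⟨⟨i, j⟩, hij⟩ := p
    refine ⟨degree_eq_two_iff.2 ⟨⟨(i, j), hij.le⟩, rfl⟩, fun k => ?_⟩
    simp only [pairWeight, varWeight, Finsupp.add_apply, Finsupp.single_apply] at hij ⊢
    split_ifs <;> omega
  · rw [coeff_elem, if_neg]
    rintro ⟨h1, h2⟩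
    obtain ⟨⟨⟨i, j⟩, hij⟩, rfl⟩ := degree_eq_two_iff.1 h1
    refine hm ⟨⟨(i, j), lt_of_le_of_ne hij fun h => ?_⟩, rfl⟩
    have := h2 i
    simp only at h
    simp [pairWeight, varWeight, h] at this

lemma psum_eq {r : ℕ} (hr : r ≠ 0) :
    (psum r : MvPowerSeries ℕ ℂ) = genSeries fun i => Finsupp.single i r := by
  refine eq_genSeries_of_injective (single_injective_of_pos hr) (fun a => ?_) fun m hm => ?_
  · rw [coeff_psum, if_pos ⟨a, rfl⟩]
  · rw [coeff_psum, if_neg hm]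

end SymFun

namespace Shuffle

variable {M N : ℕ}

/-! ### Colorings of the letters -/

section Colorings

variable {P : Finset (Fin M × Fin N)}

/-- The letters are the upper letters of the pairs, the lower letters of the pairs and the
remaining letters. -/
def IsMatching.letterEquiv (hP : IsMatching P) : (P ⊕ P) ⊕ {u // Unpaired P u} ≃ Letter M N :=
  Equiv.ofBijective
    (Sum.elim (Sum.elim (fun p => .inr p.1.2) fun p => .inl p.1.1) Subtype.val) <| by
  constructor
  · rintro ((⟨p, hp⟩ | ⟨p, hp⟩) | ⟨u, hu⟩) ((⟨q, hq⟩ | ⟨q, hq⟩) | ⟨v, hv⟩) h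
    · obtain rfl := hP.eq_of_snd_eq hp hq (Sum.inr_injective h)
      rfl
    · cases h
    · exact absurd h.symm (hv.ne_inr hp)
    · cases h
    · obtain rfl := hP.eq_of_fst_eq hp hq (Sum.inl_injective h)
      rfl
    · exact absurd h.symm (hv.ne_inl hp)
    · exact absurd h (hu.ne_inr hq)
    · exact absurd h (hu.ne_inl hq)
    · obtain rfl : u = v := h
      rfl
  · intro u
    rcases letter_cases P u with ⟨p, hp, rfl⟩ | ⟨p, hp, rfl⟩ | hu
    · exact ⟨.inl (.inr ⟨p, hp⟩), rfl⟩
    · exact ⟨.inl (.inl ⟨p, hp⟩), rfl⟩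
    · exact ⟨.inr ⟨u, hu⟩, rfl⟩

/-- The colorings of the letters such that the colors of the two letters of each pair are in a
given relation. -/
abbrev Coloring (P : Finset (Fin M × Fin N)) (r : ℕ → ℕ → Prop) : Type :=
  {T : Letter M N → ℕ // ∀ p ∈ P, r (T (.inr p.2)) (T (.inl p.1))}

/-- The content of a coloring. -/
def content {ι : Type*} [Fintype ι] (T : ι → ℕ) : ℕ →₀ ℕ := ∑ i, varWeight (T i)

lemma finiteFibers_content {ι : Type*} [Fintype ι] :
    FiniteFibers (content : (ι → ℕ) → ℕ →₀ ℕ) :=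
  FiniteFibers.pi (w := fun _ : ι => varWeight) fun _ => .of_injective varWeight_injective

/-- Colorings can be chosen separately on the pairs and on the other letters. -/
def IsMatching.coloringEquiv (hP : IsMatching P) (r : ℕ → ℕ → Prop) :
    Coloring P r ≃ (P → {p : ℕ × ℕ // r p.1 p.2}) × ({u // Unpaired P u} → ℕ) where
  toFun T := (fun p => ⟨(T.1 (.inr p.1.2), T.1 (.inl p.1.1)), T.2 p.1 p.2⟩, fun u => T.1 u)
  invFun F := ⟨fun u => (Sum.elim (Sum.elim (fun p => (F.1 p).1.1) fun p => (F.1 p).1.2) F.2)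
      (hP.letterEquiv.symm u), fun p hp => by
    rw [show (Sum.inr p.2 : Letter M N) = hP.letterEquiv (.inl (.inl ⟨p, hp⟩)) from rfl,
      show (Sum.inl p.1 : Letter M N) = hP.letterEquiv (.inl (.inr ⟨p, hp⟩)) from rfl]
    beta_reduce
    rw [Equiv.symm_apply_apply, Equiv.symm_apply_apply]
    exact (F.1 ⟨p, hp⟩).2⟩
  left_inv T := by
    refine Subtype.ext (funext fun u => ?_)
    obtain ⟨v, rfl⟩ := hP.letterEquiv.surjective u
    simp only [Equiv.symm_apply_apply]
    rcases v with (p | p) | v <;> rfl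
  right_inv F := by
    refine Prod.ext (funext fun p => Subtype.ext (Prod.ext ?_ ?_)) (funext fun u => ?_)
    · change Sum.elim _ _ (hP.letterEquiv.symm (hP.letterEquiv (.inl (.inl p)))) = _
      rw [Equiv.symm_apply_apply]; rfl
    · change Sum.elim _ _ (hP.letterEquiv.symm (hP.letterEquiv (.inl (.inr p)))) = _
      rw [Equiv.symm_apply_apply]; rfl
    · change Sum.elim _ _ (hP.letterEquiv.symm (hP.letterEquiv (.inr u))) = _
      rw [Equiv.symm_apply_apply]; rfl

/-- The condition on a coloring involves each pair separately, so the series factors. With `<` the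
pairs contribute `e_2`, with `≤` they contribute `h_2`; hence `F` and `ch(ψ)` share this
computation. -/
lemma IsMatching.genSeries_coloring (hP : IsMatching P) (r : ℕ → ℕ → Prop) :
    genSeries (fun T : Coloring P r => content T.1) =
      genSeries (pairWeight r) ^ P.card * genSeries varWeight ^ (M + N - 2 * P.card) := by
  classical
  have hfin1 : ∀ _ : P, FiniteFibers (pairWeight r) := fun _ => finiteFibers_pairWeight r
  have hfin2 : ∀ _ : {u // Unpaired P u}, FiniteFibers varWeight :=
    fun _ => .of_injective varWeight_injective
  rw [genSeries_congr (hP.coloringEquiv r)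
    (w' := fun F => ∑ p, pairWeight r (F.1 p) + ∑ u, varWeight (F.2 u)),
    genSeries_prod (FiniteFibers.pi hfin1) (FiniteFibers.pi hfin2), genSeries_pi hfin1,
    genSeries_pi hfin2, Finset.prod_const, Finset.prod_const, Finset.card_univ,
    Finset.card_univ, Fintype.card_coe]
  · congr 2
    have := Fintype.card_congr hP.letterEquiv
    simp only [Fintype.card_sum, Fintype.card_coe, Fintype.card_fin] at this
    omega
  · intro T
    rw [content, ← hP.letterEquiv.sum_comp, Fintype.sum_sum_type, Fintype.sum_sum_type,
      ← Finset.sum_add_distrib]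
    rfl

end Colorings

/-! ### The number of matchings -/

section Count

open Classical in
lemma card_isMatching (k : ℕ) :
    (Finset.univ.filter fun P : Finset (Fin M × Fin N) => IsMatching P ∧ P.card = k).card =
      M.choose k * N.choose k := by
  have h : (Finset.powersetCard k (Finset.univ : Finset (Fin M)) ×ˢ
      Finset.powersetCard k (Finset.univ : Finset (Fin N))).card = M.choose k * N.choose k := by
    simp
  rw [← h]
  refine Finset.card_bij (fun P _ => (P.image Prod.fst, P.image Prod.snd)) ?_ ?_ ?_
  · intro P hP
    obtain ⟨-, hM, rfl⟩ := Finset.mem_filter.1 hP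
    simp only [Finset.mem_product, Finset.mem_powersetCard, Finset.subset_univ, true_and]
    exact ⟨Finset.card_image_of_injOn fun p hp q hq h => hM.eq_of_fst_eq hp hq h,
      Finset.card_image_of_injOn fun p hp q hq h => hM.eq_of_snd_eq hp hq h⟩
  · intro P hP Q hQ h
    simp only [Finset.mem_filter, Finset.mem_univ, true_and] at hP hQ
    exact hP.1.eq_of_image_eq hQ.1 (Prod.ext_iff.1 h).1 (Prod.ext_iff.1 h).2
  · rintro ⟨A, B⟩ h
    simp only [Finset.mem_product, Finset.mem_powersetCard, Finset.subset_univ, true_and] at h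
    -- The matching with given sets of letters pairs the `i`-th smallest of `A` with the `i`-th
    -- smallest of `B`.
    let f : Fin k → Fin M × Fin N := fun i => (A.orderEmbOfFin h.1 i, B.orderEmbOfFin h.2 i)
    have hf : Function.Injective f := fun i j hij =>
      (A.orderEmbOfFin h.1).injective (Prod.ext_iff.1 hij).1
    refine ⟨Finset.univ.image f, ?_, ?_⟩
    · simp only [Finset.mem_filter, Finset.mem_univ, true_and]
      refine ⟨?_, by rw [Finset.card_image_of_injective _ hf, Finset.card_univ, Fintype.card_fin]⟩
      intro p hp q hq
      obtain ⟨i, -, rfl⟩ := Finset.mem_image.1 hp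
      obtain ⟨j, -, rfl⟩ := Finset.mem_image.1 hq
      simp [f]
    · rw [Finset.image_image, Finset.image_image]
      refine Prod.ext ?_ ?_
      · rw [← Finset.coe_inj, Finset.coe_image, Finset.coe_univ, Set.image_univ]
        exact A.range_orderEmbOfFin h.1
      · rw [← Finset.coe_inj, Finset.coe_image, Finset.coe_univ, Set.image_univ]
        exact B.range_orderEmbOfFin h.2

lemma IsMatching.card_le {P : Finset (Fin M × Fin N)} (hP : IsMatching P) :
    P.card ≤ min M N := by
  classical
  refine le_min ?_ ?_
  · rw [← Finset.card_image_of_injOn (f := Prod.fst) fun p hp q hq h => hP.eq_of_fst_eq hp hq h]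
    exact (Finset.card_le_univ _).trans_eq (Fintype.card_fin M)
  · rw [← Finset.card_image_of_injOn (f := Prod.snd) fun p hp q hq h => hP.eq_of_snd_eq hp hq h]
    exact (Finset.card_le_univ _).trans_eq (Fintype.card_fin N)

lemma sum_isMatching {R : Type*} [AddCommGroup R] [Module ℂ R] (f : ℕ → R)
    [Fintype {P : Finset (Fin M × Fin N) // IsMatching P}] :
    ∑ P : {P : Finset (Fin M × Fin N) // IsMatching P}, f P.1.card =
      ∑ k ∈ Finset.range (min M N + 1), ((M.choose k * N.choose k : ℕ) : ℂ) • f k := by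
  classical
  rw [← Finset.sum_subtype (Finset.univ.filter fun P => IsMatching P) (by simp)
      fun P : Finset (Fin M × Fin N) => f P.card,
    ← Finset.sum_fiberwise_of_maps_to (g := Finset.card) (t := Finset.range (min M N + 1))]
  · refine Finset.sum_congr rfl fun k _ => ?_
    rw [Finset.sum_congr rfl fun P hP => by rw [(Finset.mem_filter.1 hP).2], Finset.sum_const,
      Finset.filter_filter, card_isMatching, Nat.cast_smul_eq_nsmul]
  · intro P hP
    rw [Finset.mem_range, Nat.lt_succ_iff]
    exact (Finset.mem_filter.1 hP).2.card_le

end Count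

/-! ### The flag series -/

section FlagSeries

/-- Codes are matchings with colorings. -/
def codeEquiv : Code M N ≃
    Σ P : {P : Finset (Fin M × Fin N) // IsMatching P}, Coloring P.1 (· < ·) where
  toFun c := ⟨⟨c.pairs, c.isMatching⟩, c.time, c.time_lt⟩
  invFun x := ⟨x.1.1, x.1.2, x.2.1, x.2.2⟩
  left_inv _ := rfl
  right_inv _ := rfl

lemma bordered_zero {k : ℕ} (t : Fin k → Word M N) : bordered t 0 = ⊥ := rfl

lemma bordered_succ_of_lt {k j : ℕ} (t : Fin k → Word M N) (h : j < k) :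
    bordered t (j + 1) = t ⟨j, h⟩ := by
  simp [bordered, h]

lemma bordered_succ_of_le {k j : ℕ} (t : Fin k → Word M N) (h : k ≤ j) :
    bordered t (j + 1) = ⊤ := by
  simp [bordered, h]

/-- The multichain, continued by `⊤`. -/
def multichainFlag (c : Multichain (Word M N)) : Flag M N where
  word := bordered c.t
  mono := by
    refine monotone_nat_of_le_succ fun j => ?_
    cases j with
    | zero => exact bot_le
    | succ j =>
      by_cases h : j + 1 < c.k
      · rw [bordered_succ_of_lt _ h, bordered_succ_of_lt _ (Nat.lt_of_succ_lt h)]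
        exact c.monotone (Fin.mk_le_mk.2 j.le_succ)
      · rw [bordered_succ_of_le c.t (j := j + 1) (by omega)]
        exact le_top
  zero := bordered_zero _
  exists_top := ⟨c.k + 1, bordered_succ_of_le _ le_rfl⟩

/-- The condition `t_k < ⊤` makes the length of a multichain visible in its flag, so no two
multichains give the same flag. -/
lemma multichainFlag_word_eq_top {c : Multichain (Word M N)} {j : ℕ} :
    (multichainFlag c).word (j + 1) = ⊤ ↔ c.k ≤ j := by
  refine ⟨fun h => ?_, bordered_succ_of_le c.t⟩
  by_contra! hlt
  have h1 : bordered c.t (j + 1) = ⊤ := h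
  rw [bordered_succ_of_lt _ hlt] at h1
  exact (c.lt_top _).ne h1

lemma multichainFlag_injective : Function.Injective (multichainFlag (M := M) (N := N)) := by
  intro c c' h
  have hk : c.k = c'.k := by
    refine le_antisymm ?_ ?_
    · rw [← multichainFlag_word_eq_top, h, multichainFlag_word_eq_top]
    · rw [← multichainFlag_word_eq_top, ← h, multichainFlag_word_eq_top]
  obtain ⟨k, t, _, _⟩ := c
  obtain ⟨k', t', _, _⟩ := c'
  dsimp only at hk
  subst hk
  have : t = t' := by
    funext i
    have h1 : bordered t (i + 1) = bordered t' (i + 1) := congrArg (fun w => w.word (i + 1)) h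
    rwa [bordered_succ_of_lt _ i.isLt, bordered_succ_of_lt _ i.isLt] at h1
  subst this
  rfl

lemma multichainFlag_surjective : Function.Surjective (multichainFlag (M := M) (N := N)) := by
  classical
  intro w
  have hex : ∃ k, w.word (k + 1) = ⊤ := by
    obtain ⟨r, hr⟩ := w.exists_top
    exact ⟨r, top_le_iff.1 (hr ▸ w.mono r.le_succ)⟩
  refine ⟨⟨Nat.find hex, fun i => w.word (i + 1), fun i j h => w.mono (by simpa using h),
    fun i => lt_top_iff_ne_top.2 (Nat.find_min hex i.isLt)⟩, ?_⟩
  ext1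
  funext j
  cases j with
  | zero => exact w.zero.symm
  | succ j =>
    by_cases h : j < Nat.find hex
    · exact bordered_succ_of_lt _ h
    · refine (bordered_succ_of_le _ (not_lt.1 h)).trans (top_le_iff.1 ?_).symm
      rw [← Nat.find_spec hex]
      exact w.mono (by omega)

/-- Multichains correspond to codes. -/
def multichainEquivCode : Multichain (Word M N) ≃ Code M N :=
  (Equiv.ofBijective _ ⟨multichainFlag_injective, multichainFlag_surjective⟩).trans flagEquivCode

lemma content_apply {ι : Type*} [Fintype ι] (T : ι → ℕ) (j : ℕ) :
    content T j = (Finset.univ.filter fun u => T u = j).card := by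
  rw [content, Finsupp.finsetSum_apply, Finset.card_filter]
  exact Finset.sum_congr rfl fun u _ => Finsupp.single_apply

lemma content_time (w : Flag M N) (j : ℕ) :
    content w.time j = rank (w.word (j + 1)) - rank (w.word j) := by
  classical
  rw [Flag.rank_word, Flag.rank_word, content_apply, ← Finset.card_sdiff_of_subset]
  · congr 1
    ext u
    simp only [Finset.mem_filter, Finset.mem_univ, true_and, Finset.mem_sdiff]
    omega
  · exact Finset.monotone_filter_right _ fun u _ h => Nat.lt_succ_of_lt h

lemma content_multichain (c : Multichain (Word M N)) :
    content (multichainFlag c).time = c.exponent := by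
  ext j
  rw [content_time, Multichain.exponent, Finsupp.finsetSum_apply]
  simp only [Finsupp.single_apply, Finset.sum_ite_eq', Finset.mem_range]
  split_ifs with h
  · rfl
  -- Beyond step `c.k` the flag stays at `⊤` and no letter is treated.
  · obtain ⟨i, rfl⟩ : ∃ i, j = i + 1 := ⟨j - 1, by omega⟩
    rw [multichainFlag_word_eq_top.2 (by omega), multichainFlag_word_eq_top.2 (by omega),
      Nat.sub_self]

/-- The exponent of `x_{j+1}` is a rank difference, hence the number of letters treated in step `j`.
So the monomial of a multichain is the content of its times. -/
lemma flagSeries_eq : flagSeries (Word M N) =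
    ((∑ k ∈ Finset.range (min M N + 1), ((M.choose k * N.choose k : ℕ) : ℂ) •
      (elem 2 ^ k * elem 1 ^ (M + N - 2 * k)) : symFun) : MvPowerSeries ℕ ℂ) := by
  classical
  rw [← sum_isMatching (M := M) (N := N) fun k => elem 2 ^ k * elem 1 ^ (M + N - 2 * k)]
  have h : flagSeries (Word M N) =
      genSeries (Multichain.exponent : Multichain (Word M N) → ℕ →₀ ℕ) := rfl
  rw [h, genSeries_congr (multichainEquivCode.trans codeEquiv)
    (w' := fun x => content x.2.1) content_multichain,
    genSeries_sigma fun P => finiteFibers_content.subtype _]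
  rw [AddSubmonoidClass.coe_finsetSum]
  refine Finset.sum_congr rfl fun P _ => ?_
  rw [P.2.genSeries_coloring]
  simp only [Subalgebra.coe_mul, Subalgebra.coe_pow, elem_one_eq, elem_two_eq]

end FlagSeries

end Shuffle

namespace SymFun

open MvPowerSeries Equiv.Perm

/-! ### The character of a permutation representation -/

lemma character_ofMulAction {G X : Type*} [Group G] [MulAction G X] [Finite X] (g : G) :
    (Representation.ofMulAction ℂ G X).character g = Nat.card (MulAction.fixedBy X g) := by
  classical
  have := Fintype.ofFinite X
  rw [Representation.character, LinearMap.trace_eq_matrix_trace ℂ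
    (Module.Basis.ofRepr (MonoidAlgebra.coeffLinearEquiv ℂ : MonoidAlgebra ℂ X ≃ₗ[ℂ] X →₀ ℂ)),
    Matrix.trace, Nat.card_eq_fintype_card, Fintype.card_subtype, Finset.card_filter,
    Nat.cast_sum]
  refine Finset.sum_congr rfl fun x _ => ?_
  rw [Matrix.diag_apply, LinearMap.toMatrix_apply]
  simp [Finsupp.single_apply, MonoidAlgebra.coeffLinearEquiv, MulAction.mem_fixedBy]

/-! ### The Frobenius characteristic as a sum over permutations -/

variable {n : ℕ}

/-- The cycle type of a permutation as a partition of `n`. -/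
def cyclePartition (σ : Equiv.Perm (Fin n)) : n.Partition where
  parts := σ.partition.parts
  parts_pos h := σ.partition.parts_pos h
  parts_sum := σ.partition.parts_sum.trans (Fintype.card_fin n)

lemma parts_cyclePartition (σ : Equiv.Perm (Fin n)) : (cyclePartition σ).parts =
    σ.cycleType + Multiset.replicate (n - σ.support.card) 1 := by
  rw [cyclePartition, parts_partition, Fintype.card_fin]

lemma isConj_iff_cyclePartition_eq {σ τ : Equiv.Perm (Fin n)} :
    IsConj σ τ ↔ cyclePartition σ = cyclePartition τ := by
  rw [partition_eq_of_isConj, Nat.Partition.ext_iff, Nat.Partition.ext_iff]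
  rfl

lemma cyclePartition_choose (l : n.Partition) :
    cyclePartition (exists_perm_partition l).choose = l :=
  Nat.Partition.ext (exists_perm_partition l).choose_spec

/-- `cycleType` omits fixed points; they are the parts equal to `1` and contribute the separate
factorial. -/
lemma zee_cyclePartition (σ : Equiv.Perm (Fin n)) : zee (cyclePartition σ) =
    (Fintype.card (Fin n) - σ.cycleType.sum).factorial * σ.cycleType.prod *
      ∏ i ∈ σ.cycleType.toFinset, (σ.cycleType.count i).factorial := by
  have h1 : 1 ∉ σ.cycleType := fun h => absurd (two_le_of_mem_cycleType h) (by norm_num)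
  rw [zee, parts_cyclePartition, Fintype.card_fin, sum_cycleType,
    Finset.prod_subset (s₂ := insert 1 σ.cycleType.toFinset),
    Finset.prod_insert (by simpa using h1), Multiset.count_add, Multiset.count_eq_zero.2 h1,
    Multiset.count_replicate_self, zero_add, Multiset.prod_add, Multiset.prod_replicate, one_pow,
    mul_one, mul_left_comm, mul_assoc]
  · congr 2
    refine Finset.prod_congr rfl fun i hi => ?_
    have hne : 1 ≠ i := by
      rintro rfl
      exact h1 (Multiset.mem_toFinset.1 hi)
    rw [Multiset.count_add, Multiset.count_replicate, if_neg hne, add_zero]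
  · intro i hi
    rw [Multiset.mem_toFinset, Multiset.mem_add] at hi
    rw [Finset.mem_insert, Multiset.mem_toFinset]
    exact hi.elim .inr fun h => .inl (Multiset.eq_of_mem_replicate h)
  · intro i _ hi
    rw [Multiset.mem_toFinset] at hi
    rw [Multiset.count_eq_zero.2 hi, Nat.factorial_zero]

open Classical in
lemma card_cyclePartition_eq (l : n.Partition) :
    (Finset.univ.filter fun σ : Equiv.Perm (Fin n) => cyclePartition σ = l).card * zee l =
      n.factorial := by
  obtain ⟨σ, rfl⟩ : ∃ σ : Equiv.Perm (Fin n), cyclePartition σ = l := ⟨_, cyclePartition_choose l⟩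
  have h := card_isConj_mul_eq σ
  rw [← zee_cyclePartition, Fintype.card_fin] at h
  rw [← h, Nat.card_eq_fintype_card, Fintype.card_subtype]
  congr 2
  ext τ
  simp only [Finset.mem_filter, Finset.mem_univ, true_and]
  rw [eq_comm, ← isConj_iff_cyclePartition_eq]
  rfl

/-- The permutations of cycle type `λ` number `n! / z_λ`. -/
lemma factorial_smul_frobeniusChar {ψ : Equiv.Perm (Fin n) → ℂ}
    (hψ : ∀ σ τ, IsConj σ τ → ψ σ = ψ τ) :
    (n.factorial : ℂ) • frobeniusChar ψ =
      ∑ σ : Equiv.Perm (Fin n), ψ σ • psumPartition (cyclePartition σ) := by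
  classical
  rw [frobeniusChar, Finset.smul_sum,
    ← Finset.sum_fiberwise_of_maps_to (g := cyclePartition) (t := Finset.univ) (by simp)]
  refine Finset.sum_congr rfl fun l _ => ?_
  have h1 : ∀ σ ∈ Finset.univ.filter (fun σ : Equiv.Perm (Fin n) => cyclePartition σ = l),
      ψ σ • psumPartition (cyclePartition σ) = classValue ψ l • psumPartition l := by
    intro σ hσ
    have hσ := (Finset.mem_filter.1 hσ).2
    rw [hσ, classValue, hψ σ]
    rw [isConj_iff_cyclePartition_eq, hσ, cyclePartition_choose]
  have h2 := card_cyclePartition_eq l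
  have h3 : (zee l : ℂ) ≠ 0 := by
    intro h
    rw [Nat.cast_eq_zero.1 h, mul_zero] at h2
    exact n.factorial_ne_zero h2.symm
  rw [Finset.sum_congr rfl h1, Finset.sum_const, ← Nat.cast_smul_eq_nsmul ℂ, smul_smul, smul_smul,
    ← h2, Nat.cast_mul]
  congr 1
  field_simp

/-! ### Power sums and invariant colorings -/

open Classical in
/-- The cycle of `σ` that contains a given point, or the point itself if it is fixed. -/
def cycleClass (σ : Equiv.Perm (Fin n)) (i : Fin n) :
    σ.cycleFactorsFinset ⊕ {i // i ∉ σ.support} :=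
  if h : i ∈ σ.support then .inl ⟨σ.cycleOf i, cycleOf_mem_cycleFactorsFinset_iff.2 h⟩
  else .inr ⟨i, h⟩

lemma cycleClass_eq_inl {σ : Equiv.Perm (Fin n)} {i : Fin n} {c : σ.cycleFactorsFinset} :
    cycleClass σ i = .inl c ↔ i ∈ c.1.support := by
  obtain ⟨c, hc⟩ := c
  rw [cycleClass]
  split_ifs with h
  · rw [Sum.inl.injEq, Subtype.mk.injEq]
    constructor
    · rintro rfl
      exact mem_support_cycleOf_iff.2 ⟨SameCycle.refl σ i, h⟩
    · exact fun hi => (cycle_is_cycleOf hi hc).symm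
  · refine iff_of_false (by simp) fun hi => h ?_
    exact mem_cycleFactorsFinset_support_le hc hi

lemma cycleClass_eq_inr {σ : Equiv.Perm (Fin n)} {i : Fin n} {j : {i // i ∉ σ.support}} :
    cycleClass σ i = .inr j ↔ i = j.1 := by
  obtain ⟨j, hj⟩ := j
  rw [cycleClass]
  split_ifs with h
  · refine iff_of_false (by simp) ?_
    rintro rfl
    exact hj h
  · rw [Sum.inr.injEq, Subtype.mk.injEq]

lemma cycleClass_surjective (σ : Equiv.Perm (Fin n)) : Function.Surjective (cycleClass σ) := by
  rintro (⟨c, hc⟩ | j)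
  · obtain ⟨i, hi⟩ := (mem_cycleFactorsFinset_iff.1 hc).1.nonempty_support
    exact ⟨i, cycleClass_eq_inl.2 hi⟩
  · exact ⟨j.1, cycleClass_eq_inr.2 rfl⟩

lemma cycleClass_apply (σ : Equiv.Perm (Fin n)) (i : Fin n) :
    cycleClass σ (σ i) = cycleClass σ i := by
  rcases h : cycleClass σ i with c | j
  · rw [cycleClass_eq_inl] at h ⊢
    rw [cycle_is_cycleOf h c.2, mem_support_cycleOf_iff]
    exact ⟨sameCycle_apply_right.2 (SameCycle.refl σ i),
      mem_cycleFactorsFinset_support_le c.2 h⟩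
  · rw [cycleClass_eq_inr] at h ⊢
    rw [h]
    exact notMem_support.1 j.2

lemma sameCycle_of_cycleClass_eq {σ : Equiv.Perm (Fin n)} {i j : Fin n}
    (h : cycleClass σ i = cycleClass σ j) : σ.SameCycle i j := by
  rcases h' : cycleClass σ j with c | k
  · rw [h', cycleClass_eq_inl] at h
    rw [cycleClass_eq_inl, cycle_is_cycleOf h c.2, mem_support_cycleOf_iff] at h'
    exact h'.1
  · rw [h', cycleClass_eq_inr] at h
    rw [cycleClass_eq_inr] at h'
    rw [h, h']

lemma apply_eq_of_sameCycle {α : Type*} {σ : Equiv.Perm (Fin n)} {f : Fin n → α}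
    (hf : ∀ i, f (σ i) = f i) {i j : Fin n} (h : σ.SameCycle i j) : f i = f j := by
  obtain ⟨k, hk, rfl⟩ := h.exists_pow_eq'
  clear hk
  induction k with
  | zero => rfl
  | succ k ih => rw [ih (SameCycle.refl σ i |>.trans ⟨k, rfl⟩), pow_succ', mul_apply, hf]

/-- Invariant colorings are colorings of the cycles. -/
def invariantEquiv (σ : Equiv.Perm (Fin n)) :
    (σ.cycleFactorsFinset ⊕ {i // i ∉ σ.support} → ℕ) ≃ {f : Fin n → ℕ // ∀ i, f (σ i) = f i} :=
  Equiv.ofBijective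
    (fun g => ⟨g ∘ cycleClass σ, fun i => congrArg g (cycleClass_apply σ i)⟩) <| by
  constructor
  · intro g g' h
    exact (cycleClass_surjective σ).injective_comp_right (congrArg Subtype.val h)
  · rintro ⟨f, hf⟩
    refine ⟨f ∘ Function.surjInv (cycleClass_surjective σ), Subtype.ext (funext fun i => ?_)⟩
    exact apply_eq_of_sameCycle hf (sameCycle_of_cycleClass_eq
      (Function.surjInv_eq (cycleClass_surjective σ) _))

open Classical in
lemma content_comp {ι κ : Type*} [Fintype ι] [Fintype κ] (r : ι → κ) (g : κ → ℕ) :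
    content (g ∘ r) =
      ∑ k, Finsupp.single (g k) (Finset.univ.filter fun i => r i = k).card := by
  rw [content, ← Finset.sum_fiberwise_of_maps_to (g := r) (t := Finset.univ) (by simp)]
  refine Finset.sum_congr rfl fun k _ => ?_
  rw [Finset.sum_congr rfl (g := fun _ => Finsupp.single (g k) 1) fun i hi => by
    rw [Function.comp_apply, (Finset.mem_filter.1 hi).2, varWeight], Finset.sum_const]
  simp

/-- An invariant coloring chooses one color for each cycle, and a cycle of length `r` then
contributes the `r`-th power of a variable, which sums to `p_r`. Fixed points count as cycles of
length `1`. -/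
lemma psumPartition_cyclePartition (σ : Equiv.Perm (Fin n)) :
    (psumPartition (cyclePartition σ) : MvPowerSeries ℕ ℂ) =
      genSeries fun f : {f : Fin n → ℕ // ∀ i, f (σ i) = f i} => content f.1 := by
  classical
  let d : σ.cycleFactorsFinset ⊕ {i // i ∉ σ.support} → ℕ :=
    Sum.elim (fun c => c.1.support.card) fun _ => 1
  have hd : ∀ k, (Finset.univ.filter fun i => cycleClass σ i = k).card = d k := by
    rintro (c | j)
    · simp only [cycleClass_eq_inl, d]
      congr 1
      ext i
      simp
    · simp only [cycleClass_eq_inr, d]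
      rw [Finset.filter_eq' , if_pos (Finset.mem_univ _)]
      rfl
  have hd0 : ∀ k, d k ≠ 0 := by
    intro k h
    obtain ⟨i, hi⟩ := cycleClass_surjective σ k
    rw [← hd, Finset.card_eq_zero] at h
    exact Finset.filter_eq_empty_iff.1 h (Finset.mem_univ i) hi
  rw [← genSeries_congr (invariantEquiv σ) (w := fun g => ∑ k, Finsupp.single (g k) (d k)),
    genSeries_pi (w := fun k i => Finsupp.single i (d k))
      (fun k => .of_injective (single_injective_of_pos (hd0 k))),
    Finset.prod_congr rfl fun k _ => (psum_eq (hd0 k)).symm, Fintype.prod_sum_type]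
  · rw [psumPartition, parts_cyclePartition, Multiset.map_add, Multiset.prod_add,
      Multiset.map_replicate, Multiset.prod_replicate, cycleType_def, Multiset.map_map,
      Subalgebra.coe_mul, Subalgebra.coe_pow]
    congr 1
    · simp only [d, Sum.elim_inl]
      rw [Finset.prod_coe_sort σ.cycleFactorsFinset
        (fun c => ((psum c.support.card : symFun) : MvPowerSeries ℕ ℂ))]
      exact map_multiset_prod symFun.val _ |>.trans (by rw [Multiset.map_map]; rfl)
    · simp only [d, Sum.elim_inr, Finset.prod_const, Finset.card_univ]
      congr 1
      rw [Fintype.card_subtype_compl, Fintype.card_fin, Fintype.card_coe]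
  · intro g
    change content (g ∘ cycleClass σ) = _
    rw [content_comp]
    refine Finset.sum_congr rfl fun k _ => ?_
    rw [← hd]
    congr!

/-! ### Counting orbits -/

/-- The colorings of `n` points with given content. -/
abbrev ContentColoring (n : ℕ) (m : ℕ →₀ ℕ) : Type := {f : Fin n → ℕ // content f = m}

instance (m : ℕ →₀ ℕ) : Finite (ContentColoring n m) := finiteFibers_content m

lemma content_comp_equiv {ι κ : Type*} [Fintype ι] [Fintype κ] (f : κ → ℕ) (e : ι ≃ κ) :
    content (f ∘ e) = content f :=
  e.sum_comp fun i => varWeight (f i)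

instance (m : ℕ →₀ ℕ) : MulAction (Equiv.Perm (Fin n)) (ContentColoring n m) where
  smul σ f := ⟨f.1 ∘ (σ⁻¹ : Equiv.Perm (Fin n)), (content_comp_equiv f.1 _).trans f.2⟩
  one_smul _ := rfl
  mul_smul _ _ _ := rfl

lemma smul_contentColoring_apply {m : ℕ →₀ ℕ} (σ : Equiv.Perm (Fin n)) (f : ContentColoring n m)
    (i : Fin n) : (σ • f).1 i = f.1 (σ⁻¹ i) := rfl

lemma smul_contentColoring_eq_iff {m : ℕ →₀ ℕ} {σ : Equiv.Perm (Fin n)}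
    {f f' : ContentColoring n m} : σ • f = f' ↔ ∀ i, f'.1 (σ i) = f.1 i := by
  rw [Subtype.ext_iff, funext_iff, ← σ.forall_congr_right]
  simp [smul_contentColoring_apply, eq_comm]

/-- The coefficients of the Frobenius characteristic of a permutation representation count
orbits. -/
theorem coeff_frobeniusChar_ofMulAction {X : Type*} [Finite X]
    [MulAction (Equiv.Perm (Fin n)) X] (m : ℕ →₀ ℕ) :
    coeff m (frobeniusChar (Representation.ofMulAction ℂ (Equiv.Perm (Fin n)) X).character :
      MvPowerSeries ℕ ℂ) =
      Nat.card (MulAction.orbitRel.Quotient (Equiv.Perm (Fin n)) (X × ContentColoring n m)) := by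
  classical
  have hψ : ∀ σ τ : Equiv.Perm (Fin n), IsConj σ τ →
      (Representation.ofMulAction ℂ (Equiv.Perm (Fin n)) X).character σ =
        (Representation.ofMulAction ℂ (Equiv.Perm (Fin n)) X).character τ := by
    intro σ τ h
    obtain ⟨g, rfl⟩ := isConj_iff.1 h
    exact (Representation.char_conj _ _ _).symm
  have h1 := congrArg (fun f : symFun => coeff m (f : MvPowerSeries ℕ ℂ))
    (factorial_smul_frobeniusChar hψ)
  simp only [AddSubmonoidClass.coe_finsetSum, map_sum, Subalgebra.coe_smul, map_smul,
    psumPartition_cyclePartition, character_ofMulAction, coeff_genSeries, smul_eq_mul] at h1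
  have := Fintype.ofFinite X
  have := Fintype.ofFinite (ContentColoring n m)
  -- Burnside's lemma for the diagonal action; by `h3` below, its fixed points are the products of
  -- the fixed points counted in `h1`.
  have h2 := MulAction.sum_card_fixedBy_eq_card_orbits_mul_card_group
    (Equiv.Perm (Fin n)) (X × ContentColoring n m)
  have h3 : ∀ σ : Equiv.Perm (Fin n),
      (Nat.card (MulAction.fixedBy X σ) : ℂ) *
        Nat.card {f : {f : Fin n → ℕ // ∀ i, f (σ i) = f i} // content f.1 = m} =
      (Fintype.card (MulAction.fixedBy (X × ContentColoring n m) σ) : ℂ) := by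
    intro σ
    rw [← Nat.cast_mul, ← Nat.card_prod, ← Nat.card_eq_fintype_card]
    congr 1
    refine Nat.card_congr
      { toFun := fun p => ⟨(p.1.1, ⟨p.2.1.1, p.2.2⟩), Prod.ext p.1.2
          (smul_contentColoring_eq_iff.2 p.2.1.2)⟩
        invFun := fun q => (⟨q.1.1, congrArg Prod.fst q.2⟩, ⟨⟨q.1.2.1,
          smul_contentColoring_eq_iff.1 (congrArg Prod.snd q.2)⟩, q.1.2.2⟩)
        left_inv := fun _ => rfl
        right_inv := fun _ => rfl }
  rw [Finset.sum_congr rfl fun σ _ => h3 σ, ← Nat.cast_sum, h2, Fintype.card_perm,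
    Fintype.card_fin, Nat.cast_mul, mul_comm] at h1
  rw [mul_right_cancel₀ (Nat.cast_ne_zero.2 n.factorial_ne_zero) h1, ← Nat.card_eq_fintype_card]

end SymFun

namespace Shuffle

variable {M N : ℕ}

attribute [local instance] chainAction

instance : Finite (MaxChain (Word M N) (M + N)) := .of_injective label label_injective

/-! ### Orbits of colored maximal chains -/

/-- Two colorings that increase on all pairs and differ by a permutation which preserves the
labels are equal. -/
lemma IsMatching.eq_of_comp_eq {P : Finset (Fin M × Fin N)} (hP : IsMatching P)
    {T T' : Coloring P (· ≤ ·)} {e : Equiv.Perm (Letter M N)}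
    (he : ∀ u, letterLabel P (e u) = letterLabel P u) (h : ∀ u, T'.1 u = T.1 (e u)) : T = T' := by
  have key : ∀ p ∈ P, T.1 (.inl p.1) = T'.1 (.inl p.1) ∧ T.1 (.inr p.2) = T'.1 (.inr p.2) := by
    intro p hp
    have h1 := hP.letterLabel_eq_inr hp (he (.inr p.2))
    have h2 := hP.letterLabel_eq_inr hp ((he (.inl p.1)).trans (hP.letterLabel_inl hp))
    have h3 := T.2 p hp
    have h4 := T'.2 p hp
    rw [h, h] at h4 ⊢
    -- On a pair `e` is the identity or the exchange. In the latter case both colorings increase on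
    -- the pair, so its two colors agree.
    rcases h1 with h1 | h1 <;> rcases h2 with h2 | h2
    · exact absurd (e.injective (h1.trans h2.symm)) (by simp)
    · rw [h1, h2]
      exact ⟨rfl, rfl⟩
    · rw [h1, h2] at h4 ⊢
      exact ⟨le_antisymm h4 h3, le_antisymm h3 h4⟩
    · exact absurd (e.injective (h1.trans h2.symm)) (by simp)
  refine Subtype.ext (funext fun u => ?_)
  rcases letter_cases P u with ⟨p, hp, rfl⟩ | ⟨p, hp, rfl⟩ | hu
  · exact (key p hp).1
  · exact (key p hp).2
  · rw [h, hu.eq_of_letterLabel_eq hP ((he u).trans hu.letterLabel_eq)]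

variable {m : ℕ →₀ ℕ}

/-- A maximal chain of which the steps are colored. -/
abbrev ColoredChain (M N : ℕ) (m : ℕ →₀ ℕ) : Type :=
  MaxChain (Word M N) (M + N) × ContentColoring (M + N) m

/-- A permutation of the letters which makes the coloring increasing on all pairs. -/
def sorting (x : ColoredChain M N m) : Equiv.Perm (Letter M N) :=
  ((isMatching_chainPairs x.1).exists_perm_le fun u => x.2.1 (chainTime x.1 u)).choose

lemma letterLabel_sorting (x : ColoredChain M N m) (u : Letter M N) :
    letterLabel (chainPairs x.1) (sorting x u) = letterLabel (chainPairs x.1) u :=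
  ((isMatching_chainPairs x.1).exists_perm_le fun u => x.2.1 (chainTime x.1 u)).choose_spec.1 u

lemma letterLabel_sorting_symm (x : ColoredChain M N m) (u : Letter M N) :
    letterLabel (chainPairs x.1) ((sorting x).symm u) = letterLabel (chainPairs x.1) u := by
  rw [← letterLabel_sorting, Equiv.apply_symm_apply]

/-- The coloring of the letters given by a coloring of the steps of a maximal chain. -/
def letterColoring (x : ColoredChain M N m) : Coloring (chainPairs x.1) (· ≤ ·) :=
  ⟨fun u => x.2.1 (chainTime x.1 (sorting x u)),
    ((isMatching_chainPairs x.1).exists_perm_le fun u =>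
      x.2.1 (chainTime x.1 u)).choose_spec.2⟩

lemma content_letterColoring (x : ColoredChain M N m) : content (letterColoring x).1 = m :=
  (content_comp_equiv x.2.1 ((sorting x).trans (chainTime x.1))).trans x.2.2

variable (M N m) in
/-- The matchings with a coloring of the letters that increases on all pairs. -/
abbrev ColoredMatching : Type :=
  {x : Σ P : {P : Finset (Fin M × Fin N) // IsMatching P}, Coloring P.1 (· ≤ ·) //
    content x.2.1 = m}

/-- The matching and the coloring of the letters of a colored maximal chain. -/
def coloredMatching (x : ColoredChain M N m) : ColoredMatching M N m :=
  ⟨⟨⟨chainPairs x.1, isMatching_chainPairs x.1⟩, letterColoring x⟩, content_letterColoring x⟩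

/-- The permutation `sorting` is an arbitrary choice. By uniqueness of the increasing coloring, any
label-preserving rearrangement `e` that produces an increasing coloring computes the same result. -/
lemma coloredMatching_eq {x : ColoredChain M N m} {y : ColoredMatching M N m}
    (hp : chainPairs x.1 = y.1.1.1) (e : Equiv.Perm (Letter M N))
    (he : ∀ u, letterLabel (chainPairs x.1) (e u) = letterLabel (chainPairs x.1) u)
    (h : ∀ u, y.1.2.1 u = x.2.1 (chainTime x.1 (e u))) : coloredMatching x = y := by
  obtain ⟨⟨⟨P, hP⟩, T⟩, hT⟩ := y
  dsimp only at hp h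
  subst hp
  have hM := isMatching_chainPairs x.1
  have : letterColoring x = T := by
    refine hM.eq_of_comp_eq (e := e.trans (sorting x).symm) (fun u => ?_) fun u => ?_
    · rw [Equiv.trans_apply, letterLabel_sorting_symm, he]
    · rw [h, Equiv.trans_apply]
      change _ = x.2.1 (chainTime x.1 (sorting x ((sorting x).symm (e u))))
      rw [Equiv.apply_symm_apply]
  subst this
  rfl

lemma coloredMatching_smul (σ : Equiv.Perm (Fin (M + N))) (x : ColoredChain M N m) :
    coloredMatching (σ • x) = coloredMatching x := by
  have hp : chainPairs (σ • x.1) = chainPairs x.1 :=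
    chainPairs_eq_of_label σ fun i => by simp [label_smul]
  refine (coloredMatching_eq (y := coloredMatching (σ • x)) hp.symm
    ((sorting (σ • x)).trans
      ((chainTime (σ • x.1)).trans ((σ⁻¹).trans (chainTime x.1).symm))) (fun u => ?_)
      fun u => ?_).symm
  · have h := letterLabel_sorting (σ • x) u
    rw [Prod.smul_fst, hp] at h
    simp only [Equiv.trans_apply]
    rw [← label_eq, ← label_smul, label_chainTime, hp, h]
  · simp only [Equiv.trans_apply, Equiv.apply_symm_apply]
    rfl

/-- Let `σ` send the step of each sorted letter of `x` to the step of the corresponding sorted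
letter of `y`. It matches the colors by hypothesis and the labels because sorting preserves them. -/
lemma exists_smul_eq_of_coloredMatching_eq {x y : ColoredChain M N m}
    (h : coloredMatching x = coloredMatching y) : ∃ σ : Equiv.Perm (Fin (M + N)), σ • x = y := by
  have hp : chainPairs x.1 = chainPairs y.1 := congrArg (fun z => z.1.1.1) h
  have hT : ∀ u, x.2.1 (chainTime x.1 (sorting x u)) = y.2.1 (chainTime y.1 (sorting y u)) :=
    fun u => congrArg (fun z : ColoredMatching M N m => z.1.2.1 u) h
  let σ : Equiv.Perm (Fin (M + N)) := (chainTime x.1).symm.trans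
    ((sorting x).symm.trans ((sorting y).trans (chainTime y.1)))
  have hσ : ∀ u, σ (chainTime x.1 (sorting x u)) = chainTime y.1 (sorting y u) := fun u => by
    simp [σ]
  have hsurj : ∀ i, ∃ u, chainTime x.1 (sorting x u) = i := fun i =>
    ((sorting x).trans (chainTime x.1)).surjective i
  refine ⟨σ, Prod.ext (smul_eq_of_label fun i => ?_) (smul_contentColoring_eq_iff.2 fun i => ?_)⟩
  · obtain ⟨j, rfl⟩ := σ.surjective i
    obtain ⟨u, rfl⟩ := hsurj j
    rw [show σ⁻¹ (σ _) = _ from σ.symm_apply_apply _, hσ, label_chainTime, label_chainTime,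
      letterLabel_sorting, letterLabel_sorting, hp]
  · obtain ⟨u, rfl⟩ := hsurj i
    rw [hσ, hT]

lemma coloredMatching_surjective :
    Function.Surjective (coloredMatching : ColoredChain M N m → ColoredMatching M N m) := by
  rintro ⟨⟨⟨P, hP⟩, T⟩, hT⟩
  -- Any chain with the matching `P` will do, so the initial arrangement of the labels is arbitrary.
  obtain ⟨c, rfl, -⟩ := hP.exists_chain finSumFinEquiv
  refine ⟨(c, ⟨T.1 ∘ (chainTime c).symm, (content_comp_equiv _ _).trans hT⟩),
    coloredMatching_eq rfl (Equiv.refl _) (fun _ => rfl) fun u => ?_⟩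
  simp

/-- The orbits of colored maximal chains. -/
def orbitEquiv : MulAction.orbitRel.Quotient (Equiv.Perm (Fin (M + N))) (ColoredChain M N m) ≃
    ColoredMatching M N m :=
  Equiv.ofBijective (Quotient.lift coloredMatching fun x y h => by
    obtain ⟨σ, rfl⟩ := MulAction.orbitRel_apply.1 h
    exact coloredMatching_smul σ y) <| by
  constructor
  · rintro ⟨x⟩ ⟨y⟩ h
    obtain ⟨σ, hσ⟩ := exists_smul_eq_of_coloredMatching_eq h
    exact (Quotient.sound (MulAction.orbitRel_apply.2 ⟨σ, hσ⟩)).symm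
  · intro z
    obtain ⟨x, rfl⟩ := coloredMatching_surjective z
    exact ⟨⟦x⟧, rfl⟩

/-- Coefficients count orbits, orbits are matchings with weakly increasing colorings, and these have
the series `h_2 ^ k * h_1 ^ (M + N - 2 * k)` for each matching with `k` pairs. -/
lemma frobeniusChar_chainAction :
    frobeniusChar (Representation.ofMulAction ℂ (Equiv.Perm (Fin (M + N)))
        (MaxChain (Word M N) (M + N))).character =
      ∑ k ∈ Finset.range (min M N + 1), ((M.choose k * N.choose k : ℕ) : ℂ) •
        (homog 2 ^ k * homog 1 ^ (M + N - 2 * k)) := by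
  classical
  refine Subtype.ext (MvPowerSeries.ext fun m => ?_)
  rw [coeff_frobeniusChar_ofMulAction, Nat.card_congr orbitEquiv,
    ← coeff_genSeries fun x : Σ P : {P : Finset (Fin M × Fin N) // IsMatching P},
      Coloring P.1 (· ≤ ·) => content x.2.1,
    genSeries_sigma fun P => finiteFibers_content.subtype _,
    ← sum_isMatching (M := M) (N := N) fun k => homog 2 ^ k * homog 1 ^ (M + N - 2 * k),
    AddSubmonoidClass.coe_finsetSum]
  congr 1
  refine Finset.sum_congr rfl fun P _ => ?_
  rw [P.2.genSeries_coloring]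
  simp only [Subalgebra.coe_mul, Subalgebra.coe_pow, homog_one_eq, homog_two_eq]

end Shuffle

lemma SymFun.omega_sum_elem (s : Finset ℕ) (c : ℕ → ℂ) (d : ℕ → ℕ) :
    omega (∑ k ∈ s, c k • (elem 2 ^ k * elem 1 ^ d k)) =
      ∑ k ∈ s, c k • (homog 2 ^ k * homog 1 ^ d k) := by
  simp only [map_sum, map_smul, map_mul, map_pow, omega_elem 1, omega_elem 0]

end

theorem corollary4p5 (M N : ℕ) :
    -- every permutation of every label sequence is the label sequence of exactly one maximal chain
    (∀ (σ : Equiv.Perm (Fin (M + N))) (c : MaxChain (Word M N) (M + N)),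
      ∃! c' : MaxChain (Word M N) (M + N), ∀ i, label c' i = label c (σ⁻¹ i)) ∧
    -- so that permuting the coordinates of label sequences is an action on the maximal chains
    ∃ _ : MulAction (Equiv.Perm (Fin (M + N))) (MaxChain (Word M N) (M + N)),
      (∀ (σ : Equiv.Perm (Fin (M + N))) (c : MaxChain (Word M N) (M + N)) (i : Fin (M + N)),
        label (σ • c) i = label c (σ⁻¹ i)) ∧
      -- the action is local
      IsLocal (Representation.ofMulAction ℂ (Equiv.Perm (Fin (M + N)))
        (MaxChain (Word M N) (M + N))) ∧
      -- the Frobenius characteristic of its character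
      frobeniusChar (Representation.ofMulAction ℂ (Equiv.Perm (Fin (M + N)))
          (MaxChain (Word M N) (M + N))).character =
        ∑ k ∈ Finset.range (min M N + 1),
          ((M.choose k * N.choose k : ℕ) : ℂ) • (homog 2 ^ k * homog 1 ^ (M + N - 2 * k)) ∧
      -- `F` is a symmetric function, `ch(ψ) = ω F`, and `F` is given explicitly
      ∃ hF : flagSeries (Word M N) ∈ symFun,
        frobeniusChar (Representation.ofMulAction ℂ (Equiv.Perm (Fin (M + N)))
            (MaxChain (Word M N) (M + N))).character =
          omega ⟨flagSeries (Word M N), hF⟩ ∧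
        (⟨flagSeries (Word M N), hF⟩ : symFun) =
          ∑ k ∈ Finset.range (min M N + 1),
            ((M.choose k * N.choose k : ℕ) : ℂ) • (elem 2 ^ k * elem 1 ^ (M + N - 2 * k)) := by
  have hF : (⟨flagSeries (Word M N), flagSeries_eq (M := M) (N := N) ▸ Subtype.prop _⟩ : symFun) =
      ∑ k ∈ Finset.range (min M N + 1), ((M.choose k * N.choose k : ℕ) : ℂ) •
        (elem 2 ^ k * elem 1 ^ (M + N - 2 * k)) := Subtype.ext flagSeries_eq
  refine ⟨existsUnique_chain, chainAction, label_smul, isLocal_chainAction,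
    frobeniusChar_chainAction, _, ?_, hF⟩
  rw [hF, omega_sum_elem]
  exact frobeniusChar_chainAction
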